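/- Let $n\ge 0$ and write $\rho=(x,\xi)$ for points of $\mathbf R^{2n}$. Let $r,R$ be positive smooth functions on $\mathbf R^n$ with $r\ge 1$, $rR\ge 1$, and put $\widetilde r(x,\xi)=(r(x)^2+|\xi|^2)^{1/2}$. For a positive function $w$ on $\mathbf R^{2n}$, let $S(w)$ be the space of $a\in C^\infty(\mathbf R^{2n})$ such that for all multi-indices $\alpha,\beta$ there is a constant $C_{\alpha,\beta}$ with $$|\partial_x^\alpha\partial_\xi^\beta a|\le C_{\alpha,\beta}\,w\,R^{-|\alpha|}\widetilde r^{\,-|\beta|}\quad\text{on }\mathbf R^{2n}.$$ Functions of $x$ are regarded as functions on $\mathbf R^{2n}$. Assume $r\in S(r)$, $R\in S(R)$, and let $1\le m_0(x)\in S(m_0)$. Let $g=(d\xi/\widetilde r)^2+(dx/R)^2$ and write $\|\cdot\|_g$ for the norm of tangent vectors. Let $P=\sum_{|\alpha|\le N_0}\sum_{k=0}^{N_0-|\alpha|}h^k a_{\alpha,k}(x)(hD_x)^\alpha$, with $a_{\alpha,k}\in S(m_0r^{-|\alpha|}(rR)^{-k})$, be a formally self-adjoint semiclassical differential operator ($0<h\le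 1$), so that $p(x,\xi)=\sum_{|\alpha|\le N_0}a_{\alpha,0}(x)\xi^\alpha$ and $p_{\rm class}(x,\xi)=\sum_{|\alpha|=N_0}a_{\alpha,0}(x)\xi^\alpha$ are real-valued. Put $m=m_0(\widetilde r/r)^{N_0}$ and assume $p_{\rm class}(x,\xi)\ge m_0(x)(|\xi|/r(x))^{N_0}$ on $\mathbf R^{2n}$. Let $H_a=\partial_\xi a\cdot\partial_x-\partial_xa\cdot\partial_\xi$ denote Hamilton fields, $\Sigma_0=p^{-1}(0)$, and $\Sigma_{[-\epsilon,\epsilon]}=\{\rho:\ |p(\rho)|\le\epsilon\}$. Assume that for every $r_0>0$ there is $\epsilon>0$ such that $|p|\ge\epsilon m$ outside $\bigcup_{\rho\in\Sigma_0}B_{g(\rho)}(\rho,r_0)$, where $B_{g(\rho)}(\rho,r_0)$ is the open ball of center $\rho$ and radius $r_0$ for the constant metric $g(\rho)$. Let $G\in S(\widetilde rR)$ be a real-valued escape function: there are $C_0>0$ and a compact set $K_0\subset\mathbf R^{2n}$ with $H_pG\ge m/C_0$ on $\Sigma_0\setminus K_0$. Then for all sufficiently small $\epsilon_0>0$ the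 following holds: $$(\ast)\qquad\text{there are } C_0>0 \text{ and a compact set } K \text{ such that } H_pG\ge m/C_0\text{ on }\Sigma_{[-\epsilon_0,\epsilon_0]}\setminus K .$$ Fix any $\epsilon_0>0$ for which $(\ast)$ holds and write $\Sigma=\Sigma_{[-\epsilon_0,\epsilon_0]}$. For $\rho\in\Sigma$ let $]-\tau_-(\rho),\tau_+(\rho)[\,\ni t\mapsto\exp(tH_p)(\rho)$ be the maximal integral curve of $H_p$ through $\rho$, and set $$\Gamma_\pm=\{\rho\in\Sigma:\ \exp(tH_p)(\rho)\not\to\infty\text{ as }t\to\mp\tau_\mp(\rho)\},$$ where tending to infinity means eventually leaving every compact set. Let $\widetilde K\subset\Sigma$ be a compact set containing the trapped set $\Gamma_+\cap\Gamma_-$, and set $$\Gamma_\pm(\widetilde K)=\Gamma_\pm\cup\{\exp(\pm tH_p)(\rho):\ \rho\in\widetilde K,\ 0\le t<\tau_\pm(\rho)\},\qquad \widehat{\widetilde K}=\Gamma_+(\widetilde K)\cap\Gamma_-(\widetilde K).$$ Then the $H_p$-convex hull $\widehat{\widetilde K}$ of $\widetilde K$ is a compact subset of $\Sigma$, and for every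 neighborhood $U$ of $\widehat{\widetilde K}$ there is a real-valued function $\widetilde G\in S(\widetilde rR)$, equal to $G$ outside a bounded set, such that: 1. $C^{-1}m\|H_{\widetilde G}\|_g\le H_p\widetilde G\le C\,m\|H_{\widetilde G}\|_g$ on $\Sigma$ for some constant $C>0$; 2. $H_p\widetilde G>0$ on $\Sigma\setminus U$; 3. $\widetilde G=0$ in a neighborhood of $\widehat{\widetilde K}$; 4. if moreover $C^{-1}\le m\le C$ on $\Sigma$ for some constant $C>0$, then for every $\chi\in C_0^\infty(]-\epsilon_0,\epsilon_0[;[0,1])$ equal to $1$ on $[-\epsilon_0/2,\epsilon_0/2]$, the function $G^0=\chi(p)\widetilde G$ belongs to $S(\widetilde rR)$ and there is a constant $C>0$ with $$H_pG^0\ge\frac mC\,\|H_{G^0}\|_g^2\quad\text{on }\mathbf R^{2n}.$$ -/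

import Mathlib

open Set Filter Topology MeasureTheory
open scoped ContDiff ComplexConjugate

noncomputable section

namespace Escape

/-- Configuration space `ℝⁿ` with its Euclidean norm. -/
abbrev Config (n : ℕ) : Type := EuclideanSpace ℝ (Fin n)

/-- Phase space `ℝ²ⁿ`, with points `ρ = (x, ξ)`. -/
abbrev Phase (n : ℕ) : Type := Config n × Config n

/-- The scale `r̃(x, ξ) = (r(x)² + |ξ|²)^{1/2}`. -/
def rTilde {n : ℕ} (r : Config n → ℝ) (ρ : Phase n) : ℝ :=
  Real.sqrt (r ρ.1 ^ 2 + ‖ρ.2‖ ^ 2)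

/-- The coordinate directions of phase space: `Sum.inl i` is `∂/∂xᵢ`, `Sum.inr i` is `∂/∂ξᵢ`. -/
def coordVec {n : ℕ} : Fin n ⊕ Fin n → Phase n
  | Sum.inl i => (EuclideanSpace.single i 1, 0)
  | Sum.inr i => (0, EuclideanSpace.single i 1)

/-- The scale that belongs to a coordinate direction: `R(x)` for `∂/∂xᵢ`, `r̃(x, ξ)` for
`∂/∂ξᵢ`. -/
def coordScale {n : ℕ} (r R : Config n → ℝ) (ρ : Phase n) : Fin n ⊕ Fin n → ℝ
  | Sum.inl _ => R ρ.1
  | Sum.inr _ => rTilde r ρ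

/-- The estimate `|∂_x^α ∂_ξ^β a| ≤ C w R^{-|α|} r̃^{-|β|}` on all of phase space, for some constant
`C`. The mixed partial derivative is given by the word `I` of the `k = |α| + |β|` coordinate
directions in which one differentiates; mixed partials of smooth functions commute, so that all
words together are the same as all pairs `(α, β)`. -/
def SymbolEstimate {n : ℕ} {F : Type*} [NormedAddCommGroup F] [NormedSpace ℝ F]
    (r R : Config n → ℝ) (w : Phase n → ℝ) (a : Phase n → F) (k : ℕ)
    (I : Fin k → Fin n ⊕ Fin n) : Prop :=
  ∃ C : ℝ, ∀ ρ : Phase n,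
    ‖iteratedFDeriv ℝ k a ρ (fun j => coordVec (I j))‖
      ≤ C * w ρ * ∏ j, (coordScale r R ρ (I j))⁻¹

/-- The symbol space `S(w)`. -/
def SymbolClass {n : ℕ} {F : Type*} [NormedAddCommGroup F] [NormedSpace ℝ F]
    (r R : Config n → ℝ) (w : Phase n → ℝ) (a : Phase n → F) : Prop :=
  ContDiff ℝ ∞ a ∧ ∀ (k : ℕ) (I : Fin k → Fin n ⊕ Fin n), SymbolEstimate r R w a k I

/-- The space `Ṡ(w)`: the estimates of `S(w)` are required for derivatives of order at least one
only. -/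
def SymbolClassDot {n : ℕ} {F : Type*} [NormedAddCommGroup F] [NormedSpace ℝ F]
    (r R : Config n → ℝ) (w : Phase n → ℝ) (a : Phase n → F) : Prop :=
  ContDiff ℝ ∞ a ∧ ∀ (k : ℕ) (I : Fin k → Fin n ⊕ Fin n), k ≠ 0 → SymbolEstimate r R w a k I

/-- The standing assumptions on the scale functions: `r`, `R` are positive and smooth, `r ≥ 1`,
`r R ≥ 1`, `r ∈ S(r)` and `R ∈ S(R)`. -/
structure IsScalePair {n : ℕ} (r R : Config n → ℝ) : Prop where
  R_pos : ∀ x, 0 < R x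
  one_le_r : ∀ x, 1 ≤ r x
  one_le_rR : ∀ x, 1 ≤ r x * R x
  symbol_r : SymbolClass r R (fun ρ : Phase n => r ρ.1) (fun ρ : Phase n => r ρ.1)
  symbol_R : SymbolClass r R (fun ρ : Phase n => R ρ.1) (fun ρ : Phase n => R ρ.1)

/-- The weight `m₀` is smooth, `m₀ ≥ 1` and `m₀ ∈ S(m₀)`. -/
structure IsBaseWeight {n : ℕ} (r R m₀ : Config n → ℝ) : Prop where
  one_le : ∀ x, 1 ≤ m₀ x
  symbol : SymbolClass r R (fun ρ : Phase n => m₀ ρ.1) (fun ρ : Phase n => m₀ ρ.1)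

/-- The norm `‖v‖_{g(ρ)}` of a vector for the metric `g = (dξ / r̃)² + (dx / R)²`. -/
def gNorm {n : ℕ} (r R : Config n → ℝ) (ρ v : Phase n) : ℝ :=
  Real.sqrt ((‖v.1‖ / R ρ.1) ^ 2 + (‖v.2‖ / rTilde r ρ) ^ 2)

/-- The open ball `B_{g(ρ)}(ρ, δ)` for the constant metric `g(ρ)`. -/
def gBall {n : ℕ} (r R : Config n → ℝ) (ρ : Phase n) (δ : ℝ) : Set (Phase n) :=
  {ν | gNorm r R ρ (ν - ρ) < δ}

/-! ### Semiclassical differential operators -/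

/-- The partial derivative `∂^α u`. -/
def partialDeriv {n : ℕ} (α : Fin n → ℕ) (u : Config n → ℂ) : Config n → ℂ :=
  (List.finRange n).foldr
    (fun i f => (fun (w : Config n → ℂ) (x : Config n) =>
      fderiv ℝ w x (EuclideanSpace.single i 1))^[α i] f) u

/-- Coefficient data of a semiclassical differential operator
`P = ∑_{|α| ≤ N} ∑_{k ≤ N - |α|} h^k a_{α,k}(x) (hD)^α`, `D = -i∂`. Only the coefficients with
`|α| + k ≤ N` are ever used. -/
structure SemiclassicalOperator (n : ℕ) where
  N : ℕ
  a : (Fin n → ℕ) → ℕ → Config n → ℂ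

namespace SemiclassicalOperator

/-- The action of `P` on functions. The multi-indices of length `j` are
`Finset.piAntidiag Finset.univ j`. -/
def act {n : ℕ} (P : SemiclassicalOperator n) (h : ℝ) (u : Config n → ℂ) (x : Config n) : ℂ :=
  ∑ j ∈ Finset.range (P.N + 1), ∑ α ∈ Finset.piAntidiag (Finset.univ : Finset (Fin n)) j,
    (∑ k ∈ Finset.range (P.N - j + 1), (h : ℂ) ^ k * P.a α k x) *
      (((h : ℂ) / Complex.I) ^ j * partialDeriv α u x)

/-- The coefficients satisfy `a_{α,k} ∈ S(m₀ r^{-|α|} (rR)^{-k})` for `|α| + k ≤ N`. -/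
def HasSymbolCoeffs {n : ℕ} (P : SemiclassicalOperator n) (r R m₀ : Config n → ℝ) : Prop :=
  ∀ j ≤ P.N, ∀ α ∈ Finset.piAntidiag (Finset.univ : Finset (Fin n)) j, ∀ k ≤ P.N - j,
    SymbolClass r R
      (fun ρ : Phase n => m₀ ρ.1 * (r ρ.1 ^ j)⁻¹ * ((r ρ.1 * R ρ.1) ^ k)⁻¹)
      (fun ρ : Phase n => P.a α k ρ.1)

/-- `P` is formally self-adjoint: `(Pu | v) = (u | Pv)` in `L²` for all test functions. -/
def FormallySelfAdjoint {n : ℕ} (P : SemiclassicalOperator n) : Prop :=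
  ∀ h ∈ Ioc (0 : ℝ) 1, ∀ u v : Config n → ℂ,
    ContDiff ℝ ∞ u → HasCompactSupport u → ContDiff ℝ ∞ v → HasCompactSupport v →
      ∫ x, P.act h u x * conj (v x) = ∫ x, u x * conj (P.act h v x)

/-- The semiclassical principal symbol `p(x, ξ) = ∑_{|α| ≤ N} a_{α,0}(x) ξ^α`. It is real for
formally self-adjoint `P`, the only case considered, and is therefore given as a real function. -/
def p {n : ℕ} (P : SemiclassicalOperator n) (ρ : Phase n) : ℝ :=
  (∑ j ∈ Finset.range (P.N + 1), ∑ α ∈ Finset.piAntidiag (Finset.univ : Finset (Fin n)) j,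
    P.a α 0 ρ.1 * ∏ i, ((ρ.2 i : ℝ) : ℂ) ^ α i).re

/-- The classical principal symbol `∑_{|α| = N} a_{α,0}(x) ξ^α`, real for formally self-adjoint
`P`. -/
def pClass {n : ℕ} (P : SemiclassicalOperator n) (ρ : Phase n) : ℝ :=
  (∑ α ∈ Finset.piAntidiag (Finset.univ : Finset (Fin n)) P.N,
    P.a α 0 ρ.1 * ∏ i, ((ρ.2 i : ℝ) : ℂ) ^ α i).re

/-- Classical ellipticity: `p_class(x, ξ) ≥ m₀(x) (|ξ| / r(x))^N`. -/
def Elliptic {n : ℕ} (P : SemiclassicalOperator n) (r m₀ : Config n → ℝ) : Prop :=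
  ∀ ρ : Phase n, m₀ ρ.1 * (‖ρ.2‖ / r ρ.1) ^ P.N ≤ P.pClass ρ

/-- The weight `m(x, ξ) = m₀(x) (r̃ / r)^N`. -/
def m {n : ℕ} (P : SemiclassicalOperator n) (r m₀ : Config n → ℝ) (ρ : Phase n) : ℝ :=
  m₀ ρ.1 * (rTilde r ρ / r ρ.1) ^ P.N

end SemiclassicalOperator

/-! ### Hamilton fields and energy shells -/

/-- The Hamilton field `H_a = ∂_ξ a · ∂_x - ∂_x a · ∂_ξ`. -/
def hamField {n : ℕ} (a : Phase n → ℝ) (ρ : Phase n) : Phase n :=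
  (gradient (fun η => a (ρ.1, η)) ρ.2, -gradient (fun y => a (y, ρ.2)) ρ.1)

/-- The derivative `H_a b` of `b` along the Hamilton field of `a`. -/
def hamDeriv {n : ℕ} (a b : Phase n → ℝ) (ρ : Phase n) : ℝ :=
  fderiv ℝ b ρ (hamField a ρ)

/-- The energy shell `Σ_{[-ε, ε]} = {|p| ≤ ε}`. For `ε = 0` it is the energy surface `Σ₀`. -/
def shell {n : ℕ} (p : Phase n → ℝ) (ε : ℝ) : Set (Phase n) :=
  {ρ | |p ρ| ≤ ε}

/-- `H_p G ≥ m / C₀` on `Σ_{[-ε, ε]} ∖ K`, for some constant `C₀` and some compact `K`. -/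
def EscapesOnShell {n : ℕ} (p m G : Phase n → ℝ) (ε : ℝ) : Prop :=
  ∃ C₀ : ℝ, 0 < C₀ ∧ ∃ K : Set (Phase n), IsCompact K ∧
    ∀ ρ ∈ shell p ε \ K, m ρ / C₀ ≤ hamDeriv p G ρ

/-- Escape functions (at energy zero). -/
def IsEscapeFunction {n : ℕ} (r R : Config n → ℝ) (p m G : Phase n → ℝ) : Prop :=
  SymbolClassDot r R (fun ρ => rTilde r ρ * R ρ.1) G ∧ EscapesOnShell p m G 0

/-- For every `r₀ > 0` there is `ε > 0` such that `|p| ≥ ε m` outside the union of the balls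
`B_{g(ρ)}(ρ, r₀)`, `ρ ∈ Σ₀`. -/
def LargeAwayFromEnergySurface {n : ℕ} (r R : Config n → ℝ) (p m : Phase n → ℝ) : Prop :=
  ∀ r₀ : ℝ, 0 < r₀ → ∃ ε : ℝ, 0 < ε ∧
    ∀ ν : Phase n, ν ∉ ⋃ ρ ∈ shell p 0, gBall r R ρ r₀ → ε * m ν ≤ |p ν|

/-! ### The Hamilton flow, the tails and the convex hull -/

/-- `ν = exp(t v)(ρ)`: the integral curve of `v` that starts at `ρ` exists up to the time `t`
(of either sign) and is at `ν` then. -/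
def FlowsTo {n : ℕ} (v : Phase n → Phase n) (t : ℝ) (ρ ν : Phase n) : Prop :=
  ∃ γ : ℝ → Phase n, γ 0 = ρ ∧ γ t = ν ∧
    ∀ s ∈ uIcc 0 t, HasDerivWithinAt γ (v (γ s)) (uIcc 0 t) s

/-- `exp(t v)(ρ) → ∞` as `t → τ₊(ρ)`: for each compact `L` there is a time `t₀` in the interval
of existence such that the curve is outside `L` at all later times of that interval. -/
def TendsToInftyForward {n : ℕ} (v : Phase n → Phase n) (ρ : Phase n) : Prop :=
  ∀ L : Set (Phase n), IsCompact L → ∃ t₀ : ℝ, 0 ≤ t₀ ∧ (∃ ν, FlowsTo v t₀ ρ ν) ∧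
    ∀ t, t₀ ≤ t → ∀ ν, FlowsTo v t ρ ν → ν ∉ L

/-- `exp(t v)(ρ) → ∞` as `t → -τ₋(ρ)`. -/
def TendsToInftyBackward {n : ℕ} (v : Phase n → Phase n) (ρ : Phase n) : Prop :=
  ∀ L : Set (Phase n), IsCompact L → ∃ t₀ : ℝ, t₀ ≤ 0 ∧ (∃ ν, FlowsTo v t₀ ρ ν) ∧
    ∀ t, t ≤ t₀ → ∀ ν, FlowsTo v t ρ ν → ν ∉ L

/-- The outgoing tail `Γ₊`. -/
def outTail {n : ℕ} (p : Phase n → ℝ) (ε : ℝ) : Set (Phase n) :=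
  {ρ ∈ shell p ε | ¬ TendsToInftyBackward (hamField p) ρ}

/-- The incoming tail `Γ₋`. -/
def inTail {n : ℕ} (p : Phase n → ℝ) (ε : ℝ) : Set (Phase n) :=
  {ρ ∈ shell p ε | ¬ TendsToInftyForward (hamField p) ρ}

/-- The trapped set `Γ₊ ∩ Γ₋`. -/
def trappedSet {n : ℕ} (p : Phase n → ℝ) (ε : ℝ) : Set (Phase n) :=
  outTail p ε ∩ inTail p ε

/-- The outgoing `K`-tail `Γ₊(K) = Γ₊ ∪ {exp(tH_p)(ρ); ρ ∈ K, 0 ≤ t < τ₊(ρ)}`. -/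
def outTailOf {n : ℕ} (p : Phase n → ℝ) (ε : ℝ) (K : Set (Phase n)) : Set (Phase n) :=
  outTail p ε ∪ {ν | ∃ ρ ∈ K, ∃ t : ℝ, 0 ≤ t ∧ FlowsTo (hamField p) t ρ ν}

/-- The incoming `K`-tail `Γ₋(K) = Γ₋ ∪ {exp(-tH_p)(ρ); ρ ∈ K, 0 ≤ t < τ₋(ρ)}`. -/
def inTailOf {n : ℕ} (p : Phase n → ℝ) (ε : ℝ) (K : Set (Phase n)) : Set (Phase n) :=
  inTail p ε ∪ {ν | ∃ ρ ∈ K, ∃ t : ℝ, 0 ≤ t ∧ FlowsTo (hamField p) (-t) ρ ν}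

/-- The `H_p`-convex hull `Γ₊(K) ∩ Γ₋(K)` of `K`. -/
def hull {n : ℕ} (p : Phase n → ℝ) (ε : ℝ) (K : Set (Phase n)) : Set (Phase n) :=
  outTailOf p ε K ∩ inTailOf p ε K

/-- `χ ∈ C₀^∞(]-ε, ε[; [0, 1])` with `χ = 1` on `[-ε/2, ε/2]`. -/
structure IsEnergyCutoff (ε : ℝ) (χ : ℝ → ℝ) : Prop where
  smooth : ContDiff ℝ ∞ χ
  support : tsupport χ ⊆ Ioo (-ε) ε
  mem_Icc : ∀ s, χ s ∈ Icc (0 : ℝ) 1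
  eq_one : ∀ s ∈ Icc (-(ε / 2)) (ε / 2), χ s = 1

end Escape

end

/-!
The Hamilton field `H_p` is replaced by `w = H_p / m`. Since `p ∈ S(m)`, the field `w` moves the
proper function `log ((1 + |x|²) r̃²)` (`logWeight`) at bounded speed, hence is complete
(`exists_isFlow`), and the escape condition `H_p G ≥ m / C₀` says that `G` increases at a rate
bounded below along its flow `Φ`, in the energy shell `Σ` and off a compact set. The orbits of
`H_p` are those of `w` in another parametrization (`FlowsTo.exists_eq_timeChange`,
`flowsTo_timeChange`). Once `G` exceeds its maximum `M` on the compact set, it increases forever.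
So the points that escape forward without meeting `K` are those whose orbit avoids `K` until
`G > M`; this is an open condition (`escapeSet`), and the convex hull is the complement in `Σ` of
the forward and the backward escape set (`hull_eq_diff_escapeSet`). It is compact because far out
an orbit on which `G ≥ 0`, respectively `G ≤ 0`, has no time to return in the forward,
respectively backward, direction.

All dynamics takes place in the abstract setting `IsEscapeSystem`. The function
`f(x) = inf_{0 ≤ s ≤ S} ((G - λ β)(Φ_s x) - c s / 2)`, with a bump `β` equal to `1` on `K` and with
`λ`, `S` large, is locally Lipschitz, very negative off the forward escape set, equal to `G` far
out in `Σ`, and increasing along the flow wherever it is not very negative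
(`IsEscapeSystem.exists_locallyLipschitz_lyapunov`). Convolution makes it smooth
(`exists_contDiff_approx_of_increasing`, `IsEscapeSystem.exists_contDiff_lyapunov`). With such a
function `F₁`, and with minus its analogue for `-G` and reversed time as `F₂`, `G̃ = f(F₁) - f(-F₂)`, where `f` is a smooth
ramp that vanishes on `]-∞, -T]`, is smooth, equal to `G` far out because `f(s) - f(-s) = s`, zero
near the hull, and increasing along the flow (`IsEscapeSystem.exists_modification`). Its gradient
and its square are bounded on compact sets by its derivative along the flow: both terms of the
gradient carry a factor `f'`, and `f² ≤ C f'` there. So `H_p G̃` bounds `m ‖H_G̃‖_g` on `Σ`; the converse bound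
is `p ∈ S(m)`. After multiplication by `χ(p)` the additional term, which contains `χ'(p)`, is
controlled by `χ'² ≤ C χ` (`deriv_sq_le_of_nonneg`).

That `H_p G ≥ m / C₀` extends from the energy surface to nearby energies is a consequence of the
slow variation of `g` and `m` (`exists_escapesOnShell`). Symbol estimates are handled as bounds on
the derivatives of the function rescaled by `scaleMap` (`symbolClass_iff`), where the bounds for
derivatives of products and compositions apply.
-/

noncomputable section

namespace Escape

/-! ### Flows of complete vector fields -/

section Flow

variable {E : Type*} [NormedAddCommGroup E] [NormedSpace ℝ E]

/-- `Φ` is the complete flow of the vector field `w`. The last two fields would follow from the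
others if `w` were required to be `C¹`; with them no regularity of `w` need be assumed. -/
structure IsFlow (w : E → E) (Φ : ℝ → E → E) : Prop where
  zero : ∀ x, Φ 0 x = x
  add : ∀ s t x, Φ (s + t) x = Φ s (Φ t x)
  hasDerivAt : ∀ x t, HasDerivAt (fun s => Φ s x) (w (Φ t x)) t
  continuous : Continuous fun q : ℝ × E => Φ q.1 q.2
  lipschitz : ∀ X : Set E, IsCompact X → ∀ S : ℝ, ∃ L : NNReal, ∀ t ∈ Icc (-S) S,
    LipschitzOnWith L (Φ t) X

/-- Reversal of time. -/
lemma IsFlow.reverse {w : E → E} {Φ : ℝ → E → E} (h : IsFlow w Φ) :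
    IsFlow (fun x => -w x) (fun t => Φ (-t)) where
  zero x := by simpa using h.zero x
  add s t x := by rw [neg_add, h.add]
  hasDerivAt x t := by
    simpa [Function.comp_def] using (h.hasDerivAt x (-t)).scomp t (hasDerivAt_neg t)
  continuous := h.continuous.comp ((continuous_fst.neg).prodMk continuous_snd)
  lipschitz X hX S := by
    obtain ⟨L, hL⟩ := h.lipschitz X hX S
    exact ⟨L, fun t ht => hL _ ⟨by linarith [ht.2], by linarith [ht.1]⟩⟩

lemma IsFlow.continuous_time {w : E → E} {Φ : ℝ → E → E} (h : IsFlow w Φ) (x : E) :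
    Continuous fun t => Φ t x :=
  h.continuous.comp (continuous_id.prodMk continuous_const)

lemma IsFlow.continuous_space {w : E → E} {Φ : ℝ → E → E} (h : IsFlow w Φ) (t : ℝ) :
    Continuous (Φ t) :=
  h.continuous.comp (continuous_const.prodMk continuous_id)

lemma IsFlow.hasDerivAt_comp {w : E → E} {Φ : ℝ → E → E} (h : IsFlow w Φ) {f : E → ℝ}
    (hf : Differentiable ℝ f) (x : E) (t : ℝ) :
    HasDerivAt (fun s => f (Φ s x)) (fderiv ℝ f (Φ t x) (w (Φ t x))) t :=
  (hf (Φ t x)).hasFDerivAt.comp_hasDerivAt t (h.hasDerivAt x t)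

/-- A function that is annihilated by the field is constant along the flow. -/
lemma IsFlow.apply_eq_of_fderiv_eq_zero {w : E → E} {Φ : ℝ → E → E} (h : IsFlow w Φ) {f : E → ℝ}
    (hf : Differentiable ℝ f) (h0 : ∀ x, fderiv ℝ f x (w x) = 0) (x : E) (t : ℝ) :
    f (Φ t x) = f x := by
  have hd : ∀ s, HasDerivAt (fun s => f (Φ s x)) 0 s := fun s => by
    simpa [h0] using h.hasDerivAt_comp hf x s
  have := is_const_of_deriv_eq_zero (fun s => (hd s).differentiableAt)
    (fun s => (hd s).deriv) t 0
  simpa [h.zero] using this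

/-- A `C¹` map is Lipschitz on compact sets. -/
lemma exists_lipschitzOnWith_of_isCompact {F : Type*} [NormedAddCommGroup F] [NormedSpace ℝ F]
    {f : E → F} (hf : ContDiff ℝ 1 f) {X : Set E} (hX : IsCompact X) :
    ∃ L : NNReal, LipschitzOnWith L f X :=
  LocallyLipschitzOn.exists_lipschitzOnWith_of_compact hX hf.locallyLipschitz.locallyLipschitzOn

/-- A function whose derivative along a curve is bounded by `C` grows at most linearly. -/
lemma le_add_mul_abs_of_hasDerivAt {g g' : ℝ → ℝ} {T C : ℝ}
    (hg : ∀ t ∈ Ioo (-T) T, HasDerivAt g (g' t) t) (hC : ∀ t ∈ Ioo (-T) T, |g' t| ≤ C) {t : ℝ}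
    (ht : t ∈ Ioo (-T) T) : g t ≤ g 0 + C * |t| := by
  have h0 : (0 : ℝ) ∈ Ioo (-T) T := ⟨by linarith [ht.1, ht.2], by linarith [ht.1, ht.2]⟩
  have := (convex_Ioo (-T) T).norm_image_sub_le_of_norm_hasDerivWithin_le
    (fun s hs => (hg s hs).hasDerivWithinAt) hC h0 ht
  rw [Real.norm_eq_abs, Real.norm_eq_abs, sub_zero] at this
  linarith [le_abs_self (g t - g 0)]

/-- Along the flow a function whose derivative along the field is bounded by `C` grows at most
linearly. -/
lemma IsFlow.le_add_mul_abs {w : E → E} {Φ : ℝ → E → E} (h : IsFlow w Φ) {ψ : E → ℝ}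
    (hψ : Differentiable ℝ ψ) {C : ℝ} (hC : ∀ x, |fderiv ℝ ψ x (w x)| ≤ C) (x : E) (t : ℝ) :
    ψ (Φ t x) ≤ ψ x + C * |t| := by
  have := le_add_mul_abs_of_hasDerivAt (g := fun s => ψ (Φ s x)) (T := |t| + 1) (C := C)
    (fun s _ => h.hasDerivAt_comp hψ x s) (fun s _ => hC _) (t := t) (abs_lt.1 (by linarith))
  simpa [h.zero] using this

/-- Integral curves of a `C¹` field on symmetric intervals are unique. -/
lemma eqOn_Ioo_of_hasDerivAt {w : E → E} (hw : ContDiff ℝ 1 w) {γ₁ γ₂ : ℝ → E} {T : ℝ}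
    (h₁ : ∀ t ∈ Ioo (-T) T, HasDerivAt γ₁ (w (γ₁ t)) t)
    (h₂ : ∀ t ∈ Ioo (-T) T, HasDerivAt γ₂ (w (γ₂ t)) t) (h0 : γ₁ 0 = γ₂ 0) :
    EqOn γ₁ γ₂ (Ioo (-T) T) := by
  intro t ht
  -- restrict to a smaller interval, whose closure has compact image
  obtain ⟨T', h1, h2⟩ : ∃ T', |t| < T' ∧ T' < T := exists_between (abs_lt.2 ht)
  have hsub : Icc (-T') T' ⊆ Ioo (-T) T := fun s hs => ⟨by linarith [hs.1], by linarith [hs.2]⟩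
  have hsub' : Ioo (-T') T' ⊆ Ioo (-T) T := Ioo_subset_Icc_self.trans hsub
  have c₁ : ContinuousOn γ₁ (Icc (-T') T') := HasDerivAt.continuousOn fun s hs => h₁ s (hsub hs)
  have c₂ : ContinuousOn γ₂ (Icc (-T') T') := HasDerivAt.continuousOn fun s hs => h₂ s (hsub hs)
  have hX := (isCompact_Icc.image_of_continuousOn c₁).union (isCompact_Icc.image_of_continuousOn c₂)
  obtain ⟨L, hL⟩ := exists_lipschitzOnWith_of_isCompact hw hX
  have hpos : 0 < T' := lt_of_le_of_lt (abs_nonneg t) h1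
  exact ODE_solution_unique_of_mem_Ioo (v := fun _ => w) (fun _ _ => hL)
    (⟨by linarith, hpos⟩ : (0 : ℝ) ∈ Ioo (-T') T')
    (fun s hs => ⟨h₁ s (hsub' hs), Or.inl (mem_image_of_mem _ (Ioo_subset_Icc_self hs))⟩)
    (fun s hs => ⟨h₂ s (hsub' hs), Or.inr (mem_image_of_mem _ (Ioo_subset_Icc_self hs))⟩)
    h0 (abs_lt.1 h1)

variable [FiniteDimensional ℝ E]

/-- A field that moves a proper function `ψ` at bounded speed has integral curves on arbitrarily
long intervals: it agrees on a large sublevel set of `ψ` with a compactly supported field, whose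
integral curves cannot leave that set in the given time. -/
lemma exists_hasDerivAt_Ioo {w : E → E} (hw : ContDiff ℝ 1 w) {ψ : E → ℝ}
    (hψ : ContDiff ℝ 1 ψ) (hproper : ∀ a, IsCompact {x | ψ x ≤ a}) {C : ℝ}
    (hC : ∀ x, |fderiv ℝ ψ x (w x)| ≤ C) (x : E) (T : ℝ) :
    ∃ γ : ℝ → E, γ 0 = x ∧ ∀ t ∈ Ioo (-T) T, HasDerivAt γ (w (γ t)) t := by
  have hC0 : 0 ≤ C := (abs_nonneg _).trans (hC x)
  rcases le_or_gt T 0 with hT | hT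
  · exact ⟨fun _ => x, rfl, fun t ht => by
      have := ht.1.trans ht.2
      exfalso; linarith⟩
  set a := ψ x + C * T
  have hX := hproper a
  obtain ⟨κ, hκ1, hκc, hκ01, hκs⟩ : ∃ κ : E → ℝ, (∀ y, ψ y ≤ a → κ y = 1) ∧
      HasCompactSupport κ ∧ (∀ y, 0 ≤ κ y ∧ κ y ≤ 1) ∧ ContDiff ℝ 1 κ := by
    obtain ⟨r, hr⟩ := hX.isBounded.subset_closedBall (0 : E)
    let f : ContDiffBump (0 : E) := ⟨|r| + 1, |r| + 2, by positivity, by linarith⟩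
    refine ⟨f, fun y hy => f.one_of_mem_closedBall ?_, f.hasCompactSupport,
      fun y => ⟨f.nonneg, f.le_one⟩, f.contDiff⟩
    exact Metric.closedBall_subset_closedBall
      (show r ≤ |r| + 1 by linarith [le_abs_self r]) (hr hy)
  set u : E → E := fun y => κ y • w y with hu
  have hus : ContDiff ℝ 1 u := hκs.smul hw
  have huc : HasCompactSupport u := hκc.smul_right
  obtain ⟨B, hB⟩ := hus.continuous.bounded_above_of_compact_support huc
  have hB0 : 0 ≤ B := (norm_nonneg _).trans (hB x)
  obtain ⟨K, hK⟩ := exists_lipschitzOnWith_of_isCompact hus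
    (isCompact_closedBall x (B * T))
  have hPL : IsPicardLindelof (fun _ => u) (tmin := -T) (tmax := T)
      ⟨0, by constructor <;> linarith⟩ x ⟨B * T, by positivity⟩ 0 ⟨B, hB0⟩ K := by
    refine IsPicardLindelof.of_time_independent (fun y _ => hB y) hK ?_
    simp only [sub_zero, zero_sub, neg_neg, max_self, NNReal.coe_zero]
    exact le_rfl
  obtain ⟨γ, hγ0, hγ⟩ := hPL.exists_eq_forall_mem_Icc_hasDerivWithinAt₀
  have hγ' : ∀ t ∈ Ioo (-T) T, HasDerivAt γ (u (γ t)) t := fun t ht =>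
    (hγ t (Ioo_subset_Icc_self ht)).hasDerivAt (Icc_mem_nhds ht.1 ht.2)
  refine ⟨γ, hγ0, fun t ht => ?_⟩
  have hψγ : ψ (γ t) ≤ ψ (γ 0) + C * |t| := by
    refine le_add_mul_abs_of_hasDerivAt (g := fun s => ψ (γ s))
      (fun s hs => ((hψ.differentiable one_ne_zero) (γ s)).hasFDerivAt.comp_hasDerivAt s
        (hγ' s hs)) (fun s hs => ?_) ht
    simp only [hu, map_smul, smul_eq_mul, abs_mul]
    rw [abs_of_nonneg (hκ01 _).1]
    exact (mul_le_of_le_one_left (abs_nonneg _) (hκ01 _).2).trans (hC _)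
  have : κ (γ t) = 1 := by
    refine hκ1 _ (hψγ.trans ?_)
    have h0 : γ 0 = x := hγ0
    have := (abs_lt.2 ht).le
    rw [h0]
    simp only [a]
    gcongr
  simpa [hu, this] using hγ' t ht

/-- A `C¹` field that moves a proper function at bounded speed is complete. -/
theorem exists_isFlow {w : E → E} (hw : ContDiff ℝ 1 w) {ψ : E → ℝ}
    (hψ : ContDiff ℝ 1 ψ) (hproper : ∀ a, IsCompact {x | ψ x ≤ a}) {C : ℝ}
    (hC : ∀ x, |fderiv ℝ ψ x (w x)| ≤ C) : ∃ Φ : ℝ → E → E, IsFlow w Φ := by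
  choose γ hγ0 hγ using exists_hasDerivAt_Ioo hw hψ hproper hC
  set Φ : ℝ → E → E := fun t x => γ x (|t| + 1) t with hΦ
  have heq : ∀ x T, EqOn (fun t => Φ t x) (γ x T) (Ioo (-T) T) := by
    intro x T t ht
    have hlt := abs_lt.2 ht
    have hmin : t ∈ Ioo (-(min T (|t| + 1))) (min T (|t| + 1)) :=
      abs_lt.1 (lt_min hlt (by linarith))
    refine eqOn_Ioo_of_hasDerivAt hw (fun s hs => hγ x (|t| + 1) s ?_)
      (fun s hs => hγ x T s ?_) (by rw [hγ0, hγ0]) hmin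
    · exact abs_lt.1 ((abs_lt.2 hs).trans_le (min_le_right _ _))
    · exact abs_lt.1 ((abs_lt.2 hs).trans_le (min_le_left _ _))
  have hder : ∀ x t, HasDerivAt (fun s => Φ s x) (w (Φ t x)) t := by
    intro x t
    have ht : t ∈ Ioo (-(|t| + 1)) (|t| + 1) := abs_lt.1 (by linarith)
    exact (hγ x _ t ht).congr_of_eventuallyEq
      ((heq x (|t| + 1)).eventuallyEq_of_mem (Ioo_mem_nhds ht.1 ht.2))
  have hzero : ∀ x, Φ 0 x = x := fun x => hγ0 _ _
  have hC0 : ∀ x : E, 0 ≤ C := fun x => (abs_nonneg _).trans (hC x)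
  have hψΦ : ∀ x t, ψ (Φ t x) ≤ ψ x + C * |t| := by
    intro x t
    have := le_add_mul_abs_of_hasDerivAt (g := fun s => ψ (Φ s x)) (T := |t| + 1) (C := C)
      (fun s _ => ((hψ.differentiable one_ne_zero) (Φ s x)).hasFDerivAt.comp_hasDerivAt
        (f := fun s => Φ s x) s (hder x s)) (fun s _ => hC _) (t := t) (abs_lt.1 (by linarith))
    simpa [hzero] using this
  have hlip : ∀ X : Set E, IsCompact X → ∀ S : ℝ, ∃ L : NNReal, ∀ t ∈ Icc (-S) S,
      LipschitzOnWith L (Φ t) X := by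
    intro X hX S
    obtain ⟨b, hb⟩ := hX.bddAbove_image hψ.continuous.continuousOn
    have hb' : ∀ x ∈ X, ψ x ≤ b := fun x hx => hb (mem_image_of_mem _ hx)
    obtain ⟨K, hK⟩ := exists_lipschitzOnWith_of_isCompact hw (hproper (b + C * |S|))
    have hmem : ∀ x ∈ X, ∀ t, |t| ≤ |S| → Φ t x ∈ {y | ψ y ≤ b + C * |S|} := by
      intro x hx t ht
      refine (hψΦ x t).trans ?_
      have := hC0 x
      gcongr
      exact hb' x hx
    refine ⟨⟨Real.exp (K * |S|), by positivity⟩, fun t ht => LipschitzOnWith.of_dist_le_mul ?_⟩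
    intro x hx y hy
    have htS : |t| ≤ |S| := (abs_le.2 ht).trans (le_abs_self S)
    -- Gronwall's inequality forwards in time, for the field `±w`
    have key : ∀ σ : ℝ, |σ| = 1 → ∀ τ ∈ Icc 0 |S|,
        dist (Φ (σ * τ) x) (Φ (σ * τ) y) ≤ dist x y * Real.exp (K * τ) := by
      intro σ hσ τ hτ
      have hd : ∀ z s, HasDerivAt (fun s => Φ (σ * s) z) (σ • w (Φ (σ * s) z)) s := by
        intro z s
        have := (hder z (σ * s)).scomp s ((hasDerivAt_id s).const_mul σ)
        simpa [Function.comp_def] using this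
      have hK' : LipschitzOnWith K (fun y => σ • w y) {y | ψ y ≤ b + C * |S|} := by
        refine LipschitzOnWith.of_dist_le_mul fun p hp q hq => ?_
        rw [dist_smul₀, Real.norm_eq_abs, hσ, one_mul]
        exact hK.dist_le_mul p hp q hq
      have hin : ∀ s ∈ Ico 0 |S|, |σ * s| ≤ |S| := by
        intro s hs
        rw [abs_mul, hσ, one_mul, abs_of_nonneg hs.1]
        exact hs.2.le
      have := dist_le_of_trajectories_ODE_of_mem (v := fun _ y => σ • w y)
        (s := fun _ => {y | ψ y ≤ b + C * |S|}) (a := 0) (b := |S|)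
        (f := fun s => Φ (σ * s) x) (g := fun s => Φ (σ * s) y) (fun _ _ => hK')
        (HasDerivAt.continuousOn fun s _ => hd x s)
        (fun s _ => (hd x s).hasDerivWithinAt) (fun s hs => hmem x hx _ (hin s hs))
        (HasDerivAt.continuousOn fun s _ => hd y s)
        (fun s _ => (hd y s).hasDerivWithinAt) (fun s hs => hmem y hy _ (hin s hs))
        (δ := dist x y) (by simp [hzero]) τ hτ
      simpa using this
    have hfin : dist (Φ t x) (Φ t y) ≤ dist x y * Real.exp (K * |t|) := by
      rcases abs_cases t with ⟨h1, -⟩ | ⟨h1, -⟩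
      · have := key 1 (by simp) |t| ⟨abs_nonneg _, htS⟩
        simpa [h1] using this
      · have := key (-1) (by simp) |t| ⟨abs_nonneg _, htS⟩
        simpa [h1] using this
    rw [mul_comm]
    refine hfin.trans ?_
    change _ ≤ dist x y * Real.exp (K * |S|)
    gcongr
  have hcont : Continuous fun q : ℝ × E => Φ q.1 q.2 := by
    rw [continuous_iff_continuousAt]
    rintro ⟨t, x⟩
    obtain ⟨L, hL⟩ := hlip (Metric.closedBall x 1) (isCompact_closedBall x 1) (|t| + 1)
    have hon : ContinuousOn (fun q : ℝ × E => Φ q.1 q.2)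
        (Icc (-(|t| + 1)) (|t| + 1) ×ˢ Metric.closedBall x 1) :=
      continuousOn_prod_of_continuousOn_lipschitzOnWith' _ L
        (fun s hs => hL s hs) fun y _ => HasDerivAt.continuousOn fun s _ => hder y s
    refine hon.continuousAt (prod_mem_nhds (Icc_mem_nhds ?_ ?_)
      (Metric.closedBall_mem_nhds x one_pos))
    · linarith [neg_abs_le t]
    · linarith [le_abs_self t]
  refine ⟨Φ, hzero, fun s t x => ?_, hder, hcont, hlip⟩
  -- both sides are integral curves in `s` through `Φ t x`
  have h1 : ∀ s, HasDerivAt (fun s => Φ (s + t) x) (w (Φ (s + t) x)) s := fun s =>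
    (hder x (s + t)).comp_add_const s t
  exact eqOn_Ioo_of_hasDerivAt hw (T := |s| + 1) (fun s _ => h1 s) (fun s _ => hder (Φ t x) s)
    (by simp [hzero]) (abs_lt.1 (by linarith))

end Flow

/-! ### Smoothing by convolution -/

section Smoothing

variable {E : Type*} [NormedAddCommGroup E]

/-- A local property of pairs of close points holds uniformly along a compact set. -/
lemma exists_uniform_ball_of_isCompact {X : Set E} (hX : IsCompact X) {P : ℝ → E → E → Prop}
    (hmono : ∀ ε ε' x z, ε' ≤ ε → P ε x z → P ε' x z)
    (h : ∀ x₀ ∈ X, ∃ ε > 0, ∀ x ∈ Metric.ball x₀ ε, ∀ z ∈ Metric.ball x ε, P ε x z) :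
    ∃ ε > 0, ∀ x ∈ X, ∀ z ∈ Metric.ball x ε, P ε x z := by
  refine hX.induction_on (p := fun S => ∃ ε > 0, ∀ x ∈ S, ∀ z ∈ Metric.ball x ε, P ε x z)
    ⟨1, one_pos, by simp⟩ ?_ ?_ ?_
  · rintro s t hst ⟨ε, hε, H⟩
    exact ⟨ε, hε, fun x hx => H x (hst hx)⟩
  · rintro s t ⟨ε, hε, H⟩ ⟨ε', hε', H'⟩
    refine ⟨min ε ε', lt_min hε hε', ?_⟩
    rintro x (hx | hx) z hz
    · exact hmono _ _ _ _ (min_le_left _ _)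
        (H x hx z (Metric.ball_subset_ball (min_le_left _ _) hz))
    · exact hmono _ _ _ _ (min_le_right _ _)
        (H' x hx z (Metric.ball_subset_ball (min_le_right _ _) hz))
  · intro x₀ hx₀
    obtain ⟨ε, hε, H⟩ := h x₀ hx₀
    exact ⟨Metric.ball x₀ ε, mem_nhdsWithin_of_mem_nhds (Metric.ball_mem_nhds _ hε), ε, hε, H⟩

variable [NormedSpace ℝ E]

/-- If a locally Lipschitz function increases at rate `c` along the orbits near `x₀`, then it
increases at rate `c / 2` along the straight lines near `x₀` in the direction of the field: up to
`o(t)` the two motions agree. -/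
lemma exists_increasing_along_lines {w : E → E} {Φ : ℝ → E → E} (h : IsFlow w Φ)
    (hw : Continuous w) {f : E → ℝ} (hf : LocallyLipschitz f) {c : ℝ} (hc : 0 < c) {x₀ : E}
    (hinc : ∃ t₀ > 0, ∀ᶠ z in 𝓝 x₀, ∀ t ∈ Icc 0 t₀, f z + c * t ≤ f (Φ t z)) :
    ∃ ε > 0, ∀ x ∈ Metric.ball x₀ ε, ∀ z ∈ Metric.ball x ε, ∀ t ∈ Icc 0 ε,
      f z + c / 2 * t ≤ f (z + t • w x) := by
  obtain ⟨t₀, ht₀, hinc⟩ := hinc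
  obtain ⟨L, V, hV, hL⟩ := hf x₀
  set η : ℝ := c / (2 * (L + 1)) with hη
  have hηpos : 0 < η := by positivity
  have hLη : L * η ≤ c / 2 := by
    rw [hη, mul_div_assoc', div_le_div_iff₀ (by positivity) (by positivity)]
    nlinarith [L.coe_nonneg]
  have e1 : ∀ᶠ q : ℝ × E × E in 𝓝 (0, x₀, x₀), ‖w (Φ q.1 q.2.1) - w q.2.2‖ < η := by
    have hcont : Continuous fun q : ℝ × E × E => ‖w (Φ q.1 q.2.1) - w q.2.2‖ :=
      ((hw.comp (h.continuous.comp (continuous_fst.prodMk continuous_snd.fst))).sub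
        (hw.comp continuous_snd.snd)).norm
    refine hcont.continuousAt.eventually_lt continuousAt_const ?_
    simpa [h.zero] using hηpos
  have e2 : ∀ᶠ q : ℝ × E × E in 𝓝 (0, x₀, x₀), Φ q.1 q.2.1 ∈ V := by
    have hcont : Continuous fun q : ℝ × E × E => Φ q.1 q.2.1 :=
      h.continuous.comp (continuous_fst.prodMk continuous_snd.fst)
    exact hcont.continuousAt.preimage_mem_nhds (by simpa [h.zero] using hV)
  have e3 : ∀ᶠ q : ℝ × E × E in 𝓝 (0, x₀, x₀), q.2.1 + q.1 • w q.2.2 ∈ V := by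
    have hcont : Continuous fun q : ℝ × E × E => q.2.1 + q.1 • w q.2.2 :=
      continuous_snd.fst.add (continuous_fst.smul (hw.comp continuous_snd.snd))
    exact hcont.continuousAt.preimage_mem_nhds (by simpa using hV)
  obtain ⟨ε₁, hε₁, H⟩ := Metric.eventually_nhds_iff.1 (e1.and (e2.and e3))
  obtain ⟨ε₂, hε₂, H₂⟩ := Metric.eventually_nhds_iff.1 hinc
  refine ⟨min t₀ (min (ε₁ / 3) (ε₂ / 3)), by positivity, ?_⟩
  intro x hx z hz t ht
  have b1 : dist x x₀ < min (ε₁ / 3) (ε₂ / 3) := lt_of_lt_of_le hx (min_le_right _ _)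
  have b2 : dist z x < min (ε₁ / 3) (ε₂ / 3) := lt_of_lt_of_le hz (min_le_right _ _)
  have b3 := dist_triangle z x x₀
  rw [lt_min_iff] at b1 b2
  have ht1 : t ≤ ε₁ / 3 := ht.2.trans ((min_le_right _ _).trans (min_le_left _ _))
  have hq : ∀ s ∈ Icc 0 t, dist (s, z, x) ((0 : ℝ), x₀, x₀) < ε₁ := by
    intro s hs
    simp only [Prod.dist_eq, Real.dist_eq, sub_zero, max_lt_iff, abs_of_nonneg hs.1]
    exact ⟨by linarith [hs.2], by linarith, by linarith⟩
  have hinc' := H₂ (show dist z x₀ < ε₂ by linarith) t ⟨ht.1, ht.2.trans (min_le_left _ _)⟩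
  have hdist : ‖Φ t z - (z + t • w x)‖ ≤ η * t := by
    have := norm_image_sub_le_of_norm_deriv_le_segment' (a := 0) (b := t)
      (f := fun s => Φ s z - s • w x) (f' := fun s => w (Φ s z) - w x) (C := η)
      (fun s _ => ((h.hasDerivAt z s).sub
        (by simpa using (hasDerivAt_id s).smul_const (w x))).hasDerivWithinAt)
      (fun s hs => (H (hq s (Ico_subset_Icc_self hs))).1.le) t ⟨ht.1, le_rfl⟩
    simp only [h.zero, zero_smul, sub_zero] at this
    convert this using 2
    abel
  have hHt := H (hq t ⟨ht.1, le_rfl⟩)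
  have hl := hL.dist_le_mul _ hHt.2.1 _ hHt.2.2
  rw [Real.dist_eq, dist_eq_norm] at hl
  have hl2 : f (Φ t z) - f (z + t • w x) ≤ c / 2 * t :=
    calc f (Φ t z) - f (z + t • w x) ≤ L * ‖Φ t z - (z + t • w x)‖ := (le_abs_self _).trans hl
      _ ≤ L * (η * t) := by gcongr
      _ = (L * η) * t := by ring
      _ ≤ c / 2 * t := mul_le_mul_of_nonneg_right hLη ht.1
  linarith

variable [FiniteDimensional ℝ E] [MeasurableSpace E] [BorelSpace E]

/-- Smoothing by convolution. A locally Lipschitz function that increases at rate `c` along the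
orbits near a compact set `X` is a uniform limit, on any compact set, of smooth functions whose
derivative along the field is at least `c / 2` on `X`. -/
theorem exists_contDiff_approx_of_increasing {w : E → E} {Φ : ℝ → E → E} (h : IsFlow w Φ)
    (hw : Continuous w) {f : E → ℝ} (hf : LocallyLipschitz f) {c : ℝ} (hc : 0 < c)
    {X Y : Set E} (hX : IsCompact X) (hY : IsCompact Y)
    (hinc : ∀ x ∈ X, ∃ t₀ > 0, ∀ᶠ z in 𝓝 x, ∀ t ∈ Icc 0 t₀, f z + c * t ≤ f (Φ t z))
    {δ : ℝ} (hδ : 0 < δ) :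
    ∃ F : E → ℝ, ContDiff ℝ ∞ F ∧ (∀ x ∈ Y, |F x - f x| ≤ δ) ∧
      ∀ x ∈ X, c / 2 ≤ fderiv ℝ F x (w x) := by
  obtain ⟨ε₁, hε₁, H₁⟩ := exists_uniform_ball_of_isCompact hX
    (P := fun ε x z => ∀ t ∈ Icc 0 ε, f z + c / 2 * t ≤ f (z + t • w x))
    (fun ε ε' x z hle hP t ht => hP t ⟨ht.1, ht.2.trans hle⟩)
    (fun x₀ hx₀ => exists_increasing_along_lines h hw hf hc (hinc x₀ hx₀))
  obtain ⟨ε₂, hε₂, H₂⟩ := exists_uniform_ball_of_isCompact hY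
    (P := fun _ x z => dist (f z) (f x) ≤ δ) (fun ε ε' x z _ hP => hP)
    (fun x₀ _ => by
      obtain ⟨ε, hε, H⟩ := Metric.continuousAt_iff.1 (hf.continuous.continuousAt (x := x₀))
        (δ / 2) (half_pos hδ)
      refine ⟨ε / 2, half_pos hε, fun x hx z hz => ?_⟩
      rw [Metric.mem_ball] at hx hz
      have h1 := H (show dist x x₀ < ε by linarith)
      have h2 := H (show dist z x₀ < ε by linarith [dist_triangle z x x₀])
      linarith [dist_triangle_right (f z) (f x) (f x₀)])
  let φ : ContDiffBump (0 : E) := ⟨min ε₁ ε₂ / 2, min ε₁ ε₂, by positivity,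
    half_lt_self (lt_min hε₁ hε₂)⟩
  set μ : Measure E := Measure.addHaar
  set F : E → ℝ := convolution (φ.normed μ) f (ContinuousLinearMap.lsmul ℝ ℝ) μ with hF
  have hFs : ContDiff ℝ ∞ F := φ.hasCompactSupport_normed.contDiff_convolution_left _
    φ.contDiff_normed hf.continuous.locallyIntegrable
  have hint : ∀ x, Integrable (fun y => φ.normed μ y * f (x - y)) μ := fun x =>
    (φ.continuous_normed.mul (hf.continuous.comp (continuous_const.sub continuous_id)))
      |>.integrable_of_hasCompactSupport φ.hasCompactSupport_normed.mul_right
  have hFx : ∀ x, F x = ∫ y, φ.normed μ y * f (x - y) ∂μ := fun x => by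
    simp [hF, convolution_def]
  refine ⟨F, hFs, fun x hx => ?_, fun x hx => ?_⟩
  · rw [← Real.dist_eq]
    exact φ.dist_normed_convolution_le hf.continuous.aestronglyMeasurable
      fun z hz => H₂ x hx z (Metric.ball_subset_ball (min_le_right _ _) hz)
  · have hlow : ∀ t ∈ Icc 0 ε₁, F x + c / 2 * t ≤ F (x + t • w x) := by
      intro t ht
      have h1 : F x + c / 2 * t = ∫ y, φ.normed μ y * (f (x - y) + c / 2 * t) ∂μ := by
        simp only [mul_add]
        rw [integral_add (hint x) (φ.integrable_normed.mul_const _), integral_mul_const,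
          φ.integral_normed, hFx, one_mul]
      rw [h1, hFx]
      refine integral_mono ?_ (hint _) fun y => ?_
      · simp only [mul_add]
        exact (hint x).add (φ.integrable_normed.mul_const _)
      · by_cases hy : y ∈ Metric.ball (0 : E) φ.rOut
        · refine mul_le_mul_of_nonneg_left ?_ (φ.nonneg_normed y)
          have := H₁ x hx (x - y) (by
            have : ‖y‖ < min ε₁ ε₂ := mem_ball_zero_iff.1 hy
            simpa using this.trans_le (min_le_left _ _)) t ht
          rwa [show x + t • w x - y = x - y + t • w x by abel]
        · have : φ.normed μ y = 0 := by
            have hs := φ.support_normed_eq (μ := μ)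
            by_contra hne
            exact hy (hs ▸ hne)
          simp [this]
    have hd : HasDerivAt (fun t : ℝ => F (x + t • w x)) (fderiv ℝ F x (w x)) 0 := by
      have h1 : HasDerivAt (fun t : ℝ => x + t • w x) (w x) 0 := by
        simpa using ((hasDerivAt_id (0 : ℝ)).smul_const (w x)).const_add x
      have h2 : HasFDerivAt F (fderiv ℝ F x) (x + (0 : ℝ) • w x) := by
        simpa using (hFs.differentiable (by simp) x).hasFDerivAt
      exact h2.comp_hasDerivAt 0 h1
    have hs := (hasDerivAt_iff_tendsto_slope.1 hd).mono_left
      (nhdsWithin_mono (0 : ℝ) (fun t (ht : t ∈ Ioi (0 : ℝ)) => ht.ne'))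
    refine ge_of_tendsto hs ?_
    filter_upwards [Ioo_mem_nhdsGT hε₁] with t ht
    have := hlow t ⟨ht.1.le, ht.2.le⟩
    rw [slope_def_field, le_div_iff₀ (by simpa using ht.1)]
    simp only [zero_smul, add_zero, sub_zero]
    linarith

end Smoothing

/-! ### Escape to infinity -/

section Lyapunov

variable {E : Type*} [NormedAddCommGroup E] [NormedSpace ℝ E]

/-- The abstract situation in which Lyapunov functions are constructed: a complete flow that leaves
the closed set `Sg` invariant, a proper function `ψ` that varies at bounded speed along the flow,
and a function `G` that increases at rate at least `c` along the flow in `Sg`, off the compact set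
`K₁`. The bound `|G| ≤ M` on `K₁` makes the situation symmetric under reversal of time. -/
structure IsEscapeSystem (w : E → E) (Φ : ℝ → E → E) (Sg : Set E) (ψ G : E → ℝ) (K₁ : Set E)
    (c C M : ℝ) : Prop where
  flow : IsFlow w Φ
  continuous : Continuous w
  isClosed : IsClosed Sg
  invariant : ∀ x ∈ Sg, ∀ t, Φ t x ∈ Sg
  contDiff_proper : ContDiff ℝ ∞ ψ
  proper : ∀ a, IsCompact {x | ψ x ≤ a}
  speed : ∀ x, |fderiv ℝ ψ x (w x)| ≤ C
  contDiff : ContDiff ℝ ∞ G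
  isCompact : IsCompact K₁
  pos : 0 < c
  escape : ∀ x ∈ Sg, x ∉ K₁ → c ≤ fderiv ℝ G x (w x)
  bound : ∀ x ∈ K₁, |G x| ≤ M

/-- The points whose forward orbit avoids `K` until `G` has become larger than `M`. For points of
`Sg` this means that the orbit escapes to infinity without ever meeting `K`. -/
def escapeSet (Φ : ℝ → E → E) (G : E → ℝ) (M : ℝ) (K : Set E) : Set E :=
  {x | ∃ s : ℝ, 0 ≤ s ∧ (∀ t ∈ Icc 0 s, Φ t x ∉ K) ∧ M < G (Φ s x)}

namespace IsEscapeSystem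

variable {w : E → E} {Φ : ℝ → E → E} {Sg : Set E} {ψ G : E → ℝ} {K₁ : Set E} {c C M : ℝ}

lemma reverse (h : IsEscapeSystem w Φ Sg ψ G K₁ c C M) :
    IsEscapeSystem (fun x => -w x) (fun t => Φ (-t)) Sg ψ (fun x => -G x) K₁ c C M where
  flow := h.flow.reverse
  continuous := h.continuous.neg
  isClosed := h.isClosed
  invariant x hx t := h.invariant x hx (-t)
  contDiff_proper := h.contDiff_proper
  proper := h.proper
  speed x := by simpa using h.speed x
  contDiff := h.contDiff.neg
  isCompact := h.isCompact
  pos := h.pos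
  escape x hx hK := by
    have : fderiv ℝ (fun x => -G x) x = -fderiv ℝ G x := fderiv_fun_neg
    simpa [this] using h.escape x hx hK
  bound x hx := by simpa using h.bound x hx

lemma differentiable (h : IsEscapeSystem w Φ Sg ψ G K₁ c C M) : Differentiable ℝ G :=
  h.contDiff.differentiable (by simp)

lemma differentiable_proper (h : IsEscapeSystem w Φ Sg ψ G K₁ c C M) : Differentiable ℝ ψ :=
  h.contDiff_proper.differentiable (by simp)

/-- Once `G` exceeds `M`, it increases forever. -/
lemma le_apply_of_lt (h : IsEscapeSystem w Φ Sg ψ G K₁ c C M) {x : E} (hx : x ∈ Sg)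
    (hM : M < G x) {t : ℝ} (ht : 0 ≤ t) : G x + c / 2 * t ≤ G (Φ t x) := by
  have hc := h.pos
  -- compare `-G` along the orbit with the barrier `-G x - c t / 2`
  have := image_le_of_deriv_right_lt_deriv_boundary' (a := 0) (b := t)
    (f := fun s => -G (Φ s x)) (f' := fun s => -fderiv ℝ G (Φ s x) (w (Φ s x)))
    (B := fun s => -G x - c / 2 * s) (B' := fun _ => -(c / 2))
    (h.differentiable.continuous.comp (h.flow.continuous_time x)).neg.continuousOn
    (fun s _ => (h.flow.hasDerivAt_comp h.differentiable x s).neg.hasDerivWithinAt)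
    (by simp [h.flow.zero]) (by fun_prop)
    (fun s _ => by
      have := (((hasDerivAt_id s).const_mul (c / 2)).const_sub (-G x))
      simpa using this.hasDerivWithinAt)
    (fun s hs heq => by
      have hG : M < G (Φ s x) := by
        have : 0 ≤ c / 2 * s := mul_nonneg (by linarith) hs.1
        linarith
      have hnot : Φ s x ∉ K₁ := fun hmem => by
        linarith [(le_abs_self _).trans (h.bound _ hmem)]
      linarith [h.escape _ (h.invariant x hx s) hnot]) ⟨ht, le_rfl⟩
  linarith

lemma notMem_of_lt (h : IsEscapeSystem w Φ Sg ψ G K₁ c C M) {x : E} (hM : M < G x) : x ∉ K₁ :=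
  fun hmem => by linarith [(le_abs_self _).trans (h.bound _ hmem)]

lemma lt_apply_of_lt (h : IsEscapeSystem w Φ Sg ψ G K₁ c C M) {x : E} (hx : x ∈ Sg)
    (hM : M < G x) {t : ℝ} (ht : 0 ≤ t) : M < G (Φ t x) := by
  have : 0 ≤ c / 2 * t := mul_nonneg (by linarith [h.pos]) ht
  linarith [h.le_apply_of_lt hx hM ht]

/-- As long as the orbit stays off `K₁`, `G` increases at rate `c`. -/
lemma le_apply_of_forall_notMem (h : IsEscapeSystem w Φ Sg ψ G K₁ c C M) {x : E} (hx : x ∈ Sg)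
    {t : ℝ} (ht : 0 ≤ t) (hK : ∀ s ∈ Ioo 0 t, Φ s x ∉ K₁) : G x + c * t ≤ G (Φ t x) := by
  have hd := h.flow.hasDerivAt_comp h.differentiable x
  have := (convex_Icc 0 t).mul_sub_le_image_sub_of_le_deriv (f := fun s => G (Φ s x)) (C := c)
    (h.differentiable.continuous.comp (h.flow.continuous_time x)).continuousOn
    (fun s _ => (hd s).differentiableAt.differentiableWithinAt)
    (fun s hs => by
      rw [interior_Icc] at hs
      rw [(hd s).deriv]
      exact h.escape _ (h.invariant x hx s) (hK s hs)) 0 ⟨le_rfl, ht⟩ t ⟨ht, le_rfl⟩ ht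
  simp only [h.flow.zero, sub_zero] at this
  linarith

/-- The orbits that escape to infinity are those along which `G` eventually exceeds `M`. -/
lemma escapes_iff (h : IsEscapeSystem w Φ Sg ψ G K₁ c C M) {x : E} (hx : x ∈ Sg) :
    (∀ L : Set E, IsCompact L → ∃ s₀ : ℝ, 0 ≤ s₀ ∧ ∀ s, s₀ ≤ s → Φ s x ∉ L) ↔
      ∃ s : ℝ, 0 ≤ s ∧ M < G (Φ s x) := by
  have hc := h.pos
  constructor
  · intro H
    obtain ⟨s₀, hs₀, H⟩ := H K₁ h.isCompact
    set t := (|M - G (Φ s₀ x)| + 1) / c with ht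
    have htpos : 0 ≤ t := by positivity
    refine ⟨t + s₀, by positivity, ?_⟩
    have := h.le_apply_of_forall_notMem (h.invariant x hx s₀) htpos fun s hs => by
      rw [← h.flow.add]
      exact H _ (by linarith [hs.1])
    rw [h.flow.add]
    have h2 : c * t = |M - G (Φ s₀ x)| + 1 := by rw [ht]; field_simp
    linarith [le_abs_self (M - G (Φ s₀ x))]
  · rintro ⟨s, hs, hM⟩ L hL
    obtain ⟨B, hB⟩ := hL.bddAbove_image h.differentiable.continuous.continuousOn
    refine ⟨s + 2 * (|B - M|) / c, by positivity, fun t ht hmem => ?_⟩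
    have h1 : G (Φ t x) ≤ B := hB (mem_image_of_mem _ hmem)
    have hst : 0 ≤ t - s := by
      have : 0 ≤ 2 * (|B - M|) / c := by positivity
      linarith
    have h2 := h.le_apply_of_lt (h.invariant x hx s) hM hst
    rw [← h.flow.add, sub_add_cancel] at h2
    have h3 : |B - M| ≤ c / 2 * (t - s) := by
      have : 2 * |B - M| / c ≤ t - s := by linarith
      rw [div_le_iff₀ hc] at this
      linarith
    linarith [le_abs_self (B - M)]

lemma notMem_of_mem_escapeSet (h : IsEscapeSystem w Φ Sg ψ G K₁ c C M) {K : Set E} (hK : K ⊆ K₁)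
    {x : E} (hx : x ∈ Sg) (hesc : x ∈ escapeSet Φ G M K) {t : ℝ} (ht : 0 ≤ t) : Φ t x ∉ K := by
  obtain ⟨s, hs, havoid, hM⟩ := hesc
  rcases le_total t s with hts | hts
  · exact havoid t ⟨ht, hts⟩
  · have := h.lt_apply_of_lt (h.invariant x hx s) hM (sub_nonneg.2 hts)
    rw [← h.flow.add, sub_add_cancel] at this
    exact fun hmem => h.notMem_of_lt this (hK hmem)

/-- A point of `Sg` is outside `escapeSet` exactly if its forward orbit does not escape to infinity
or meets `K`. -/
lemma notMem_escapeSet_iff (h : IsEscapeSystem w Φ Sg ψ G K₁ c C M) {K : Set E} (hK : K ⊆ K₁)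
    {x : E} (hx : x ∈ Sg) : x ∉ escapeSet Φ G M K ↔
      (¬ ∀ L : Set E, IsCompact L → ∃ s₀ : ℝ, 0 ≤ s₀ ∧ ∀ s, s₀ ≤ s → Φ s x ∉ L) ∨
        ∃ t : ℝ, 0 ≤ t ∧ Φ t x ∈ K := by
  rw [h.escapes_iff hx]
  constructor
  · intro hnot
    by_contra! hcon
    obtain ⟨⟨s, hs, hM⟩, havoid⟩ := hcon
    exact hnot ⟨s, hs, fun t ht => havoid t ht.1, hM⟩
  · rintro (hne | ⟨t, ht, hmem⟩) hesc
    · obtain ⟨s, hs, -, hM⟩ := hesc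
      exact hne ⟨s, hs, hM⟩
    · exact h.notMem_of_mem_escapeSet hK hx hesc ht hmem

lemma isOpen_escapeSet (h : IsEscapeSystem w Φ Sg ψ G K₁ c C M) {K : Set E} (hK : IsClosed K) :
    IsOpen (escapeSet Φ G M K) := by
  rw [isOpen_iff_mem_nhds]
  rintro x ⟨s, hs, havoid, hM⟩
  have h1 : ∀ᶠ y in 𝓝 x, ∀ t ∈ Icc 0 s, Φ t y ∉ K := by
    refine isCompact_Icc.eventually_forall_of_forall_eventually fun t ht => ?_
    have hcont : Continuous fun q : E × ℝ => Φ q.2 q.1 := h.flow.continuous.comp continuous_swap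
    exact (hcont.continuousAt (x := (x, t))).preimage_mem_nhds
      (hK.isOpen_compl.mem_nhds (havoid t ht))
  have h2 : ∀ᶠ y in 𝓝 x, M < G (Φ s y) :=
    continuousAt_const.eventually_lt
      (h.differentiable.continuous.comp (h.flow.continuous_space s)).continuousAt hM
  filter_upwards [h1, h2] with y hy1 hy2
  exact ⟨s, hs, hy1, hy2⟩

/-- Points far out at which `G ≥ 0` never meet `K₁` again: before the first meeting `G` would have
to increase up to `M` at most, which takes the time `M / c` only. -/
lemma exists_forall_notMem (h : IsEscapeSystem w Φ Sg ψ G K₁ c C M) :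
    ∃ b : ℝ, ∀ x ∈ Sg, b < ψ x → 0 ≤ G x → ∀ s, 0 ≤ s → Φ s x ∉ K₁ := by
  obtain ⟨B, hB⟩ := h.isCompact.bddAbove_image h.differentiable_proper.continuous.continuousOn
  refine ⟨B + C * (M / c), fun x hx hψ hG s hs hmem => ?_⟩
  have hC : 0 ≤ C := (abs_nonneg _).trans (h.speed x)
  have hA : IsCompact {t | t ∈ Icc 0 s ∧ Φ t x ∈ K₁} :=
    isCompact_Icc.inter_right (h.isCompact.isClosed.preimage (h.flow.continuous_time x))
  obtain ⟨t, ht, hmin⟩ := hA.exists_isLeast ⟨s, ⟨hs, le_rfl⟩, hmem⟩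
  have h1 := h.le_apply_of_forall_notMem hx ht.1.1 fun u hu hmem' =>
    absurd (hmin ⟨⟨hu.1.le, hu.2.le.trans ht.1.2⟩, hmem'⟩) (not_le.2 hu.2)
  have h2 := (le_abs_self _).trans (h.bound _ ht.2)
  have h3 : t ≤ M / c := by rw [le_div_iff₀ h.pos]; linarith
  have h4 := h.flow.le_add_mul_abs h.differentiable_proper h.speed (Φ t x) (-t)
  rw [← h.flow.add, neg_add_cancel, h.flow.zero, abs_neg, abs_of_nonneg ht.1.1] at h4
  have h5 : ψ (Φ t x) ≤ B := hB (mem_image_of_mem _ ht.2)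
  have h6 : C * t ≤ C * (M / c) := by gcongr
  linarith

/-- The points of `Sg` that escape neither forwards nor backwards without meeting `K` form a
compact set. -/
lemma isCompact_diff_escapeSet (h : IsEscapeSystem w Φ Sg ψ G K₁ c C M) {K : Set E}
    (hKc : IsClosed K) (hK : K ⊆ K₁) :
    IsCompact (Sg \ (escapeSet Φ G M K ∪ escapeSet (fun t => Φ (-t)) (fun x => -G x) M K)) := by
  -- an orbit that never meets `K₁` escapes
  have key : ∀ {w : E → E} {Φ : ℝ → E → E} {G : E → ℝ}, IsEscapeSystem w Φ Sg ψ G K₁ c C M →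
      ∀ x ∈ Sg, (∀ s, 0 ≤ s → Φ s x ∉ K₁) → x ∈ escapeSet Φ G M K := by
    intro w Φ G h x hx hnot
    have hc := h.pos
    refine ⟨(|M - G x| + 1) / c, by positivity, fun t ht hmem => hnot t ht.1 (hK hmem), ?_⟩
    have := h.le_apply_of_forall_notMem hx (t := (|M - G x| + 1) / c) (by positivity)
      fun s hs => hnot s hs.1.le
    rw [mul_div_cancel₀ _ hc.ne'] at this
    linarith [le_abs_self (M - G x)]
  obtain ⟨b₁, hb₁⟩ := h.exists_forall_notMem
  obtain ⟨b₂, hb₂⟩ := h.reverse.exists_forall_notMem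
  refine (h.proper (max b₁ b₂)).of_isClosed_subset ?_ ?_
  · exact h.isClosed.sdiff ((h.isOpen_escapeSet hKc).union (h.reverse.isOpen_escapeSet hKc))
  · rintro x ⟨hx, hnot⟩
    rw [mem_union, not_or] at hnot
    by_contra hgt
    rw [mem_ofPred, not_le, max_lt_iff] at hgt
    rcases le_total 0 (G x) with hG | hG
    · exact hnot.1 (key h x hx (hb₁ x hx hgt.1 hG))
    · exact hnot.2 (key h.reverse x hx (hb₂ x hx hgt.2 (by simpa using hG)))

end IsEscapeSystem

end Lyapunov

/-! ### Locally Lipschitz Lyapunov functions -/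

section Lyapunov

variable {E : Type*} [NormedAddCommGroup E] [NormedSpace ℝ E]

/-- The infimum of `g(Φ_s x) - κ s` over the times `0 ≤ s ≤ S`. Up to the effect of the end of the
time window it increases at rate at least `κ` along every orbit. -/
def minAlong (Φ : ℝ → E → E) (g : E → ℝ) (κ S : ℝ) (x : E) : ℝ :=
  sInf ((fun s => g (Φ s x) - κ * s) '' Icc 0 S)

section minAlong

variable {w : E → E} {Φ : ℝ → E → E} {g : E → ℝ} {κ S : ℝ}

lemma continuous_minAlong_integrand (h : IsFlow w Φ) (hg : Continuous g) (κ : ℝ) (x : E) :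
    Continuous fun s => g (Φ s x) - κ * s :=
  (hg.comp (h.continuous_time x)).sub (continuous_const.mul continuous_id)

lemma minAlong_le (h : IsFlow w Φ) (hg : Continuous g) (x : E) {s : ℝ} (hs : s ∈ Icc 0 S) :
    minAlong Φ g κ S x ≤ g (Φ s x) - κ * s :=
  csInf_le (isCompact_Icc.image (continuous_minAlong_integrand h hg κ x)).bddBelow
    (mem_image_of_mem _ hs)

lemma le_minAlong {X : Type*} {Φ : ℝ → X → X} {g : X → ℝ} {κ S : ℝ} (hS : 0 ≤ S) {x : X} {a : ℝ}
    (ha : ∀ s ∈ Icc 0 S, a ≤ g (Φ s x) - κ * s) : a ≤ minAlong Φ g κ S x :=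
  le_csInf ((nonempty_Icc.2 hS).image _) (by rintro _ ⟨s, hs, rfl⟩; exact ha s hs)

lemma locallyLipschitz_minAlong [FiniteDimensional ℝ E] (h : IsFlow w Φ) (hg : ContDiff ℝ 1 g)
    (hS : 0 ≤ S) : LocallyLipschitz (minAlong Φ g κ S) := by
  intro x₀
  have hX := isCompact_closedBall x₀ (1 : ℝ)
  obtain ⟨L₁, hL₁⟩ := h.lipschitz _ hX S
  obtain ⟨L₂, hL₂⟩ := exists_lipschitzOnWith_of_isCompact hg
    ((isCompact_Icc.prod hX).image h.continuous : IsCompact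
      ((fun q : ℝ × E => Φ q.1 q.2) '' (Icc 0 S ×ˢ Metric.closedBall x₀ 1)))
  refine ⟨L₂ * L₁, _, Metric.closedBall_mem_nhds x₀ one_pos,
    LipschitzOnWith.of_le_add_mul _ fun x hx y hy => ?_⟩
  rw [← sub_le_iff_le_add]
  refine le_minAlong hS fun s hs => ?_
  have h1 := hL₂.dist_le_mul (Φ s x) (mem_image_of_mem _ (mk_mem_prod hs hx))
    (Φ s y) (mem_image_of_mem _ (mk_mem_prod hs hy))
  have h2 := (hL₁ s ⟨by linarith [hs.1, hs.2], hs.2⟩).dist_le_mul x hx y hy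
  have h3 : (L₂ : ℝ) * dist (Φ s x) (Φ s y) ≤ L₂ * (L₁ * dist x y) := by gcongr
  have h4 := minAlong_le (κ := κ) h hg.continuous x hs
  have h5 := (le_abs_self _).trans_eq (Real.dist_eq (g (Φ s x)) (g (Φ s y))).symm
  push_cast
  linarith

lemma minAlong_add_le (h : IsFlow w Φ) (hg : Continuous g) (hS : 0 ≤ S) {x : E} {t : ℝ}
    (ht : 0 ≤ t)
    (hend : ∀ s ∈ Icc S (S + t), g (Φ S x) - κ * S ≤ g (Φ s x) - κ * s) :
    minAlong Φ g κ S x + κ * t ≤ minAlong Φ g κ S (Φ t x) := by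
  refine le_minAlong hS fun s hs => ?_
  rw [← h.add]
  have key : minAlong Φ g κ S x ≤ g (Φ (s + t) x) - κ * (s + t) := by
    rcases le_total (s + t) S with hle | hle
    · exact minAlong_le h hg x ⟨by linarith [hs.1], hle⟩
    · exact (minAlong_le h hg x ⟨hS, le_rfl⟩).trans (hend _ ⟨hle, by linarith [hs.2]⟩)
  linarith

/-- If `g` increases at a rate above `κ` at the end of the time window, then `minAlong` increases at
rate `κ` near the given point. -/
lemma eventually_minAlong_add_le (h : IsFlow w Φ) (hw : Continuous w) (hg : ContDiff ℝ 1 g)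
    (hS : 0 ≤ S) {x : E} (hx : κ < fderiv ℝ g (Φ S x) (w (Φ S x))) :
    ∃ t₀ > 0, ∀ᶠ z in 𝓝 x, ∀ t ∈ Icc 0 t₀,
      minAlong Φ g κ S z + κ * t ≤ minAlong Φ g κ S (Φ t z) := by
  have hgd : Differentiable ℝ g := hg.differentiable one_ne_zero
  have hcont : Continuous fun q : ℝ × E => fderiv ℝ g (Φ q.1 q.2) (w (Φ q.1 q.2)) :=
    ((hg.continuous_fderiv one_ne_zero).comp h.continuous).clm_apply (hw.comp h.continuous)
  have hev : ∀ᶠ q : ℝ × E in 𝓝 (S, x), κ < fderiv ℝ g (Φ q.1 q.2) (w (Φ q.1 q.2)) :=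
    continuousAt_const.eventually_lt hcont.continuousAt hx
  obtain ⟨ε, hε, H⟩ := Metric.eventually_nhds_iff.1 hev
  refine ⟨ε / 2, half_pos hε, ?_⟩
  filter_upwards [Metric.ball_mem_nhds x (half_pos hε)] with z hz t ht
  rw [Metric.mem_ball] at hz
  refine minAlong_add_le h hg.continuous hS ht.1 fun s hs => ?_
  have hd := h.hasDerivAt_comp hgd z
  have := (convex_Icc S (S + t)).mul_sub_le_image_sub_of_le_deriv (f := fun s => g (Φ s z))
    (C := κ) (hg.continuous.comp (h.continuous_time z)).continuousOn
    (fun s _ => (hd s).differentiableAt.differentiableWithinAt)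
    (fun s hs => by
      rw [interior_Icc] at hs
      rw [(hd s).deriv]
      refine (H (y := (s, z)) ?_).le
      rw [Prod.dist_eq, max_lt_iff, Real.dist_eq, abs_of_nonneg (by linarith [hs.1])]
      exact ⟨by dsimp; linarith [hs.2, ht.2], by dsimp; linarith⟩)
    S ⟨le_rfl, by linarith [ht.1]⟩ s hs hs.1
  linarith

end minAlong

namespace IsEscapeSystem

variable {w : E → E} {Φ : ℝ → E → E} {Sg : Set E} {ψ G : E → ℝ} {K₁ : Set E} {c C M : ℝ}

/-- The time after which `G > M` can be chosen uniformly on compact sets of escaping points. -/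
lemma exists_uniform_time (h : IsEscapeSystem w Φ Sg ψ G K₁ c C M) {L : Set E} (hL : IsCompact L)
    {K : Set E} (hLesc : L ⊆ escapeSet Φ G M K) :
    ∃ S : ℝ, 0 ≤ S ∧ ∀ x ∈ L, x ∈ Sg → ∀ s, S ≤ s → M < G (Φ s x) := by
  refine hL.induction_on (p := fun A => ∃ S : ℝ, 0 ≤ S ∧ ∀ x ∈ A, x ∈ Sg → ∀ s, S ≤ s →
    M < G (Φ s x)) ⟨0, le_rfl, by simp⟩ ?_ ?_ ?_
  · rintro s t hst ⟨S, hS, H⟩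
    exact ⟨S, hS, fun x hx => H x (hst hx)⟩
  · rintro s t ⟨S, hS, H⟩ ⟨S', hS', H'⟩
    refine ⟨max S S', hS.trans (le_max_left _ _), ?_⟩
    rintro x (hx | hx) hxS u hu
    · exact H x hx hxS u ((le_max_left _ _).trans hu)
    · exact H' x hx hxS u ((le_max_right _ _).trans hu)
  · intro x hx
    obtain ⟨s, hs, -, hM⟩ := hLesc hx
    refine ⟨{y | M < G (Φ s y)}, mem_nhdsWithin_of_mem_nhds ?_, s, hs, fun y hy hyS u hu => ?_⟩
    · exact continuousAt_const.eventually_lt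
        (h.differentiable.continuous.comp (h.flow.continuous_space s)).continuousAt hM
    · have := h.lt_apply_of_lt (h.invariant y hyS s) hy (sub_nonneg.2 hu)
      rwa [← h.flow.add, sub_add_cancel] at this

/-- The Lyapunov function before smoothing. With a bump `β` that is `1` on `K` it is the infimum of
`(G - λ β)(Φ_s x) - c s / 2` over a long time window: at points that do not escape, or meet `K`, it
is very negative; far out it is `G`; and wherever it is not very negative, the window ends off
`K₁`, so that it increases. -/
lemma exists_locallyLipschitz_lyapunov [FiniteDimensional ℝ E]
    (h : IsEscapeSystem w Φ Sg ψ G K₁ c C M)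
    {K L : Set E} (hKc : IsClosed K) (hK : K ⊆ interior K₁) (hL : IsCompact L) (hLS : L ⊆ Sg)
    (hLesc : L ⊆ escapeSet Φ G M K) :
    ∃ T₀ : ℝ, ∀ T, T₀ ≤ T → ∃ (f : E → ℝ) (b : ℝ), LocallyLipschitz f ∧
      (∀ x ∈ Sg, b < ψ x → f x = G x) ∧
      (∀ x ∈ Sg, x ∉ escapeSet Φ G M K → f x ≤ -T) ∧
      (∀ x ∈ Sg, -T < f x → ∃ t₀ > 0, ∀ᶠ z in 𝓝 x, ∀ t ∈ Icc 0 t₀,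
        f z + c / 2 * t ≤ f (Φ t z)) ∧
      (∀ x ∈ L, -T₀ ≤ f x) ∧
      (∀ x ∈ Sg, (∀ s, 0 ≤ s → Φ s x ∉ K₁) → 0 ≤ G x → 0 ≤ f x) := by
  have hc := h.pos
  have hGc : Continuous G := h.contDiff.continuous
  have hKK₁ : K ⊆ K₁ := hK.trans interior_subset
  obtain ⟨S₁, hS₁, hM⟩ := h.exists_uniform_time hL hLesc
  set Z : Set E := (fun q : ℝ × E => Φ q.1 q.2) '' (Icc 0 S₁ ×ˢ L) with hZ
  have hZc : IsCompact Z := (isCompact_Icc.prod hL).image h.flow.continuous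
  have hZK : ∀ x ∈ K, x ∉ Z := by
    rintro _ hxK ⟨⟨s, x⟩, ⟨hs, hx⟩, rfl⟩
    exact h.notMem_of_mem_escapeSet hKK₁ (hLS hx) (hLesc hx) hs.1 hxK
  -- the bump `β` is supported in `K₁` and off the forward orbit of `L`
  obtain ⟨β, hβs, hβ0, hβ1, hβ01⟩ : ∃ β : E → ℝ, ContDiff ℝ ∞ β ∧
      (∀ x, x ∉ K₁ ∨ x ∈ Z → β x = 0) ∧ (∀ x ∈ K, β x = 1) ∧ ∀ x, 0 ≤ β x := by
    obtain ⟨f, hf0, hf1, hf⟩ := exists_contMDiffMap_zero_one_of_isClosed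
      (modelWithCornersSelf ℝ E) (n := ⊤) (s := (interior K₁ \ Z)ᶜ) (t := K)
      (isOpen_interior.sdiff hZc.isClosed).isClosed_compl hKc
      (disjoint_left.2 fun x hx hxK => hx ⟨hK hxK, hZK x hxK⟩)
    refine ⟨f, f.contMDiff.contDiff, fun x hx => hf0 ?_, fun x hx => hf1 hx, fun x => (hf x).1⟩
    rintro ⟨h1, h2⟩
    rcases hx with hx | hx
    · exact hx (interior_subset h1)
    · exact h2 hx
  obtain ⟨B, hB⟩ := ((isCompact_Icc (a := (0 : ℝ)) (b := S₁)).prod hL).bddBelow_image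
    (f := fun q : ℝ × E => G (Φ q.1 q.2) - c / 2 * q.1)
    ((hGc.comp h.flow.continuous).sub (continuous_const.mul continuous_fst)).continuousOn
  obtain ⟨b₁, hb₁⟩ := h.isCompact.bddAbove_image h.differentiable_proper.continuous.continuousOn
  have hlowL : ∀ x ∈ L, ∀ s, 0 ≤ s → B ≤ G (Φ s x) - c / 2 * s := by
    intro x hx s hs
    rcases le_total s S₁ with hle | hle
    · exact hB (mem_image_of_mem (fun q : ℝ × E => G (Φ q.1 q.2) - c / 2 * q.1)
        (mk_mem_prod (⟨hs, hle⟩ : s ∈ Icc 0 S₁) hx))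
    · have h1 : B ≤ G (Φ S₁ x) - c / 2 * S₁ :=
        hB (mem_image_of_mem (fun q : ℝ × E => G (Φ q.1 q.2) - c / 2 * q.1)
          (mk_mem_prod (⟨hS₁, le_rfl⟩ : S₁ ∈ Icc 0 S₁) hx))
      have h2 := h.le_apply_of_lt (h.invariant x (hLS hx) S₁) (hM x hx (hLS hx) S₁ le_rfl)
        (sub_nonneg.2 hle)
      rw [← h.flow.add, sub_add_cancel] at h2
      linarith
  refine ⟨-B, fun T hT => ?_⟩
  set lam : ℝ := |M + T| with hlam
  set S : ℝ := 2 * |M + T| / c with hSdef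
  have hS : 0 ≤ S := by positivity
  have hcS : c / 2 * S = |M + T| := by rw [hSdef]; field_simp
  have hMT := le_abs_self (M + T)
  set g : E → ℝ := fun x => G x - lam * β x with hg
  have hgs : ContDiff ℝ ∞ g := h.contDiff.sub (contDiff_const.mul hβs)
  have hgs1 : ContDiff ℝ 1 g := hgs.of_le (by simp)
  have hgle : ∀ x, g x ≤ G x := fun x => by
    have := mul_nonneg (abs_nonneg (M + T)) (hβ01 x)
    simp only [hg]; linarith
  have hgeq : ∀ x, x ∉ K₁ ∨ x ∈ Z → g x = G x := fun x hx => by simp [hg, hβ0 x hx]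
  have hgd : ∀ x, x ∉ K₁ → fderiv ℝ g x = fderiv ℝ G x := by
    intro x hx
    refine Filter.EventuallyEq.fderiv_eq ?_
    filter_upwards [h.isCompact.isClosed.isOpen_compl.mem_nhds hx] with y hy
    exact hgeq y (Or.inl hy)
  have hM' : ∀ x ∈ K₁, g x ≤ M := fun x hx =>
    (hgle x).trans ((le_abs_self _).trans (h.bound x hx))
  set f := minAlong Φ g (c / 2) S with hf
  -- an orbit that never meets `K₁` in the time window has its infimum at time `0`
  have hfeq : ∀ x ∈ Sg, (∀ s ∈ Icc 0 S, Φ s x ∉ K₁) → f x = G x := by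
    intro x hx hnot
    have h0 := hnot 0 ⟨le_rfl, hS⟩
    rw [h.flow.zero] at h0
    refine le_antisymm ?_ (le_minAlong hS fun s hs => ?_)
    · have := minAlong_le (κ := c / 2) h.flow hgs.continuous x (⟨le_rfl, hS⟩ : (0 : ℝ) ∈ Icc 0 S)
      rwa [h.flow.zero, mul_zero, sub_zero, hgeq x (Or.inl h0)] at this
    · rw [hgeq _ (Or.inl (hnot s hs))]
      have := h.le_apply_of_forall_notMem hx hs.1 fun u hu =>
        hnot u ⟨hu.1.le, hu.2.le.trans hs.2⟩
      have := mul_nonneg hc.le hs.1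
      linarith
  refine ⟨f, b₁ + C * S, locallyLipschitz_minAlong h.flow hgs1 hS, ?_, ?_, ?_, ?_, ?_⟩
  · intro x hx hψ
    refine hfeq x hx fun s hs hmem => ?_
    have h1 : ψ (Φ s x) ≤ b₁ := hb₁ (mem_image_of_mem _ hmem)
    have h2 := h.flow.le_add_mul_abs h.differentiable_proper h.speed (Φ s x) (-s)
    rw [← h.flow.add, neg_add_cancel, h.flow.zero, abs_neg, abs_of_nonneg hs.1] at h2
    have hC : 0 ≤ C := (abs_nonneg _).trans (h.speed x)
    have h3 : C * s ≤ C * S := by gcongr; exact hs.2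
    linarith
  · intro x hx hnot
    by_cases hhit : ∃ t ∈ Icc 0 S, Φ t x ∈ K
    · obtain ⟨t, ht, hmem⟩ := hhit
      have h1 := minAlong_le (κ := c / 2) h.flow hgs.continuous x ht
      have h2 := (le_abs_self _).trans (h.bound _ (hKK₁ hmem))
      have h3 : g (Φ t x) = G (Φ t x) - lam := by simp [hg, hβ1 _ hmem]
      have h4 := mul_nonneg hc.le ht.1
      linarith
    · have h0 : G (Φ S x) ≤ M := by
        by_contra hlt
        exact hnot ⟨S, hS, fun t ht hmem => hhit ⟨t, ht, hmem⟩, not_le.1 hlt⟩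
      have h1 := minAlong_le (κ := c / 2) h.flow hgs.continuous x (⟨hS, le_rfl⟩ : S ∈ Icc 0 S)
      have h2 := hgle (Φ S x)
      linarith
  · intro x hx hfx
    have hend : Φ S x ∉ K₁ := fun hmem => by
      have h1 := minAlong_le (κ := c / 2) h.flow hgs.continuous x (⟨hS, le_rfl⟩ : S ∈ Icc 0 S)
      linarith [hM' _ hmem]
    refine eventually_minAlong_add_le h.flow h.continuous hgs1 hS ?_
    rw [hgd _ hend]
    linarith [h.escape _ (h.invariant x hx S) hend]
  · intro x hx
    rw [neg_neg]
    refine le_minAlong hS fun s hs => ?_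
    have : g (Φ s x) = G (Φ s x) := by
      refine hgeq _ ?_
      rcases le_total s S₁ with hle | hle
      · exact Or.inr ⟨(s, x), ⟨⟨hs.1, hle⟩, hx⟩, rfl⟩
      · exact Or.inl (h.notMem_of_lt (hM x hx (hLS hx) s hle))
    rw [this]
    exact hlowL x hx s hs.1
  · intro x hx hnot hG
    rwa [hfeq x hx fun s hs => hnot s hs.1]

end IsEscapeSystem

end Lyapunov

/-! ### Smooth Lyapunov functions -/

section Lyapunov

variable {E : Type*} [NormedAddCommGroup E] [NormedSpace ℝ E] [FiniteDimensional ℝ E]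
  [MeasurableSpace E] [BorelSpace E]

namespace IsEscapeSystem

variable {w : E → E} {Φ : ℝ → E → E} {Sg : Set E} {ψ G : E → ℝ} {K₁ : Set E} {c C M : ℝ}

/-- The smooth Lyapunov function: the locally Lipschitz one is smoothed on a large compact set and
glued to `G`, which is harmless because on `Sg` the two agree far out. -/
lemma exists_contDiff_lyapunov (h : IsEscapeSystem w Φ Sg ψ G K₁ c C M)
    {K L : Set E} (hKc : IsClosed K) (hK : K ⊆ interior K₁) (hL : IsCompact L) (hLS : L ⊆ Sg)
    (hLesc : L ⊆ escapeSet Φ G M K) :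
    ∃ T₀ : ℝ, ∀ T, T₀ ≤ T → ∃ (F : E → ℝ) (b : ℝ), ContDiff ℝ ∞ F ∧
      (∀ x, b < ψ x → F x = G x) ∧
      (∀ x ∈ Sg, x ∉ escapeSet Φ G M K → F x < -T) ∧
      (∀ x ∈ Sg, -T ≤ F x → 0 < fderiv ℝ F x (w x)) ∧
      (∀ x ∈ L, -T < F x) ∧
      (∀ x ∈ Sg, (∀ s, 0 ≤ s → Φ s x ∉ K₁) → 0 ≤ G x → -T < F x) := by
  have hc := h.pos
  have hψc : Continuous ψ := h.contDiff_proper.continuous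
  obtain ⟨T₁, H⟩ := h.exists_locallyLipschitz_lyapunov hKc hK hL hLS hLesc
  refine ⟨max (T₁ + 2) 2, fun T hT => ?_⟩
  have hT1 : T₁ + 2 ≤ T := (le_max_left _ _).trans hT
  have hT2 : 2 ≤ T := (le_max_right _ _).trans hT
  obtain ⟨f, b', hf, hfar, hneg, hinc, hfL, hfpos⟩ := H (T + 2) (by linarith)
  obtain ⟨b₁, hb₁⟩ := h.isCompact.bddAbove_image hψc.continuousOn
  set b := max b' b₁ with hb
  have hfar' : ∀ x ∈ Sg, b < ψ x → f x = G x := fun x hx hlt =>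
    hfar x hx ((le_max_left _ _).trans_lt hlt)
  have hoff : ∀ x, b < ψ x → x ∉ K₁ := fun x hlt hmem => by
    have h1 : ψ x ≤ b₁ := hb₁ (mem_image_of_mem _ hmem)
    linarith [le_max_right b' b₁]
  set κ : E → ℝ := fun x => Real.smoothTransition (b + 2 - ψ x) with hκ
  have hκs : ContDiff ℝ ∞ κ :=
    Real.smoothTransition.contDiff.comp (contDiff_const.sub h.contDiff_proper)
  have hκ1 : ∀ x, ψ x ≤ b + 1 → κ x = 1 := fun x hx =>
    Real.smoothTransition.one_of_one_le (by linarith)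
  have hκ0 : ∀ x, b + 2 ≤ ψ x → κ x = 0 := fun x hx =>
    Real.smoothTransition.zero_of_nonpos (by linarith)
  have hκn : ∀ x, 0 ≤ κ x := fun x => Real.smoothTransition.nonneg _
  have hκl : ∀ x, κ x ≤ 1 := fun x => Real.smoothTransition.le_one _
  have hY := h.proper (b + 2)
  obtain ⟨D, hD⟩ := hY.exists_bound_of_continuousOn (f := fun x => fderiv ℝ κ x (w x))
    ((hκs.continuous_fderiv (by simp)).clm_apply h.continuous).continuousOn
  set δ : ℝ := min 1 (c / (8 * (|D| + 1))) with hδ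
  have hδpos : 0 < δ := lt_min one_pos (by positivity)
  have hδ1 : δ ≤ 1 := min_le_left _ _
  have hδD : |D| * δ ≤ c / 8 := by
    have h1 : δ ≤ c / (8 * (|D| + 1)) := min_le_right _ _
    rw [le_div_iff₀ (by positivity)] at h1
    nlinarith [abs_nonneg D]
  have hX : IsCompact (Sg ∩ {x | -(T + 1) ≤ f x} ∩ {x | ψ x ≤ b + 2}) :=
    hY.inter_left (h.isClosed.inter (isClosed_le continuous_const hf.continuous))
  obtain ⟨F₁, hF₁s, hF₁f, hF₁w⟩ := exists_contDiff_approx_of_increasing h.flow h.continuous hf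
    (half_pos hc) hX hY (fun x hx => hinc x hx.1.1 (by linarith [hx.1.2.out])) hδpos
  set F : E → ℝ := fun x => G x + κ x * (F₁ x - G x) with hF
  have hFs : ContDiff ℝ ∞ F := h.contDiff.add (hκs.mul (hF₁s.sub h.contDiff))
  have hFf : ∀ x ∈ Sg, |F x - f x| ≤ δ := by
    intro x hx
    rcases le_or_gt (ψ x) (b + 1) with h1 | h1
    · have : F x = F₁ x := by simp [hF, hκ1 x h1]
      rw [this]
      exact hF₁f x (show ψ x ≤ b + 2 by linarith)
    · have hfx := hfar' x hx (by linarith)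
      rcases le_or_gt (ψ x) (b + 2) with h2 | h2
      · have : F x - f x = κ x * (F₁ x - f x) := by simp only [hF, hfx]; ring
        rw [this, abs_mul, abs_of_nonneg (hκn x)]
        exact (mul_le_of_le_one_left (abs_nonneg _) (hκl x)).trans (hF₁f x h2)
      · have : F x - f x = 0 := by simp [hF, hfx, hκ0 x h2.le]
        rw [this, abs_zero]
        exact hδpos.le
  refine ⟨F, b + 2, hFs, fun x hx => by simp [hF, hκ0 x hx.le], fun x hx hnot => ?_,
    fun x hx hFx => ?_, fun x hx => ?_, fun x hx hnot hG => ?_⟩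
  · linarith [hneg x hx hnot, (abs_le.1 (hFf x hx)).2]
  · have hfx : -(T + 1) ≤ f x := by linarith [(abs_le.1 (hFf x hx)).2]
    have hderiv : fderiv ℝ F x (w x) = (1 - κ x) * fderiv ℝ G x (w x) +
        κ x * fderiv ℝ F₁ x (w x) + fderiv ℝ κ x (w x) * (F₁ x - G x) := by
      have dG := (h.differentiable x).hasFDerivAt
      have dκ := (hκs.differentiable (by simp) x).hasFDerivAt
      have dF := (hF₁s.differentiable (by simp) x).hasFDerivAt
      have := (dG.add (dκ.mul (dF.sub dG))).fderiv
      rw [show F = G + κ * (F₁ - G) from rfl, this]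
      simp only [add_apply, smul_apply, sub_apply, smul_eq_mul, Pi.sub_apply]
      ring
    rcases le_or_gt (ψ x) b with h1 | h1
    · have e : κ =ᶠ[𝓝 x] fun _ => 1 := by
        filter_upwards [hψc.continuousAt.eventually_lt (continuousAt_const (y := b + 1))
          (by linarith)] with y hy
        exact hκ1 y hy.le
      have hd : fderiv ℝ κ x = 0 := by rw [e.fderiv_eq]; simp
      rw [hderiv, hd, hκ1 x (by linarith)]
      have := hF₁w x ⟨⟨hx, hfx⟩, show ψ x ≤ b + 2 by linarith⟩
      simp only [zero_apply]
      linarith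
    · have hG := h.escape x hx (hoff x h1)
      rcases le_or_gt (ψ x) (b + 2) with h2 | h2
      · have h3 := hF₁w x ⟨⟨hx, hfx⟩, h2⟩
        have h4 := hF₁f x h2
        rw [hfar' x hx h1] at h4
        have h5 : |fderiv ℝ κ x (w x) * (F₁ x - G x)| ≤ c / 8 := by
          rw [abs_mul]
          refine le_trans ?_ hδD
          exact mul_le_mul ((hD x h2).trans (le_abs_self D)) h4 (abs_nonneg _) (abs_nonneg _)
        have h6 : c / 4 ≤ (1 - κ x) * fderiv ℝ G x (w x) + κ x * fderiv ℝ F₁ x (w x) := by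
          have := mul_le_mul_of_nonneg_left (show c / 4 ≤ fderiv ℝ G x (w x) by linarith)
            (sub_nonneg.2 (hκl x))
          have := mul_le_mul_of_nonneg_left (show c / 4 ≤ fderiv ℝ F₁ x (w x) by linarith) (hκn x)
          linarith
        rw [hderiv]
        linarith [(abs_le.1 h5).1]
      · have e : κ =ᶠ[𝓝 x] fun _ => 0 := by
          filter_upwards [(continuousAt_const (y := b + 2)).eventually_lt hψc.continuousAt h2]
            with y hy
          exact hκ0 y hy.le
        have hd : fderiv ℝ κ x = 0 := by rw [e.fderiv_eq]; simp
        rw [hderiv, hd, hκ0 x h2.le]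
        simp only [zero_apply]
        linarith
  · linarith [hfL x hx, (abs_le.1 (hFf x (hLS hx))).1]
  · linarith [hfpos x hx hnot hG, (abs_le.1 (hFf x hx)).1]

/-- A Lyapunov function for the forward escaping points and one for the backward escaping points,
which together cover `Sg` off the given neighbourhood of the remaining points. -/
theorem exists_lyapunov_pair (h : IsEscapeSystem w Φ Sg ψ G K₁ c C M)
    {K U : Set E} (hKc : IsClosed K) (hK : K ⊆ interior K₁) (hU : IsOpen U)
    (hKU : Sg \ (escapeSet Φ G M K ∪ escapeSet (fun t => Φ (-t)) (fun x => -G x) M K) ⊆ U) :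
    ∃ (T b : ℝ) (F₁ F₂ : E → ℝ), 0 < T ∧ ContDiff ℝ ∞ F₁ ∧ ContDiff ℝ ∞ F₂ ∧
      (∀ x, b < ψ x → F₁ x = G x ∧ F₂ x = G x) ∧
      (∀ x ∈ Sg \ (escapeSet Φ G M K ∪ escapeSet (fun t => Φ (-t)) (fun x => -G x) M K),
        F₁ x < -T ∧ T < F₂ x) ∧
      (∀ x ∈ Sg, -T ≤ F₁ x → 0 < fderiv ℝ F₁ x (w x)) ∧
      (∀ x ∈ Sg, F₂ x ≤ T → 0 < fderiv ℝ F₂ x (w x)) ∧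
      ∀ x ∈ Sg \ U, -T < F₁ x ∨ F₂ x < T := by
  have h' := h.reverse
  have hKK₁ := hK.trans interior_subset
  obtain ⟨b₁, hb₁⟩ := h.exists_forall_notMem
  obtain ⟨b₂, hb₂⟩ := h'.exists_forall_notMem
  have hQ : IsCompact ((Sg \ U) ∩ {x | ψ x ≤ max b₁ b₂}) :=
    (h.proper _).inter_left (h.isClosed.sdiff hU)
  obtain ⟨L₁, L₂, hL₁, hL₂, hL₁e, hL₂e, hQL⟩ := hQ.binary_compact_cover
    (h.isOpen_escapeSet hKc) (h'.isOpen_escapeSet hKc) (by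
      rintro x ⟨⟨hx, hxU⟩, -⟩
      by_contra hnot
      exact hxU (hKU ⟨hx, hnot⟩))
  have hL₁S : L₁ ⊆ Sg := fun x hx => (hQL.symm.subset (Or.inl hx)).1.1
  have hL₂S : L₂ ⊆ Sg := fun x hx => (hQL.symm.subset (Or.inr hx)).1.1
  obtain ⟨T₁, H₁⟩ := h.exists_contDiff_lyapunov hKc hK hL₁ hL₁S hL₁e
  obtain ⟨T₂, H₂⟩ := h'.exists_contDiff_lyapunov hKc hK hL₂ hL₂S hL₂e
  set T := max 1 (max T₁ T₂) with hT
  have hT0 : 0 < T := one_pos.trans_le (le_max_left _ _)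
  obtain ⟨F₁, c₁, s₁, far₁, neg₁, der₁, low₁, pos₁⟩ :=
    H₁ T ((le_max_left _ _).trans (le_max_right _ _))
  obtain ⟨F₂, c₂, s₂, far₂, neg₂, der₂, low₂, pos₂⟩ :=
    H₂ T ((le_max_right _ _).trans (le_max_right _ _))
  refine ⟨T, max c₁ c₂, F₁, fun x => -F₂ x, hT0, s₁, s₂.neg, fun x hx => ?_, ?_, der₁, ?_, ?_⟩
  · rw [max_lt_iff] at hx
    exact ⟨far₁ x hx.1, by simp [far₂ x hx.2]⟩
  · rintro x ⟨hx, hnot⟩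
    rw [mem_union, not_or] at hnot
    exact ⟨neg₁ x hx hnot.1, by linarith [neg₂ x hx hnot.2]⟩
  · intro x hx hle
    have := der₂ x hx (by linarith)
    have e : fderiv ℝ (fun x => -F₂ x) x = -fderiv ℝ F₂ x := fderiv_fun_neg
    rw [e]
    simpa using this
  · rintro x hx
    rcases le_or_gt (ψ x) (max b₁ b₂) with hle | hgt
    · have : x ∈ L₁ ∪ L₂ := hQL.subset ⟨hx, hle⟩
      rcases this with hx' | hx'
      · exact Or.inl (low₁ x hx')
      · exact Or.inr (by linarith [low₂ x hx'])
    · rw [max_lt_iff] at hgt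
      rcases le_total 0 (G x) with hG | hG
      · exact Or.inl (pos₁ x hx.1 (hb₁ x hx.1 hgt.1 hG) hG)
      · have hG' : 0 ≤ -G x := by linarith
        have := pos₂ x hx.1 (hb₂ x hx.1 hgt.2 hG') hG'
        exact Or.inr (by linarith)

end IsEscapeSystem

end Lyapunov

/-! ### The modified escape function -/

section Ramp

/-- The slope of `ramp T`: a smooth step from `0` at `-T` to `1` at `T`. -/
def rampSlope (T s : ℝ) : ℝ := Real.smoothTransition ((s + T) / (2 * T))

/-- A smooth convex function which is `0` for `s ≤ -T`, and `s` for `s ≥ T`. -/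
def ramp (T s : ℝ) : ℝ := ∫ u in (-T)..s, rampSlope T u

lemma contDiff_rampSlope (T : ℝ) : ContDiff ℝ ∞ (rampSlope T) :=
  Real.smoothTransition.contDiff.comp ((contDiff_id.add contDiff_const).div_const _)

lemma rampSlope_nonneg (T s : ℝ) : 0 ≤ rampSlope T s := Real.smoothTransition.nonneg _

lemma rampSlope_le_one (T s : ℝ) : rampSlope T s ≤ 1 := Real.smoothTransition.le_one _

lemma rampSlope_eq_zero {T s : ℝ} (hT : 0 < T) (hs : s ≤ -T) : rampSlope T s = 0 :=
  Real.smoothTransition.zero_of_nonpos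
    (div_nonpos_of_nonpos_of_nonneg (by linarith) (by linarith))

lemma rampSlope_pos {T s : ℝ} (hT : 0 < T) (hs : -T < s) : 0 < rampSlope T s :=
  Real.smoothTransition.pos_of_pos (div_pos (by linarith) (by linarith))

lemma monotone_rampSlope {T : ℝ} (hT : 0 < T) : Monotone (rampSlope T) := fun s t hst =>
  Real.smoothTransition.monotone (by gcongr)

lemma rampSlope_add_rampSlope_neg {T : ℝ} (hT : 0 < T) (s : ℝ) :
    rampSlope T s + rampSlope T (-s) = 1 := by
  have e : (-s + T) / (2 * T) = 1 - (s + T) / (2 * T) := by field_simp; ring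
  rw [rampSlope, rampSlope, e, Real.smoothTransition, Real.smoothTransition, sub_sub_cancel]
  rw [add_comm (expNegInvGlue (1 - _)), ← add_div]
  exact div_self (Real.smoothTransition.pos_denom _).ne'

lemma hasDerivAt_ramp (T s : ℝ) : HasDerivAt (ramp T) (rampSlope T s) s :=
  intervalIntegral.integral_hasDerivAt_right
    ((contDiff_rampSlope T).continuous.intervalIntegrable _ _)
    ((contDiff_rampSlope T).continuous.stronglyMeasurableAtFilter _ _)
    (contDiff_rampSlope T).continuous.continuousAt

lemma contDiff_ramp (T : ℝ) : ContDiff ℝ ∞ (ramp T) := by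
  refine contDiff_infty_iff_deriv.2 ⟨fun s => (hasDerivAt_ramp T s).differentiableAt, ?_⟩
  rw [show deriv (ramp T) = rampSlope T from funext fun s => (hasDerivAt_ramp T s).deriv]
  exact contDiff_rampSlope T

lemma ramp_eq_zero {T s : ℝ} (hT : 0 < T) (hs : s ≤ -T) : ramp T s = 0 := by
  rw [ramp, intervalIntegral.integral_congr (g := fun _ => 0)]
  · simp
  · intro u hu
    rw [uIcc_of_ge hs] at hu
    exact rampSlope_eq_zero hT hu.2

lemma ramp_nonneg {T : ℝ} (hT : 0 < T) (s : ℝ) : 0 ≤ ramp T s := by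
  rcases le_total s (-T) with hs | hs
  · rw [ramp_eq_zero hT hs]
  · exact intervalIntegral.integral_nonneg hs fun u _ => rampSlope_nonneg T u

/-- The slope of `ramp T` is increasing. -/
lemma ramp_le_mul_rampSlope {T s : ℝ} (hT : 0 < T) (hs : -T ≤ s) :
    ramp T s ≤ (s + T) * rampSlope T s := by
  have := intervalIntegral.integral_mono_on (μ := volume) hs
    ((contDiff_rampSlope T).continuous.intervalIntegrable (-T) s)
    (intervalIntegrable_const (c := rampSlope T s)) fun u hu => monotone_rampSlope hT hu.2
  rw [intervalIntegral.integral_const, smul_eq_mul, sub_neg_eq_add] at this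
  exact this

lemma ramp_sub_ramp_neg {T : ℝ} (hT : 0 < T) (s : ℝ) : ramp T s - ramp T (-s) = s := by
  have hd : ∀ s, HasDerivAt (fun s => ramp T s - ramp T (-s) - s) 0 s := fun s => by
    have h2 := (hasDerivAt_ramp T (-s)).comp s (hasDerivAt_neg s)
    have h3 := ((hasDerivAt_ramp T s).sub h2).sub (hasDerivAt_id s)
    have e : rampSlope T s - rampSlope T (-s) * -1 - 1 = 0 := by
      linarith [rampSlope_add_rampSlope_neg hT s]
    rw [e] at h3
    exact h3
  have := is_const_of_deriv_eq_zero (fun s => (hd s).differentiableAt) (fun s => (hd s).deriv) s 0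
  simp only [neg_zero, sub_self] at this
  linarith

lemma ramp_sq_le {T s : ℝ} (hT : 0 < T) : ramp T s ^ 2 ≤ (s + T) ^ 2 * rampSlope T s := by
  rcases le_total s (-T) with hs | hs
  · rw [ramp_eq_zero hT hs]
    have := mul_nonneg (sq_nonneg (s + T)) (rampSlope_nonneg T s)
    simpa using this
  · have h1 := ramp_le_mul_rampSlope hT hs
    have h2 : ramp T s ^ 2 ≤ ((s + T) * rampSlope T s) ^ 2 :=
      pow_le_pow_left₀ (ramp_nonneg hT s) h1 2
    have h3 : rampSlope T s ^ 2 ≤ rampSlope T s := by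
      rw [sq]; exact mul_le_of_le_one_left (rampSlope_nonneg T s) (rampSlope_le_one T s)
    calc ramp T s ^ 2 ≤ ((s + T) * rampSlope T s) ^ 2 := h2
      _ = (s + T) ^ 2 * rampSlope T s ^ 2 := by ring
      _ ≤ _ := by gcongr

variable {E : Type*} [NormedAddCommGroup E] [NormedSpace ℝ E]

/-- Composing with `ramp T` a function `F` that increases strictly along `w` where `F ≥ -T` gives a
function whose size and gradient are controlled by its derivative along `w`: the degeneracy takes
place in the factor `rampSlope T (F x)` only. -/
lemma exists_ramp_bound {F : E → ℝ} (hF : ContDiff ℝ ∞ F) {w : E → E} (hw : Continuous w) {T : ℝ}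
    (hT : 0 < T) {X : Set E} (hX : IsCompact X)
    (hpos : ∀ x ∈ X, -T ≤ F x → 0 < fderiv ℝ F x (w x)) :
    ∃ A : ℝ, 0 < A ∧ ∀ x ∈ X, 0 ≤ rampSlope T (F x) * fderiv ℝ F x (w x) ∧
      rampSlope T (F x) * ‖fderiv ℝ F x‖ ≤ A * (rampSlope T (F x) * fderiv ℝ F x (w x)) ∧
      ramp T (F x) ^ 2 ≤ A * (rampSlope T (F x) * fderiv ℝ F x (w x)) := by
  have hDc : Continuous (fderiv ℝ F) := hF.continuous_fderiv (by simp)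
  have hY : IsCompact (X ∩ {x | -T ≤ F x}) :=
    hX.inter_right (isClosed_le continuous_const hF.continuous)
  obtain ⟨a, ha, hlow⟩ : ∃ a > 0, ∀ x ∈ X ∩ {x | -T ≤ F x}, a ≤ fderiv ℝ F x (w x) := by
    rcases (X ∩ {x | -T ≤ F x}).eq_empty_or_nonempty with hemp | hne
    · exact ⟨1, one_pos, by simp [hemp]⟩
    · obtain ⟨x₀, hx₀, hmin⟩ := hY.exists_isMinOn hne (hDc.clm_apply hw).continuousOn
      exact ⟨_, hpos x₀ hx₀.1 hx₀.2, fun x hx => hmin hx⟩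
  obtain ⟨B, hB⟩ := hX.exists_bound_of_continuousOn (f := fun x => ‖fderiv ℝ F x‖ + (F x + T) ^ 2)
    (hDc.norm.add ((hF.continuous.add continuous_const).pow 2)).continuousOn
  refine ⟨(|B| + 1) / a, by positivity, fun x hx => ?_⟩
  rcases lt_or_ge (F x) (-T) with h1 | h1
  · rw [rampSlope_eq_zero hT h1.le, ramp_eq_zero hT h1.le]
    simp
  · have h2 := hlow x ⟨hx, h1⟩
    have hσ := rampSlope_nonneg T (F x)
    have h3 : ‖fderiv ℝ F x‖ + (F x + T) ^ 2 ≤ |B| + 1 := by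
      have := (le_abs_self _).trans (hB x hx)
      linarith [le_abs_self B]
    have h4 : |B| + 1 ≤ (|B| + 1) / a * fderiv ℝ F x (w x) := by
      rw [div_mul_eq_mul_div, le_div_iff₀ ha]
      exact mul_le_mul_of_nonneg_left h2 (by positivity)
    have h5 : rampSlope T (F x) * (|B| + 1) ≤
        (|B| + 1) / a * (rampSlope T (F x) * fderiv ℝ F x (w x)) := by
      calc _ ≤ rampSlope T (F x) * ((|B| + 1) / a * fderiv ℝ F x (w x)) := by gcongr
        _ = _ := by ring
    refine ⟨mul_nonneg hσ (ha.le.trans h2), le_trans ?_ h5, le_trans ?_ h5⟩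
    · gcongr
      linarith [sq_nonneg (F x + T)]
    · refine (ramp_sq_le hT).trans ?_
      rw [mul_comm]
      gcongr
      linarith [norm_nonneg (fderiv ℝ F x)]

end Ramp

section Lyapunov

variable {E : Type*} [NormedAddCommGroup E] [NormedSpace ℝ E] [FiniteDimensional ℝ E]
  [MeasurableSpace E] [BorelSpace E]

/-- The modified escape function is `ramp T F₁ - ramp T (-F₂)` for the pair of Lyapunov functions
`F₁`, `F₂`. It is `G` where both are `G`, and `0` where `F₁ ≤ -T` and `F₂ ≥ T`. -/
theorem IsEscapeSystem.exists_modification {w : E → E} {Φ : ℝ → E → E} {Sg : Set E} {ψ G : E → ℝ}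
    {K₁ : Set E} {c C M : ℝ} (h : IsEscapeSystem w Φ Sg ψ G K₁ c C M)
    {K U : Set E} (hKc : IsClosed K) (hK : K ⊆ interior K₁) (hU : IsOpen U)
    (hKU : Sg \ (escapeSet Φ G M K ∪ escapeSet (fun t => Φ (-t)) (fun x => -G x) M K) ⊆ U) :
    ∃ (Gt : E → ℝ) (b : ℝ), ContDiff ℝ ∞ Gt ∧ (∀ x, b < ψ x → Gt x = G x) ∧
      (∀ᶠ x in 𝓝ˢ (Sg \
        (escapeSet Φ G M K ∪ escapeSet (fun t => Φ (-t)) (fun x => -G x) M K)), Gt x = 0) ∧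
      (∀ x ∈ Sg \ U, 0 < fderiv ℝ Gt x (w x)) ∧
      ∀ X : Set E, IsCompact X → ∃ A : ℝ, 0 < A ∧ ∀ x ∈ Sg ∩ X,
        ‖fderiv ℝ Gt x‖ ≤ A * fderiv ℝ Gt x (w x) ∧ Gt x ^ 2 ≤ A * fderiv ℝ Gt x (w x) := by
  obtain ⟨T, b, F₁, F₂, hT, s₁, s₂, far, near, der₁, der₂, cov⟩ :=
    h.exists_lyapunov_pair hKc hK hU hKU
  set N : E → ℝ := fun x => -F₂ x with hN
  have sN : ContDiff ℝ ∞ N := s₂.neg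
  have hNd : ∀ x v, fderiv ℝ N x v = -fderiv ℝ F₂ x v := fun x v => by
    have : fderiv ℝ N x = -fderiv ℝ F₂ x := fderiv_fun_neg
    rw [this]; rfl
  have derN : ∀ x ∈ Sg, -T ≤ N x → 0 < fderiv ℝ N x (-w x) := fun x hx hle => by
    rw [hNd, map_neg, neg_neg]
    exact der₂ x hx (by simp only [hN] at hle; linarith)
  set Gt : E → ℝ := fun x => ramp T (F₁ x) - ramp T (N x) with hGt
  have hGts : ContDiff ℝ ∞ Gt := ((contDiff_ramp T).comp s₁).sub ((contDiff_ramp T).comp sN)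
  have hDG : ∀ x, fderiv ℝ Gt x =
      rampSlope T (F₁ x) • fderiv ℝ F₁ x - rampSlope T (N x) • fderiv ℝ N x := fun x =>
    (((hasDerivAt_ramp T (F₁ x)).comp_hasFDerivAt x
      (s₁.differentiable (by simp) x).hasFDerivAt).sub
      ((hasDerivAt_ramp T (N x)).comp_hasFDerivAt x
        (sN.differentiable (by simp) x).hasFDerivAt)).fderiv
  have hDGw : ∀ x, fderiv ℝ Gt x (w x) = rampSlope T (F₁ x) * fderiv ℝ F₁ x (w x) +
      rampSlope T (N x) * fderiv ℝ N x (-w x) := fun x => by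
    rw [hDG, map_neg]
    simp only [sub_apply, smul_apply, smul_eq_mul]
    ring
  refine ⟨Gt, b, hGts, fun x hx => ?_, ?_, fun x hx => ?_, fun X hX => ?_⟩
  · simp only [hGt, hN, (far x hx).1, (far x hx).2]
    exact ramp_sub_ramp_neg hT (G x)
  · have hopen : IsOpen {x | F₁ x < -T ∧ T < F₂ x} :=
      (isOpen_lt s₁.continuous continuous_const).inter (isOpen_lt continuous_const s₂.continuous)
    filter_upwards [hopen.mem_nhdsSet.2 near] with x hx
    simp only [hGt, hN]
    rw [ramp_eq_zero hT hx.1.le, ramp_eq_zero hT (by linarith [hx.2]), sub_zero]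
  · rw [hDGw]
    have n₁ : 0 ≤ rampSlope T (F₁ x) * fderiv ℝ F₁ x (w x) := by
      rcases lt_or_ge (F₁ x) (-T) with hlt | hge
      · simp [rampSlope_eq_zero hT hlt.le]
      · exact mul_nonneg (rampSlope_nonneg _ _) (der₁ x hx.1 hge).le
    have n₂ : 0 ≤ rampSlope T (N x) * fderiv ℝ N x (-w x) := by
      rcases lt_or_ge (N x) (-T) with hlt | hge
      · simp [rampSlope_eq_zero hT hlt.le]
      · exact mul_nonneg (rampSlope_nonneg _ _) (derN x hx.1 hge).le
    rcases cov x hx with hlt | hlt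
    · have := mul_pos (rampSlope_pos hT hlt) (der₁ x hx.1 hlt.le)
      linarith
    · have hlt' : -T < N x := by simp only [hN]; linarith
      have := mul_pos (rampSlope_pos hT hlt') (derN x hx.1 hlt'.le)
      linarith
  · have hXS : IsCompact (Sg ∩ X) := hX.inter_left h.isClosed
    obtain ⟨A₁, hA₁, H₁⟩ := exists_ramp_bound s₁ h.continuous hT hXS fun x hx => der₁ x hx.1
    obtain ⟨A₂, hA₂, H₂⟩ := exists_ramp_bound (w := fun x => -w x) sN h.continuous.neg hT hXS
      fun x hx => derN x hx.1
    refine ⟨2 * (A₁ + A₂), by positivity, fun x hx => ?_⟩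
    obtain ⟨p₁, q₁, r₁⟩ := H₁ x hx
    obtain ⟨p₂, q₂, r₂⟩ := H₂ x hx
    rw [hDGw]
    have m₁ := mul_nonneg hA₁.le p₂
    have m₂ := mul_nonneg hA₂.le p₁
    have m₃ := mul_nonneg hA₁.le p₁
    have m₄ := mul_nonneg hA₂.le p₂
    constructor
    · have hn : ‖fderiv ℝ Gt x‖ ≤ rampSlope T (F₁ x) * ‖fderiv ℝ F₁ x‖ +
          rampSlope T (N x) * ‖fderiv ℝ N x‖ := by
        rw [hDG]
        refine (norm_sub_le _ _).trans_eq ?_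
        rw [norm_smul, norm_smul, Real.norm_of_nonneg (rampSlope_nonneg _ _),
          Real.norm_of_nonneg (rampSlope_nonneg _ _)]
      linarith
    · have hn : Gt x ^ 2 ≤ 2 * ramp T (F₁ x) ^ 2 + 2 * ramp T (N x) ^ 2 := by
        simp only [hGt]
        nlinarith [sq_nonneg (ramp T (F₁ x) + ramp T (N x))]
      linarith

end Lyapunov

/-! ### Symbol calculus -/

section Symbols

variable {n : ℕ} {r R : Config n → ℝ} {F : Type*} [NormedAddCommGroup F] [NormedSpace ℝ F]

lemma IsScalePair.r_pos (h : IsScalePair r R) (x : Config n) : 0 < r x :=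
  one_pos.trans_le (h.one_le_r x)

lemma r_le_rTilde (r : Config n → ℝ) (ρ : Phase n) : r ρ.1 ≤ rTilde r ρ :=
  Real.le_sqrt_of_sq_le (by nlinarith [sq_nonneg ‖ρ.2‖])

lemma norm_le_rTilde (r : Config n → ℝ) (ρ : Phase n) : ‖ρ.2‖ ≤ rTilde r ρ :=
  Real.le_sqrt_of_sq_le (by nlinarith [sq_nonneg (r ρ.1)])

lemma IsScalePair.rTilde_le (h : IsScalePair r R) (ρ : Phase n) : rTilde r ρ ≤ r ρ.1 + ‖ρ.2‖ := by
  have := h.r_pos ρ.1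
  refine Real.sqrt_le_iff.2 ⟨by positivity, ?_⟩
  nlinarith [norm_nonneg ρ.2]

lemma IsScalePair.rTilde_pos (h : IsScalePair r R) (ρ : Phase n) : 0 < rTilde r ρ :=
  (h.r_pos ρ.1).trans_le (r_le_rTilde r ρ)

lemma IsScalePair.one_le_rTilde (h : IsScalePair r R) (ρ : Phase n) : 1 ≤ rTilde r ρ :=
  (h.one_le_r ρ.1).trans (r_le_rTilde r ρ)

lemma IsScalePair.one_le_rTilde_mul (h : IsScalePair r R) (ρ : Phase n) :
    1 ≤ rTilde r ρ * R ρ.1 :=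
  (h.one_le_rR ρ.1).trans (mul_le_mul_of_nonneg_right (r_le_rTilde r ρ) (h.R_pos _).le)

lemma IsScalePair.coordScale_pos (h : IsScalePair r R) (ρ : Phase n) (i : Fin n ⊕ Fin n) :
    0 < coordScale r R ρ i := by
  cases i with
  | inl i => exact h.R_pos _
  | inr i => exact h.rTilde_pos _

/-- The linear map `(y, η) ↦ (R y, r̃ η)`, which carries the unit ball to that of `g(ρ)`, up to a
constant factor. After composition with it symbol estimates are bounds on derivatives in the usual
norm, to which the formulas of Leibniz and Faà di Bruno apply. -/
def scaleMap (r R : Config n → ℝ) (ρ : Phase n) : Phase n →L[ℝ] Phase n :=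
  (R ρ.1 • ContinuousLinearMap.fst ℝ (Config n) (Config n)).prod
    (rTilde r ρ • ContinuousLinearMap.snd ℝ (Config n) (Config n))

lemma scaleMap_apply (ρ v : Phase n) : scaleMap r R ρ v = (R ρ.1 • v.1, rTilde r ρ • v.2) := rfl

lemma scaleMap_coordVec (ρ : Phase n) (i : Fin n ⊕ Fin n) :
    scaleMap r R ρ (coordVec i) = coordScale r R ρ i • coordVec i := by
  cases i <;> simp [scaleMap_apply, coordVec, coordScale]

lemma IsScalePair.exists_scaleMap_eq (h : IsScalePair r R) (ρ v : Phase n) :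
    ∃ u, scaleMap r R ρ u = v ∧ ‖u‖ ≤ gNorm r R ρ v := by
  have hR := h.R_pos ρ.1
  have hr := h.rTilde_pos ρ
  refine ⟨((R ρ.1)⁻¹ • v.1, (rTilde r ρ)⁻¹ • v.2), ?_, ?_⟩
  · simp [scaleMap_apply, smul_smul, hR.ne', hr.ne']
  · rw [Prod.norm_def, norm_smul, norm_smul, norm_inv, norm_inv, Real.norm_of_nonneg hR.le,
      Real.norm_of_nonneg hr.le, inv_mul_eq_div, inv_mul_eq_div]
    exact max_le (Real.le_sqrt_of_sq_le (by nlinarith [sq_nonneg (‖v.2‖ / rTilde r ρ)]))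
      (Real.le_sqrt_of_sq_le (by nlinarith [sq_nonneg (‖v.1‖ / R ρ.1)]))

lemma norm_coordVec_le (i : Fin n ⊕ Fin n) : ‖(coordVec i : Phase n)‖ ≤ 1 := by
  cases i <;> simp [coordVec, Prod.norm_def]

/-- The coordinates of a point of phase space. -/
def phaseCoord (v : Phase n) : Fin n ⊕ Fin n → ℝ
  | Sum.inl i => v.1 i
  | Sum.inr i => v.2 i

lemma sum_phaseCoord_smul (v : Phase n) : ∑ i, phaseCoord v i • coordVec i = v := by
  rw [Fintype.sum_sum_type]
  have key : ∀ x : Config n, ∑ i, x i • EuclideanSpace.single i (1 : ℝ) = x := fun x => by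
    ext j
    simp [Finset.sum_apply, Pi.single_apply]
  refine Prod.ext ?_ ?_
  · simp [phaseCoord, coordVec, Prod.fst_sum, key]
  · simp [phaseCoord, coordVec, Prod.snd_sum, key]

lemma abs_phaseCoord_le (v : Phase n) (i : Fin n ⊕ Fin n) : |phaseCoord v i| ≤ ‖v‖ := by
  cases i with
  | inl i => exact (PiLp.norm_apply_le v.1 i).trans (norm_fst_le v)
  | inr i => exact (PiLp.norm_apply_le v.2 i).trans (norm_snd_le v)

/-- The norm of a multilinear map is bounded by the sum of its coefficients. -/
lemma norm_multilinear_le_sum {k : ℕ} (N : ContinuousMultilinearMap ℝ (fun _ : Fin k => Phase n) F) :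
    ‖N‖ ≤ ∑ I : Fin k → Fin n ⊕ Fin n, ‖N fun j => coordVec (I j)‖ := by
  refine ContinuousMultilinearMap.opNorm_le_bound (Finset.sum_nonneg fun _ _ => norm_nonneg _)
    fun v => ?_
  have e : N v = ∑ I : Fin k → Fin n ⊕ Fin n,
      (∏ j, phaseCoord (v j) (I j)) • N fun j => coordVec (I j) := by
    conv_lhs => rw [show v = fun j => ∑ i, phaseCoord (v j) i • coordVec i from
      funext fun j => (sum_phaseCoord_smul (v j)).symm]
    rw [N.map_sum]
    exact Finset.sum_congr rfl fun I _ => N.map_smul_univ _ _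
  rw [e, Finset.sum_mul]
  refine (norm_sum_le _ _).trans (Finset.sum_le_sum fun I _ => ?_)
  rw [norm_smul, mul_comm, norm_prod]
  gcongr with j
  exact abs_phaseCoord_le _ _

/-- The norm of the `k`-th derivative of `a` at `ρ`, measured in the scaled coordinates. -/
def jetNorm (r R : Config n → ℝ) (k : ℕ) (a : Phase n → F) (ρ : Phase n) : ℝ :=
  ‖(iteratedFDeriv ℝ k a ρ).compContinuousLinearMap fun _ => scaleMap r R ρ‖

lemma jetNorm_nonneg (r R : Config n → ℝ) (k : ℕ) (a : Phase n → F) (ρ : Phase n) :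
    0 ≤ jetNorm r R k a ρ := norm_nonneg _

lemma symbolClass_iff (h : IsScalePair r R) {w : Phase n → ℝ} {a : Phase n → F} :
    SymbolClass r R w a ↔
      ContDiff ℝ ∞ a ∧ ∀ k, ∃ C : ℝ, ∀ ρ, jetNorm r R k a ρ ≤ C * w ρ := by
  refine and_congr_right fun _ => forall_congr' fun k => ?_
  have hcoef : ∀ ρ (I : Fin k → Fin n ⊕ Fin n),
      ‖((iteratedFDeriv ℝ k a ρ).compContinuousLinearMap fun _ => scaleMap r R ρ)
        fun j => coordVec (I j)‖ =
      (∏ j, coordScale r R ρ (I j)) * ‖iteratedFDeriv ℝ k a ρ fun j => coordVec (I j)‖ := by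
    intro ρ I
    rw [ContinuousMultilinearMap.compContinuousLinearMap_apply]
    simp only [scaleMap_coordVec]
    rw [ContinuousMultilinearMap.map_smul_univ, norm_smul, Real.norm_of_nonneg
      (Finset.prod_nonneg fun j _ => (h.coordScale_pos ρ _).le)]
  constructor
  · intro H
    choose C hC using H
    refine ⟨∑ I, C I, fun ρ => (norm_multilinear_le_sum _).trans ?_⟩
    rw [Finset.sum_mul]
    refine Finset.sum_le_sum fun I _ => ?_
    rw [hcoef]
    have hpos : 0 < ∏ j, coordScale r R ρ (I j) :=
      Finset.prod_pos fun j _ => h.coordScale_pos ρ _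
    have := mul_le_mul_of_nonneg_left (hC I ρ) hpos.le
    rwa [Finset.prod_inv_distrib, mul_comm (C I * w ρ), mul_inv_cancel_left₀ hpos.ne'] at this
  · rintro ⟨C, hC⟩ I
    refine ⟨C, fun ρ => ?_⟩
    have hpos : 0 < ∏ j, coordScale r R ρ (I j) :=
      Finset.prod_pos fun j _ => h.coordScale_pos ρ _
    rw [Finset.prod_inv_distrib, ← div_eq_mul_inv, le_div_iff₀ hpos, mul_comm, ← hcoef]
    refine (ContinuousMultilinearMap.le_opNorm _ _).trans ((mul_le_of_le_one_right
      (norm_nonneg _) ?_).trans (hC ρ))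
    exact Finset.prod_le_one (fun _ _ => norm_nonneg _) fun j _ => norm_coordVec_le _

/-- `jetNorm` is the usual norm of the derivative of the rescaled function. -/
lemma jetNorm_eq {a : Phase n → F} (ha : ContDiff ℝ ∞ a) (k : ℕ) {ρ u : Phase n}
    (hu : scaleMap r R ρ u = ρ) :
    jetNorm r R k a ρ = ‖iteratedFDeriv ℝ k (a ∘ scaleMap r R ρ) u‖ := by
  rw [ContinuousLinearMap.iteratedFDeriv_comp_right _ ha _ (mod_cast le_top), hu]
  rfl

lemma SymbolClass.mono (h : IsScalePair r R) {w w' : Phase n → ℝ} {a : Phase n → F}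
    (ha : SymbolClass r R w a) {D : ℝ} (hw : ∀ ρ, 0 ≤ w ρ) (hww' : ∀ ρ, w ρ ≤ D * w' ρ) :
    SymbolClass r R w' a := by
  rw [symbolClass_iff h] at ha ⊢
  refine ⟨ha.1, fun k => ?_⟩
  obtain ⟨C, hC⟩ := ha.2 k
  refine ⟨|C| * D, fun ρ => (hC ρ).trans ?_⟩
  calc C * w ρ ≤ |C| * w ρ := mul_le_mul_of_nonneg_right (le_abs_self C) (hw ρ)
    _ ≤ |C| * (D * w' ρ) := mul_le_mul_of_nonneg_left (hww' ρ) (abs_nonneg C)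
    _ = _ := by ring

lemma SymbolClass.mul (h : IsScalePair r R) {w₁ w₂ : Phase n → ℝ} {a b : Phase n → ℝ}
    (ha : SymbolClass r R w₁ a) (hb : SymbolClass r R w₂ b) :
    SymbolClass r R (fun ρ => w₁ ρ * w₂ ρ) (fun ρ => a ρ * b ρ) := by
  rw [symbolClass_iff h] at ha hb ⊢
  refine ⟨ha.1.mul hb.1, fun k => ?_⟩
  choose A hA using ha.2
  choose B hB using hb.2
  refine ⟨∑ i ∈ Finset.range (k + 1), (k.choose i : ℝ) * (A i * B (k - i)), fun ρ => ?_⟩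
  obtain ⟨u, hu, -⟩ := h.exists_scaleMap_eq ρ ρ
  rw [jetNorm_eq (ha.1.mul hb.1) k hu]
  have hL : ContDiff ℝ ∞ (scaleMap r R ρ) := ContinuousLinearMap.contDiff _
  have := norm_iteratedFDeriv_mul_le (ha.1.comp hL) (hb.1.comp hL) u (n := k) (mod_cast le_top)
  refine this.trans ?_
  rw [Finset.sum_mul]
  refine Finset.sum_le_sum fun i _ => ?_
  rw [← jetNorm_eq ha.1 i hu, ← jetNorm_eq hb.1 (k - i) hu, mul_assoc, mul_assoc]
  refine mul_le_mul_of_nonneg_left ?_ (Nat.cast_nonneg _)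
  calc jetNorm r R i a ρ * jetNorm r R (k - i) b ρ
      ≤ (A i * w₁ ρ) * (B (k - i) * w₂ ρ) :=
        mul_le_mul (hA i ρ) (hB (k - i) ρ) (jetNorm_nonneg _ _ _ _ _)
          ((jetNorm_nonneg _ _ _ _ _).trans (hA i ρ))
    _ = _ := by ring

lemma SymbolClass.add (h : IsScalePair r R) {w : Phase n → ℝ} {a b : Phase n → F}
    (ha : SymbolClass r R w a) (hb : SymbolClass r R w b) :
    SymbolClass r R w (fun ρ => a ρ + b ρ) := by
  rw [symbolClass_iff h] at ha hb ⊢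
  refine ⟨ha.1.add hb.1, fun k => ?_⟩
  obtain ⟨A, hA⟩ := ha.2 k
  obtain ⟨B, hB⟩ := hb.2 k
  refine ⟨A + B, fun ρ => ?_⟩
  have e : iteratedFDeriv ℝ k (fun ρ => a ρ + b ρ) ρ =
      iteratedFDeriv ℝ k a ρ + iteratedFDeriv ℝ k b ρ :=
    iteratedFDeriv_add_apply (ha.1.contDiffAt.of_le (mod_cast le_top))
      (hb.1.contDiffAt.of_le (mod_cast le_top))
  have : jetNorm r R k (fun ρ => a ρ + b ρ) ρ ≤ jetNorm r R k a ρ + jetNorm r R k b ρ := by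
    unfold jetNorm
    rw [e]
    exact norm_add_le ((iteratedFDeriv ℝ k a ρ).compContinuousLinearMap fun _ => scaleMap r R ρ)
      ((iteratedFDeriv ℝ k b ρ).compContinuousLinearMap fun _ => scaleMap r R ρ)
  linarith [hA ρ, hB ρ]

lemma SymbolClass.clm_comp (h : IsScalePair r R) {F' : Type*} [NormedAddCommGroup F']
    [NormedSpace ℝ F'] {w : Phase n → ℝ} {a : Phase n → F}
    (ha : SymbolClass r R w a) (T : F →L[ℝ] F') : SymbolClass r R w (fun ρ => T (a ρ)) := by
  rw [symbolClass_iff h] at ha ⊢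
  have hTa : ContDiff ℝ ∞ (fun ρ => T (a ρ)) := T.contDiff.comp ha.1
  refine ⟨hTa, fun k => ?_⟩
  obtain ⟨A, hA⟩ := ha.2 k
  refine ⟨‖T‖ * A, fun ρ => ?_⟩
  obtain ⟨u, hu, -⟩ := h.exists_scaleMap_eq ρ ρ
  rw [jetNorm_eq hTa k hu]
  have hL : ContDiff ℝ ∞ (scaleMap r R ρ) := ContinuousLinearMap.contDiff _
  have := T.norm_iteratedFDeriv_comp_left (n := k) (ha.1.comp hL).contDiffAt (x := u)
    (mod_cast le_top)
  rw [← jetNorm_eq ha.1 k hu] at this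
  refine this.trans ?_
  rw [mul_assoc]
  exact mul_le_mul_of_nonneg_left (hA ρ) (norm_nonneg _)

lemma SymbolClass.neg (h : IsScalePair r R) {w : Phase n → ℝ} {a : Phase n → ℝ}
    (ha : SymbolClass r R w a) : SymbolClass r R w (fun ρ => -a ρ) := by
  simpa using ha.clm_comp h (-ContinuousLinearMap.id ℝ ℝ)

lemma symbolClass_const (h : IsScalePair r R) (c : F) :
    SymbolClass r R (fun _ => 1) (fun _ : Phase n => c) := by
  rw [symbolClass_iff h]
  refine ⟨contDiff_const, fun k => ⟨‖c‖, fun ρ => ?_⟩⟩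
  obtain ⟨u, hu, -⟩ := h.exists_scaleMap_eq ρ ρ
  rw [jetNorm_eq contDiff_const k hu]
  cases k with
  | zero => simp
  | succ k =>
    rw [show ((fun _ : Phase n => c) ∘ scaleMap r R ρ) = fun _ => c from rfl,
      iteratedFDeriv_succ_const]
    simp

lemma SymbolClass.sum (h : IsScalePair r R) {ι : Type*} {w : Phase n → ℝ} (hw : ∀ ρ, 0 ≤ w ρ)
    {a : ι → Phase n → ℝ} {s : Finset ι} (ha : ∀ i ∈ s, SymbolClass r R w (a i)) :
    SymbolClass r R w (fun ρ => ∑ i ∈ s, a i ρ) := by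
  classical
  induction s using Finset.induction_on with
  | empty =>
    rw [symbolClass_iff h]
    refine ⟨by simpa using contDiff_const, fun k => ⟨1, fun ρ => ?_⟩⟩
    have : jetNorm r R k (fun _ : Phase n => (0 : ℝ)) ρ = 0 := by
      unfold jetNorm
      rw [show iteratedFDeriv ℝ k (fun _ : Phase n => (0 : ℝ)) ρ = 0 by
        rw [iteratedFDeriv_fun_zero]; rfl]
      exact norm_zero
    simp only [Finset.sum_empty]
    rw [this, one_mul]
    exact hw ρ
  | insert i s hi ih =>
    simp only [Finset.sum_insert hi]
    exact (ha i (Finset.mem_insert_self i s)).add h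
      (ih fun j hj => ha j (Finset.mem_insert_of_mem hj))

/-- Differentiation in a coordinate direction divides the weight by the scale of the direction. -/
lemma SymbolClass.fderiv_coordVec {w : Phase n → ℝ} {a : Phase n → F}
    (ha : SymbolClass r R w a) (i : Fin n ⊕ Fin n) :
    SymbolClass r R (fun ρ => w ρ * (coordScale r R ρ i)⁻¹)
      (fun ρ => fderiv ℝ a ρ (coordVec i)) := by
  have hD : ContDiff ℝ ∞ (fderiv ℝ a) := ha.1.fderiv_right (by simp)
  refine ⟨hD.clm_apply contDiff_const, fun k I => ?_⟩
  obtain ⟨C, hC⟩ := ha.2 (k + 1) (Fin.snoc (α := fun _ => Fin n ⊕ Fin n) I i)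
  refine ⟨C, fun ρ => ?_⟩
  have := hC ρ
  rw [Fin.prod_univ_castSucc, iteratedFDeriv_succ_apply_right] at this
  rw [iteratedFDeriv_clm_apply_const_apply hD (mod_cast le_top)]
  simp only [Fin.snoc_castSucc, Fin.snoc_last] at this
  have e : (Fin.init fun j : Fin (k + 1) =>
      (coordVec (Fin.snoc (α := fun _ => Fin n ⊕ Fin n) I i j) : Phase n)) =
      fun j => coordVec (I j) := by
    funext j
    simp [Fin.init]
  rw [e] at this
  calc _ ≤ _ := this
    _ = _ := by ring

/-- A linear function of `ξ` is a symbol of weight `r̃`. -/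
lemma symbolClass_snd (h : IsScalePair r R) (i : Fin n) :
    SymbolClass r R (rTilde r) (fun ρ : Phase n => ρ.2 i) := by
  rw [symbolClass_iff h]
  set T : Phase n →L[ℝ] ℝ :=
    (EuclideanSpace.proj i : Config n →L[ℝ] ℝ).comp (ContinuousLinearMap.snd ℝ _ _) with hT
  have hTs : ContDiff ℝ ∞ T := T.contDiff
  refine ⟨hTs, fun k => ⟨1, fun ρ => ?_⟩⟩
  have hr := h.rTilde_pos ρ
  rw [one_mul]
  obtain ⟨u, hu, -⟩ := h.exists_scaleMap_eq ρ ρ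
  change jetNorm r R k T ρ ≤ _
  rw [jetNorm_eq hTs k hu]
  set T' : Phase n →L[ℝ] ℝ := T.comp (scaleMap r R ρ) with hT'
  have hcomp : (T ∘ scaleMap r R ρ : Phase n → ℝ) = T' := rfl
  rw [hcomp]
  rcases k with _ | _ | k
  · rw [norm_iteratedFDeriv_zero]
    have : T' u = ρ.2 i := by
      rw [hT', ContinuousLinearMap.comp_apply, hu]; rfl
    rw [this]
    exact (PiLp.norm_apply_le ρ.2 i).trans (norm_le_rTilde r ρ)
  · rw [zero_add, norm_iteratedFDeriv_one, ContinuousLinearMap.fderiv]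
    refine ContinuousLinearMap.opNorm_le_bound _ hr.le fun v => ?_
    have : T' v = rTilde r ρ * v.2 i := rfl
    rw [this, norm_mul, Real.norm_of_nonneg hr.le]
    gcongr
    exact (PiLp.norm_apply_le v.2 i).trans (norm_snd_le v)
  · rw [← norm_iteratedFDeriv_fderiv]
    have : fderiv ℝ T' = fun _ => T' := funext fun v => T'.fderiv
    rw [this, iteratedFDeriv_succ_const]
    simpa using hr.le

lemma SymbolClass.pow (h : IsScalePair r R) {w : Phase n → ℝ} {a : Phase n → ℝ}
    (ha : SymbolClass r R w a) (k : ℕ) :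
    SymbolClass r R (fun ρ => w ρ ^ k) (fun ρ => a ρ ^ k) := by
  induction k with
  | zero => simpa using symbolClass_const (r := r) (R := R) h (1 : ℝ)
  | succ k ih => simpa only [pow_succ] using ih.mul h ha

lemma SymbolClass.prod (h : IsScalePair r R) {ι : Type*} {w : ι → Phase n → ℝ}
    {a : ι → Phase n → ℝ} {s : Finset ι} (ha : ∀ i ∈ s, SymbolClass r R (w i) (a i)) :
    SymbolClass r R (fun ρ => ∏ i ∈ s, w i ρ) (fun ρ => ∏ i ∈ s, a i ρ) := by
  classical
  induction s using Finset.induction_on with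
  | empty => simpa using symbolClass_const (r := r) (R := R) h (1 : ℝ)
  | insert i s hi ih =>
    simp only [Finset.prod_insert hi]
    exact (ha i (Finset.mem_insert_self i s)).mul h
      (ih fun j hj => ha j (Finset.mem_insert_of_mem hj))

/-- The differential of a symbol, measured by `g`. -/
lemma SymbolClass.exists_abs_fderiv_le (h : IsScalePair r R) {w : Phase n → ℝ}
    {a : Phase n → ℝ} (ha : SymbolClass r R w a) (hw : ∀ ρ, 0 ≤ w ρ) :
    ∃ C : ℝ, 0 < C ∧ ∀ ρ v, |fderiv ℝ a ρ v| ≤ C * w ρ * gNorm r R ρ v := by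
  obtain ⟨C, hC⟩ := ((symbolClass_iff h).1 ha).2 1
  refine ⟨|C| + 1, by positivity, fun ρ v => ?_⟩
  obtain ⟨u, hu, hun⟩ := h.exists_scaleMap_eq ρ v
  have h1 := ((iteratedFDeriv ℝ 1 a ρ).compContinuousLinearMap
    fun _ => scaleMap r R ρ).le_opNorm (fun _ => u)
  rw [ContinuousMultilinearMap.compContinuousLinearMap_apply, iteratedFDeriv_one_apply, hu] at h1
  simp only [Finset.prod_const, Finset.card_univ, Fintype.card_fin, pow_one] at h1
  refine h1.trans (mul_le_mul ?_ hun (norm_nonneg _) (mul_nonneg (by positivity) (hw ρ)))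
  refine (hC ρ).trans (mul_le_mul_of_nonneg_right ?_ (hw ρ))
  linarith [le_abs_self C]

/-- A symbol remains one if it is modified smoothly in a bounded set. -/
lemma SymbolClass.congr_off_bounded (h : IsScalePair r R) {w : Phase n → ℝ} {a b : Phase n → ℝ}
    (ha : SymbolClass r R w a) (hwc : Continuous w) (hw : ∀ ρ, 0 < w ρ) (hb : ContDiff ℝ ∞ b)
    {B : Set (Phase n)} (hB : Bornology.IsBounded B) (hab : ∀ ρ, ρ ∉ B → b ρ = a ρ)
    (hRc : Continuous R) (hrc : Continuous r) : SymbolClass r R w b := by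
  refine ⟨hb, fun k I => ?_⟩
  obtain ⟨C, hC⟩ := ha.2 k I
  have hcs : Continuous fun ρ : Phase n => ∏ j, (coordScale r R ρ (I j))⁻¹ := by
    refine continuous_finsetProd _ fun j _ => Continuous.inv₀ ?_ fun ρ => (h.coordScale_pos ρ _).ne'
    cases I j with
    | inl i => exact hRc.comp continuous_fst
    | inr i =>
      exact (((hrc.comp continuous_fst).pow 2).add (continuous_snd.norm.pow 2)).sqrt
  have hprod : ∀ ρ : Phase n, 0 < ∏ j, (coordScale r R ρ (I j))⁻¹ := fun ρ =>
    Finset.prod_pos fun j _ => inv_pos.2 (h.coordScale_pos ρ _)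
  obtain ⟨D, hD⟩ := hB.isCompact_closure.exists_bound_of_continuousOn
    (f := fun ρ => ‖iteratedFDeriv ℝ k b ρ fun j => coordVec (I j)‖ /
      (w ρ * ∏ j, (coordScale r R ρ (I j))⁻¹)) (by
        refine Continuous.continuousOn (Continuous.div ?_ (hwc.mul hcs) fun ρ =>
          (mul_pos (hw ρ) (hprod ρ)).ne')
        exact ((ContinuousMultilinearMap.apply ℝ (fun _ : Fin k => Phase n) ℝ
          (fun j => coordVec (I j))).continuous.comp
            (hb.continuous_iteratedFDeriv (mod_cast le_top))).norm)
  refine ⟨max C D, fun ρ => ?_⟩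
  have hpos := mul_pos (hw ρ) (hprod ρ)
  by_cases hρ : ρ ∈ closure B
  · have := (le_abs_self _).trans (hD ρ hρ)
    rw [div_le_iff₀ hpos] at this
    rw [mul_assoc]
    exact this.trans (mul_le_mul_of_nonneg_right (le_max_right _ _) hpos.le)
  · have e : b =ᶠ[𝓝 ρ] a := by
      filter_upwards [isClosed_closure.isOpen_compl.mem_nhds hρ] with ν hν
      exact hab ν fun hm => hν (subset_closure hm)
    rw [(Filter.EventuallyEq.iteratedFDeriv ℝ e k).eq_of_nhds]
    refine (hC ρ).trans ?_
    rw [mul_assoc, mul_assoc]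
    exact mul_le_mul_of_nonneg_right (le_max_left _ _) hpos.le

/-- If the support of `χ` lies in `]-ε, ε[` and the weight of `p` is bounded where `|p| ≤ ε`, then
`χ(p)` is a symbol of weight `1`. -/
lemma SymbolClass.comp_cutoff (h : IsScalePair r R) {w : Phase n → ℝ} {p : Phase n → ℝ}
    (hp : SymbolClass r R w p) {χ : ℝ → ℝ} (hχ : ContDiff ℝ ∞ χ) {ε : ℝ}
    (hsupp : tsupport χ ⊆ Ioo (-ε) ε) {D : ℝ} (hD : ∀ ρ, |p ρ| ≤ ε → w ρ ≤ D)
    (hw : ∀ ρ, 0 ≤ w ρ) : SymbolClass r R (fun _ => 1) (fun ρ => χ (p ρ)) := by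
  rw [symbolClass_iff h] at hp ⊢
  have hχp : ContDiff ℝ ∞ (fun ρ => χ (p ρ)) := hχ.comp hp.1
  refine ⟨hχp, fun k => ?_⟩
  choose A hA using hp.2
  have hcomp : HasCompactSupport χ :=
    isCompact_Icc.of_isClosed_subset (isClosed_tsupport χ) (hsupp.trans Ioo_subset_Icc_self)
  have hbd : ∀ i : ℕ, ∃ B, ∀ s, ‖iteratedFDeriv ℝ i χ s‖ ≤ B := fun i =>
    (hχ.continuous_iteratedFDeriv (mod_cast le_top)).bounded_above_of_compact_support
      (hcomp.iteratedFDeriv i)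
  choose B hB using hbd
  set b : ℝ := ∑ i ∈ Finset.range (k + 1), |B i| with hb
  set d : ℝ := 1 + ∑ i ∈ Finset.range (k + 1), |A i| * |D| with hd
  have hd1 : 1 ≤ d := by
    have : 0 ≤ ∑ i ∈ Finset.range (k + 1), |A i| * |D| :=
      Finset.sum_nonneg fun i _ => by positivity
    linarith
  have hb0 : 0 ≤ b := Finset.sum_nonneg fun i _ => abs_nonneg _
  refine ⟨k.factorial * b * d ^ k, fun ρ => ?_⟩
  rw [mul_one]
  by_cases hρ : |p ρ| ≤ ε
  · obtain ⟨u, hu, -⟩ := h.exists_scaleMap_eq ρ ρ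
    rw [jetNorm_eq hχp k hu]
    have hL : ContDiff ℝ ∞ (scaleMap r R ρ) := ContinuousLinearMap.contDiff _
    refine norm_iteratedFDeriv_comp_le (g := χ) hχ (hp.1.comp hL) (mod_cast le_top) u
      (fun i hi => ?_) (fun i hi1 hi => ?_)
    · refine (hB i _).trans ((le_abs_self _).trans ?_)
      exact Finset.single_le_sum (f := fun i => |B i|) (fun i _ => abs_nonneg _)
        (Finset.mem_range.2 (Nat.lt_succ_of_le hi))
    · rw [← jetNorm_eq hp.1 i hu]
      refine le_trans ?_ (le_self_pow₀ hd1 (by omega))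
      have h1 : |A i| * |D| ≤ ∑ i ∈ Finset.range (k + 1), |A i| * |D| :=
        Finset.single_le_sum (f := fun i => |A i| * |D|) (fun i _ => by positivity)
          (Finset.mem_range.2 (Nat.lt_succ_of_le hi))
      have h2 : A i * w ρ ≤ |A i| * |D| :=
        mul_le_mul (le_abs_self _) ((hD ρ hρ).trans (le_abs_self D)) (hw ρ) (abs_nonneg _)
      linarith [hA i ρ]
  · have e : (fun ρ => χ (p ρ)) =ᶠ[𝓝 ρ] fun _ => 0 := by
      filter_upwards [continuousAt_const.eventually_lt hp.1.continuous.abs.continuousAt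
        (not_le.1 hρ)] with ν hν
      refine image_eq_zero_of_notMem_tsupport fun hm => ?_
      have := hsupp hm
      linarith [abs_lt.2 ⟨this.1, this.2⟩]
    have : jetNorm r R k (fun ρ => χ (p ρ)) ρ = 0 := by
      unfold jetNorm
      rw [(Filter.EventuallyEq.iteratedFDeriv ℝ e k).eq_of_nhds, iteratedFDeriv_fun_zero]
      exact norm_zero
    rw [this]
    positivity

end Symbols

/-! ### Hamilton fields -/

section HamiltonFields

variable {n : ℕ} {r R : Config n → ℝ} {a b : Phase n → ℝ}

lemma inner_hamField_fst {ρ : Phase n} (ha : DifferentiableAt ℝ a ρ) (v : Config n) :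
    inner ℝ (hamField a ρ).1 v = fderiv ℝ a ρ (0, v) := by
  have h : HasFDerivAt (fun η => a (ρ.1, η))
      ((fderiv ℝ a ρ).comp (ContinuousLinearMap.inr ℝ (Config n) (Config n))) ρ.2 :=
    HasFDerivAt.comp ρ.2 (g := a) (f := fun η => (ρ.1, η)) ha.hasFDerivAt
      (hasFDerivAt_prodMk_right ρ.1 ρ.2)
  change inner ℝ (gradient _ _) v = _
  rw [gradient, InnerProductSpace.toDual_symm_apply, h.fderiv]
  rfl

lemma inner_hamField_snd {ρ : Phase n} (ha : DifferentiableAt ℝ a ρ) (v : Config n) :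
    inner ℝ (hamField a ρ).2 v = -fderiv ℝ a ρ (v, 0) := by
  have h : HasFDerivAt (fun y => a (y, ρ.2))
      ((fderiv ℝ a ρ).comp (ContinuousLinearMap.inl ℝ (Config n) (Config n))) ρ.1 :=
    HasFDerivAt.comp ρ.1 (g := a) (f := fun y => (y, ρ.2)) ha.hasFDerivAt
      (hasFDerivAt_prodMk_left ρ.1 ρ.2)
  change inner ℝ (-gradient _ _) v = _
  rw [inner_neg_left, gradient, InnerProductSpace.toDual_symm_apply, h.fderiv]
  rfl

/-- The Hamilton field is the vector that represents the differential in the symplectic form. -/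
lemma hamField_eq_of_fderiv {ρ : Phase n} (ha : DifferentiableAt ℝ a ρ) {v : Phase n}
    (hv : ∀ u : Phase n, inner ℝ v.1 u.2 - inner ℝ v.2 u.1 = fderiv ℝ a ρ u) :
    hamField a ρ = v := by
  refine Prod.ext ?_ ?_
  · refine ext_inner_right ℝ fun u => ?_
    rw [inner_hamField_fst ha, ← hv]
    simp
  · refine ext_inner_right ℝ fun u => ?_
    rw [inner_hamField_snd ha, ← hv]
    simp

lemma fderiv_eq_inner_hamField {ρ : Phase n} (ha : DifferentiableAt ℝ a ρ) (u : Phase n) :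
    fderiv ℝ a ρ u = inner ℝ (hamField a ρ).1 u.2 - inner ℝ (hamField a ρ).2 u.1 := by
  rw [inner_hamField_fst ha, inner_hamField_snd ha, sub_neg_eq_add, ← map_add]
  simp

lemma hamDeriv_antisymm {ρ : Phase n} (ha : DifferentiableAt ℝ a ρ) (hb : DifferentiableAt ℝ b ρ) :
    hamDeriv a b ρ = -fderiv ℝ a ρ (hamField b ρ) := by
  rw [hamDeriv, fderiv_eq_inner_hamField hb, fderiv_eq_inner_hamField ha,
    real_inner_comm (hamField b ρ).1, real_inner_comm (hamField a ρ).1]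
  ring

lemma hamDeriv_self {ρ : Phase n} (ha : DifferentiableAt ℝ a ρ) : hamDeriv a a ρ = 0 := by
  have := hamDeriv_antisymm ha ha
  simp only [hamDeriv] at *
  linarith

/-- The derivative of `χ` contributes to the Hamilton field of `χ(p) Gt`, but not to its derivative
along `H_p`, since `H_p p = 0`. -/
lemma hamField_mul_comp {p Gt : Phase n → ℝ} {χ : ℝ → ℝ} {ρ : Phase n}
    (hp : DifferentiableAt ℝ p ρ) (hG : DifferentiableAt ℝ Gt ρ) (hχ : DifferentiableAt ℝ χ (p ρ)) :
    hamField (fun ν => χ (p ν) * Gt ν) ρ =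
      χ (p ρ) • hamField Gt ρ + (deriv χ (p ρ) * Gt ρ) • hamField p ρ ∧
    hamDeriv p (fun ν => χ (p ν) * Gt ν) ρ = χ (p ρ) * hamDeriv p Gt ρ := by
  have h1 : HasFDerivAt (fun ν => χ (p ν)) (deriv χ (p ρ) • fderiv ℝ p ρ) ρ :=
    hχ.hasDerivAt.comp_hasFDerivAt ρ hp.hasFDerivAt
  have h2 : HasFDerivAt (fun ν => χ (p ν) * Gt ν) _ ρ := h1.mul hG.hasFDerivAt
  constructor
  · refine hamField_eq_of_fderiv h2.differentiableAt fun u => ?_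
    have e : fderiv ℝ (fun ν => χ (p ν) * Gt ν) ρ = _ := h2.fderiv
    rw [e]
    simp only [Prod.fst_add, Prod.snd_add, Prod.smul_fst, Prod.smul_snd, inner_add_left,
      real_inner_smul_left, add_apply, smul_apply,
      smul_eq_mul, fderiv_eq_inner_hamField hG, fderiv_eq_inner_hamField hp]
    ring
  · have e : fderiv ℝ (fun ν => χ (p ν) * Gt ν) ρ = _ := h2.fderiv
    have h0 := hamDeriv_self hp
    rw [hamDeriv] at h0 ⊢
    rw [e]
    simp [h0, hamDeriv]

lemma gNorm_nonneg (r R : Config n → ℝ) (ρ v : Phase n) : 0 ≤ gNorm r R ρ v := Real.sqrt_nonneg _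

lemma IsScalePair.norm_fst_le (h : IsScalePair r R) (ρ v : Phase n) :
    ‖v.1‖ ≤ R ρ.1 * gNorm r R ρ v := by
  have hR := h.R_pos ρ.1
  rw [← div_le_iff₀' hR]
  exact Real.le_sqrt_of_sq_le (by nlinarith [sq_nonneg (‖v.2‖ / rTilde r ρ)])

lemma IsScalePair.norm_snd_le (h : IsScalePair r R) (ρ v : Phase n) :
    ‖v.2‖ ≤ rTilde r ρ * gNorm r R ρ v := by
  have hR := h.rTilde_pos ρ
  rw [← div_le_iff₀' hR]
  exact Real.le_sqrt_of_sq_le (by nlinarith [sq_nonneg (‖v.1‖ / R ρ.1)])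

lemma IsScalePair.gNorm_le_add (h : IsScalePair r R) (ρ v : Phase n) :
    gNorm r R ρ v ≤ ‖v.1‖ / R ρ.1 + ‖v.2‖ / rTilde r ρ := by
  have hR := h.R_pos ρ.1
  have hr := h.rTilde_pos ρ
  have h1 : 0 ≤ ‖v.1‖ / R ρ.1 := by positivity
  have h2 : 0 ≤ ‖v.2‖ / rTilde r ρ := by positivity
  exact Real.sqrt_le_iff.2 ⟨by positivity, by nlinarith⟩

lemma IsScalePair.gNorm_le_of (h : IsScalePair r R) {ρ v : Phase n} {s : ℝ}
    (h1 : ‖v.1‖ ≤ R ρ.1 * s) (h2 : ‖v.2‖ ≤ rTilde r ρ * s) : gNorm r R ρ v ≤ 2 * s := by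
  refine (h.gNorm_le_add ρ v).trans ?_
  rw [← div_le_iff₀' (h.R_pos _)] at h1
  rw [← div_le_iff₀' (h.rTilde_pos _)] at h2
  linarith

lemma gNorm_add_smul_le (h : IsScalePair r R) (ρ u v : Phase n) (s t : ℝ) :
    gNorm r R ρ (s • u + t • v) ≤ 2 * (|s| * gNorm r R ρ u + |t| * gNorm r R ρ v) := by
  refine h.gNorm_le_of ?_ ?_
  · rw [Prod.fst_add, Prod.smul_fst, Prod.smul_fst]
    refine (norm_add_le _ _).trans ?_
    rw [norm_smul, norm_smul, Real.norm_eq_abs, Real.norm_eq_abs]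
    nlinarith [mul_le_mul_of_nonneg_left (h.norm_fst_le ρ u) (abs_nonneg s),
      mul_le_mul_of_nonneg_left (h.norm_fst_le ρ v) (abs_nonneg t)]
  · rw [Prod.snd_add, Prod.smul_snd, Prod.smul_snd]
    refine (norm_add_le _ _).trans ?_
    rw [norm_smul, norm_smul, Real.norm_eq_abs, Real.norm_eq_abs]
    nlinarith [mul_le_mul_of_nonneg_left (h.norm_snd_le ρ u) (abs_nonneg s),
      mul_le_mul_of_nonneg_left (h.norm_snd_le ρ v) (abs_nonneg t)]

/-- Measured by `g`, the Hamilton field is smaller than the differential by the factor `r̃ R`, up to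
a constant: `∂_ξ a`, of size `B / r̃`, is the component in `x`, whose scale is `R`, and conversely. -/
lemma IsScalePair.gNorm_hamField_le (h : IsScalePair r R) {ρ : Phase n}
    (ha : DifferentiableAt ℝ a ρ) {B : ℝ} (hB : 0 ≤ B)
    (H : ∀ v, |fderiv ℝ a ρ v| ≤ B * gNorm r R ρ v) :
    gNorm r R ρ (hamField a ρ) ≤ 2 * (B / (rTilde r ρ * R ρ.1)) := by
  have hR := h.R_pos ρ.1
  have hr := h.rTilde_pos ρ
  refine h.gNorm_le_of ?_ ?_
  · rcases eq_or_ne (hamField a ρ).1 0 with h0 | h0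
    · rw [h0, norm_zero]
      positivity
    · have h0' := norm_pos_iff.2 h0
      have e := inner_hamField_fst ha (hamField a ρ).1
      rw [real_inner_self_eq_norm_sq] at e
      have h1 := H (0, (hamField a ρ).1)
      have h2 := h.gNorm_le_add ρ (0, (hamField a ρ).1)
      simp only [norm_zero, zero_div, zero_add] at h2
      have h3 : ‖(hamField a ρ).1‖ ^ 2 ≤ B * (‖(hamField a ρ).1‖ / rTilde r ρ) := by
        rw [e]
        exact (le_abs_self _).trans (h1.trans (mul_le_mul_of_nonneg_left h2 hB))
      have h4 : ‖(hamField a ρ).1‖ ≤ B / rTilde r ρ := by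
        refine le_of_mul_le_mul_left ?_ h0'
        calc _ = ‖(hamField a ρ).1‖ ^ 2 := by ring
          _ ≤ _ := h3
          _ = _ := by ring
      refine h4.trans (le_of_eq ?_)
      field_simp
  · rcases eq_or_ne (hamField a ρ).2 0 with h0 | h0
    · rw [h0, norm_zero]
      positivity
    · have h0' := norm_pos_iff.2 h0
      have e := inner_hamField_snd ha (hamField a ρ).2
      rw [real_inner_self_eq_norm_sq] at e
      have h1 := H ((hamField a ρ).2, 0)
      have h2 := h.gNorm_le_add ρ ((hamField a ρ).2, 0)
      simp only [norm_zero, zero_div, add_zero] at h2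
      have h3 : ‖(hamField a ρ).2‖ ^ 2 ≤ B * (‖(hamField a ρ).2‖ / R ρ.1) := by
        rw [e]
        exact (neg_le_abs _).trans (h1.trans (mul_le_mul_of_nonneg_left h2 hB))
      have h4 : ‖(hamField a ρ).2‖ ≤ B / R ρ.1 := by
        refine le_of_mul_le_mul_left ?_ h0'
        calc _ = ‖(hamField a ρ).2‖ ^ 2 := by ring
          _ ≤ _ := h3
          _ = _ := by ring
      refine h4.trans (le_of_eq ?_)
      field_simp

lemma hamField_eq_toLp {ρ : Phase n} (ha : DifferentiableAt ℝ a ρ) :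
    hamField a ρ = (WithLp.toLp 2 fun i => fderiv ℝ a ρ (coordVec (Sum.inr i)),
      WithLp.toLp 2 fun i => -fderiv ℝ a ρ (coordVec (Sum.inl i))) := by
  refine Prod.ext ?_ ?_
  · ext i
    have := inner_hamField_fst ha (EuclideanSpace.single i 1)
    simpa [EuclideanSpace.inner_single_right, coordVec] using this
  · ext i
    have := inner_hamField_snd ha (EuclideanSpace.single i 1)
    simpa [EuclideanSpace.inner_single_right, coordVec] using this

lemma contDiff_hamField (ha : ContDiff ℝ ∞ a) : ContDiff ℝ ∞ (hamField a) := by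
  have hD : ContDiff ℝ ∞ (fderiv ℝ a) := ha.fderiv_right (by simp)
  rw [show hamField a = fun ρ => (WithLp.toLp 2 fun i => fderiv ℝ a ρ (coordVec (Sum.inr i)),
      WithLp.toLp 2 fun i => -fderiv ℝ a ρ (coordVec (Sum.inl i))) from
    funext fun ρ => hamField_eq_toLp (ha.differentiable (by simp) ρ)]
  refine ContDiff.prodMk ?_ ?_
  · rw [contDiff_euclidean]
    exact fun i => hD.clm_apply contDiff_const
  · rw [contDiff_euclidean]
    exact fun i => (hD.clm_apply contDiff_const).neg

lemma hamDeriv_eq_sum {ρ : Phase n} (ha : DifferentiableAt ℝ a ρ) :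
    hamDeriv a b ρ = ∑ i : Fin n,
      (fderiv ℝ a ρ (coordVec (Sum.inr i)) * fderiv ℝ b ρ (coordVec (Sum.inl i)) +
        -(fderiv ℝ a ρ (coordVec (Sum.inl i)) * fderiv ℝ b ρ (coordVec (Sum.inr i)))) := by
  rw [hamDeriv, hamField_eq_toLp ha]
  conv_lhs => rw [← sum_phaseCoord_smul (n := n) (_, _)]
  rw [map_sum, Fintype.sum_sum_type, ← Finset.sum_add_distrib]
  refine Finset.sum_congr rfl fun i _ => ?_
  simp [phaseCoord]

/-- `H_a b` is a symbol if `a` and `b` are; one derivative in `x` and one in `ξ` gain the factor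
`(r̃ R)⁻¹`. -/
lemma SymbolClass.hamDeriv (h : IsScalePair r R) {w₁ w₂ : Phase n → ℝ}
    (hw₁ : ∀ ρ, 0 ≤ w₁ ρ) (hw₂ : ∀ ρ, 0 ≤ w₂ ρ)
    (ha : SymbolClass r R w₁ a) (hb : SymbolClass r R w₂ b) :
    SymbolClass r R (fun ρ => w₁ ρ * w₂ ρ / (rTilde r ρ * R ρ.1)) (hamDeriv a b) := by
  rw [show Escape.hamDeriv a b = fun ρ => _ from
    funext fun ρ => hamDeriv_eq_sum (b := b) (ha.1.differentiable (by simp) ρ)]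
  have hpos : ∀ ρ : Phase n, 0 ≤ w₁ ρ * w₂ ρ / (rTilde r ρ * R ρ.1) := fun ρ => by
    have := h.rTilde_pos ρ
    have := h.R_pos ρ.1
    have := hw₁ ρ
    have := hw₂ ρ
    positivity
  refine SymbolClass.sum h hpos fun i _ => ?_
  have e1 : (fun ρ : Phase n => w₁ ρ * w₂ ρ / (rTilde r ρ * R ρ.1)) = fun ρ =>
      w₁ ρ * (coordScale r R ρ (Sum.inr i))⁻¹ * (w₂ ρ * (coordScale r R ρ (Sum.inl i))⁻¹) := by
    funext ρ
    simp only [coordScale]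
    rw [div_eq_mul_inv, mul_inv]
    ring
  have e2 : (fun ρ : Phase n => w₁ ρ * w₂ ρ / (rTilde r ρ * R ρ.1)) = fun ρ =>
      w₁ ρ * (coordScale r R ρ (Sum.inl i))⁻¹ * (w₂ ρ * (coordScale r R ρ (Sum.inr i))⁻¹) := by
    funext ρ
    simp only [coordScale]
    rw [div_eq_mul_inv, mul_inv]
    ring
  refine SymbolClass.add h ?_ (SymbolClass.neg h ?_)
  · rw [e1]
    exact (ha.fderiv_coordVec _).mul h (hb.fderiv_coordVec _)
  · rw [e2]
    exact (ha.fderiv_coordVec _).mul h (hb.fderiv_coordVec _)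

end HamiltonFields

/-! ### The principal symbol and the weights -/

section Weights

variable {n : ℕ} {r R m₀ : Config n → ℝ}

lemma SymbolClass.contDiff_base {w : Phase n → ℝ} {f : Config n → ℝ}
    (hf : SymbolClass r R w (fun ρ : Phase n => f ρ.1)) : ContDiff ℝ ∞ f :=
  hf.1.comp (contDiff_id.prodMk (contDiff_const (c := (0 : Config n))))

lemma IsScalePair.contDiff_r (h : IsScalePair r R) : ContDiff ℝ ∞ r := h.symbol_r.contDiff_base

lemma IsScalePair.contDiff_R (h : IsScalePair r R) : ContDiff ℝ ∞ R := h.symbol_R.contDiff_base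

lemma IsScalePair.contDiff_rTilde (h : IsScalePair r R) : ContDiff ℝ ∞ (rTilde r : Phase n → ℝ) := by
  refine ContDiff.sqrt (((h.contDiff_r.comp contDiff_fst).pow 2).add
    ((contDiff_norm_sq ℝ).comp contDiff_snd)) fun ρ => ?_
  have := h.r_pos ρ.1
  have : r ρ.1 ^ 2 + ‖ρ.2‖ ^ 2 ≠ 0 := by positivity
  exact this

namespace SemiclassicalOperator

variable (P : SemiclassicalOperator n)

lemma contDiff_m (h : IsScalePair r R) (hm : IsBaseWeight r R m₀) : ContDiff ℝ ∞ (P.m r m₀) :=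
  (hm.symbol.contDiff_base.comp contDiff_fst).mul
    ((h.contDiff_rTilde.div (h.contDiff_r.comp contDiff_fst) fun ρ => (h.r_pos ρ.1).ne').pow P.N)

lemma one_le_m (h : IsScalePair r R) (hm : IsBaseWeight r R m₀) (ρ : Phase n) :
    1 ≤ P.m r m₀ ρ :=
  one_le_mul_of_one_le_of_one_le (hm.one_le _)
    (one_le_pow₀ ((one_le_div (h.r_pos _)).2 (r_le_rTilde r ρ)))

lemma symbolClass_p (h : IsScalePair r R) (hm : IsBaseWeight r R m₀)
    (hc : P.HasSymbolCoeffs r R m₀) : SymbolClass r R (P.m r m₀) P.p := by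
  have e : P.p = fun ρ : Phase n => ∑ j ∈ Finset.range (P.N + 1),
      ∑ α ∈ Finset.piAntidiag (Finset.univ : Finset (Fin n)) j,
        (P.a α 0 ρ.1).re * ∏ i, ρ.2 i ^ α i := by
    funext ρ
    rw [p, Complex.re_sum]
    refine Finset.sum_congr rfl fun j _ => ?_
    rw [Complex.re_sum]
    refine Finset.sum_congr rfl fun α _ => ?_
    have : (∏ i, ((ρ.2 i : ℝ) : ℂ) ^ α i) = ((∏ i, ρ.2 i ^ α i : ℝ) : ℂ) := by push_cast; rfl
    rw [this, Complex.re_mul_ofReal]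
  rw [e]
  have hm0 : ∀ ρ, 0 ≤ P.m r m₀ ρ := fun ρ => zero_le_one.trans (P.one_le_m h hm ρ)
  refine SymbolClass.sum h hm0 fun j hj => SymbolClass.sum h hm0 fun α hα => ?_
  have hjN : j ≤ P.N := Nat.lt_succ_iff.1 (Finset.mem_range.1 hj)
  have h1 := (hc j hjN α hα 0 (Nat.zero_le _)).clm_comp h Complex.reCLM
  have h2 : SymbolClass r R (fun ρ : Phase n => ∏ i : Fin n, rTilde r ρ ^ α i)
      (fun ρ : Phase n => ∏ i, ρ.2 i ^ α i) :=
    SymbolClass.prod h fun i _ => (symbolClass_snd h i).pow h (α i)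
  have hsum : ∑ i, α i = j := (Finset.mem_piAntidiag.1 hα).1
  have hw : ∀ ρ : Phase n, m₀ ρ.1 * (r ρ.1 ^ j)⁻¹ * ((r ρ.1 * R ρ.1) ^ 0)⁻¹ *
      ∏ i : Fin n, rTilde r ρ ^ α i = m₀ ρ.1 * (rTilde r ρ / r ρ.1) ^ j := fun ρ => by
    rw [Finset.prod_pow_eq_pow_sum, hsum, div_pow]
    have := (h.r_pos ρ.1).ne'
    field_simp
  refine SymbolClass.mono h (D := 1) (h1.mul h h2) (fun ρ => ?_) fun ρ => ?_
  · rw [hw]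
    have := h.r_pos ρ.1
    have := h.rTilde_pos ρ
    have := hm.one_le ρ.1
    positivity
  · rw [hw, one_mul, m]
    have := hm.one_le ρ.1
    gcongr
    exact (one_le_div (h.r_pos _)).2 (r_le_rTilde r ρ)

end SemiclassicalOperator

/-- A smooth proper function on phase space whose differential has at most the size `r̃ R`, measured
by `g`. -/
def logWeight (r : Config n → ℝ) (ρ : Phase n) : ℝ :=
  Real.log ((1 + ‖ρ.1‖ ^ 2) * rTilde r ρ ^ 2)

lemma IsScalePair.contDiff_logWeight (h : IsScalePair r R) :
    ContDiff ℝ ∞ (logWeight r : Phase n → ℝ) := by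
  refine ContDiff.log ((contDiff_const.add ((contDiff_norm_sq ℝ).comp contDiff_fst)).mul
    (h.contDiff_rTilde.pow 2)) fun ρ => ?_
  have := h.rTilde_pos ρ
  have : (1 + ‖ρ.1‖ ^ 2) * rTilde r ρ ^ 2 ≠ 0 := by positivity
  exact this

lemma IsScalePair.isCompact_logWeight_le (h : IsScalePair r R) (b : ℝ) :
    IsCompact {ρ : Phase n | logWeight r ρ ≤ b} := by
  refine (isCompact_closedBall (0 : Phase n) (Real.exp b)).of_isClosed_subset
    (isClosed_le h.contDiff_logWeight.continuous continuous_const) fun ρ hρ => ?_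
  have hr := h.one_le_rTilde ρ
  have h1 : (1 + ‖ρ.1‖ ^ 2) * rTilde r ρ ^ 2 ≤ Real.exp b := by
    rw [← Real.log_le_iff_le_exp (by positivity)]
    exact hρ
  have h2 := norm_le_rTilde r ρ
  rw [mem_closedBall_zero_iff, Prod.norm_def]
  refine max_le ?_ ?_ <;> nlinarith [norm_nonneg ρ.1, sq_nonneg (‖ρ.1‖ - 1), sq_nonneg ‖ρ.1‖,
    mul_nonneg (sq_nonneg ‖ρ.1‖) (sq_nonneg (rTilde r ρ)), norm_nonneg ρ.2,
    mul_le_mul hr hr zero_le_one (by linarith)]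

lemma hasFDerivAt_norm_fst_sq {ρ : Phase n} :
    HasFDerivAt (fun ν : Phase n => ‖ν.1‖ ^ 2)
      ((2 • innerSL ℝ ρ.1).comp (ContinuousLinearMap.fst ℝ (Config n) (Config n))) ρ :=
  (hasStrictFDerivAt_norm_sq ρ.1).hasFDerivAt.comp ρ hasFDerivAt_fst

lemma IsScalePair.exists_abs_fderiv_le_base (h : IsScalePair r R) {f : Config n → ℝ}
    (hf0 : ∀ x, 0 < f x)
    (hf : SymbolClass r R (fun ρ : Phase n => f ρ.1) (fun ρ : Phase n => f ρ.1)) :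
    ∃ C : ℝ, 0 < C ∧ ∀ x v, |fderiv ℝ f x v| ≤ C * f x * (‖v‖ / R x) := by
  obtain ⟨C, hC, H⟩ := hf.exists_abs_fderiv_le h fun ρ => (hf0 ρ.1).le
  refine ⟨C, hC, fun x v => ?_⟩
  have h1 := H (x, 0) (v, 0)
  have h2 := h.gNorm_le_add (x, 0) (v, 0)
  simp only [norm_zero, zero_div, add_zero] at h2
  have h3 : HasFDerivAt (fun ρ : Phase n => f ρ.1)
      ((fderiv ℝ f x).comp (ContinuousLinearMap.fst ℝ _ _)) ((x, 0) : Phase n) :=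
    HasFDerivAt.comp ((x, 0) : Phase n) (g := f) (f := Prod.fst)
      (hf.contDiff_base.differentiable (by simp) x).hasFDerivAt hasFDerivAt_fst
  rw [h3.fderiv] at h1
  exact h1.trans (mul_le_mul_of_nonneg_left h2 (mul_nonneg hC.le (hf0 x).le))

lemma IsScalePair.exists_abs_fderiv_logWeight_le (h : IsScalePair r R) :
    ∃ C : ℝ, 0 < C ∧ ∀ ρ v : Phase n,
      |fderiv ℝ (logWeight r) ρ v| ≤ C * (rTilde r ρ * R ρ.1) * gNorm r R ρ v := by
  obtain ⟨A, hA, hr'⟩ := h.exists_abs_fderiv_le_base h.r_pos h.symbol_r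
  refine ⟨3 + 2 * A, by positivity, fun ρ v => ?_⟩
  have hR := h.R_pos ρ.1
  have hr := h.r_pos ρ.1
  have hrt := h.one_le_rTilde ρ
  have hrtR := h.one_le_rTilde_mul ρ
  have d1 : HasFDerivAt (fun ν : Phase n => r ν.1)
      ((fderiv ℝ r ρ.1).comp (ContinuousLinearMap.fst ℝ _ _)) ρ :=
    HasFDerivAt.comp ρ (g := r) (f := Prod.fst)
      (h.contDiff_r.differentiable (by simp) ρ.1).hasFDerivAt hasFDerivAt_fst
  have d2 : HasFDerivAt (fun ν : Phase n => ‖ν.2‖ ^ 2)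
      ((2 • innerSL ℝ ρ.2).comp (ContinuousLinearMap.snd ℝ (Config n) (Config n))) ρ :=
    (hasStrictFDerivAt_norm_sq ρ.2).hasFDerivAt.comp ρ hasFDerivAt_snd
  have hpos1 : 0 < 1 + ‖ρ.1‖ ^ 2 := by positivity
  have hpos2 : 0 < r ρ.1 ^ 2 + ‖ρ.2‖ ^ 2 := by positivity
  have hsq : rTilde r ρ ^ 2 = r ρ.1 ^ 2 + ‖ρ.2‖ ^ 2 := Real.sq_sqrt hpos2.le
  have e : (logWeight r : Phase n → ℝ) = fun ν =>
      Real.log (1 + ‖ν.1‖ ^ 2) + Real.log (r ν.1 ^ 2 + ‖ν.2‖ ^ 2) := by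
    funext ν
    have h1 : 0 < r ν.1 ^ 2 + ‖ν.2‖ ^ 2 := by have := h.r_pos ν.1; positivity
    rw [logWeight, rTilde, Real.sq_sqrt h1.le, Real.log_mul (by positivity) h1.ne']
  have d3 := ((hasFDerivAt_norm_fst_sq (ρ := ρ)).const_add 1).log hpos1.ne'
  have d4 := ((d1.pow 2).add d2).log (by exact hpos2.ne')
  have d5 := (d3.add d4).fderiv
  rw [e]
  have e2 : fderiv ℝ (fun ν : Phase n =>
      Real.log (1 + ‖ν.1‖ ^ 2) + Real.log (r ν.1 ^ 2 + ‖ν.2‖ ^ 2)) ρ v =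
      (1 + ‖ρ.1‖ ^ 2)⁻¹ * (2 * inner ℝ ρ.1 v.1) +
        (r ρ.1 ^ 2 + ‖ρ.2‖ ^ 2)⁻¹ * (2 * r ρ.1 * fderiv ℝ r ρ.1 v.1 + 2 * inner ℝ ρ.2 v.2) := by
    refine (congrArg (fun T : Phase n →L[ℝ] ℝ => T v) d5).trans ?_
    simp
    ring
  rw [e2, ← hsq]
  set g := gNorm r R ρ v with hg
  have hg0 : 0 ≤ g := gNorm_nonneg _ _ _ _
  have hv1 : ‖v.1‖ ≤ R ρ.1 * g := h.norm_fst_le ρ v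
  have hv2 : ‖v.2‖ ≤ rTilde r ρ * g := h.norm_snd_le ρ v
  have hvR : ‖v.1‖ / R ρ.1 ≤ g := by rwa [div_le_iff₀' hR]
  have i1 : |(1 + ‖ρ.1‖ ^ 2)⁻¹ * (2 * inner ℝ ρ.1 v.1)| ≤ rTilde r ρ * R ρ.1 * g := by
    rw [abs_mul, abs_of_pos (inv_pos.2 hpos1), inv_mul_le_iff₀ hpos1, abs_mul, abs_two]
    have := abs_real_inner_le_norm ρ.1 v.1
    have h2 : 2 * ‖ρ.1‖ ≤ 1 + ‖ρ.1‖ ^ 2 := by nlinarith [sq_nonneg (‖ρ.1‖ - 1)]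
    calc 2 * |inner ℝ ρ.1 v.1| ≤ 2 * ‖ρ.1‖ * ‖v.1‖ := by linarith
      _ ≤ (1 + ‖ρ.1‖ ^ 2) * (R ρ.1 * g) := by gcongr
      _ ≤ (1 + ‖ρ.1‖ ^ 2) * (rTilde r ρ * R ρ.1 * g) := by
        gcongr
        nlinarith
  have hs : 0 < rTilde r ρ ^ 2 := by positivity
  have i2 : |(rTilde r ρ ^ 2)⁻¹ * (2 * r ρ.1 * fderiv ℝ r ρ.1 v.1 + 2 * inner ℝ ρ.2 v.2)| ≤
      (2 * A + 2) * g := by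
    rw [abs_mul, abs_of_pos (inv_pos.2 hs), inv_mul_le_iff₀ hs]
    have j1 : |2 * r ρ.1 * fderiv ℝ r ρ.1 v.1| ≤ 2 * A * rTilde r ρ ^ 2 * g := by
      rw [abs_mul, abs_of_pos (by positivity : 0 < 2 * r ρ.1)]
      have hrr := r_le_rTilde r ρ
      calc 2 * r ρ.1 * |fderiv ℝ r ρ.1 v.1| ≤ 2 * r ρ.1 * (A * r ρ.1 * (‖v.1‖ / R ρ.1)) := by
            gcongr; exact hr' _ _
        _ ≤ 2 * rTilde r ρ * (A * rTilde r ρ * g) := by gcongr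
        _ = _ := by ring
    have j2 : |2 * inner ℝ ρ.2 v.2| ≤ 2 * rTilde r ρ ^ 2 * g := by
      rw [abs_mul, abs_two]
      have := abs_real_inner_le_norm ρ.2 v.2
      calc 2 * |inner ℝ ρ.2 v.2| ≤ 2 * (‖ρ.2‖ * ‖v.2‖) := by linarith
        _ ≤ 2 * (rTilde r ρ * (rTilde r ρ * g)) := by
          gcongr; exact norm_le_rTilde r ρ
        _ = _ := by ring
    refine (abs_add_le _ _).trans ?_
    linarith
  refine (abs_add_le _ _).trans ?_
  have : (2 * A + 2) * g ≤ (2 * A + 2) * (rTilde r ρ * R ρ.1 * g) := by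
    gcongr
    nlinarith
  calc _ ≤ rTilde r ρ * R ρ.1 * g + (2 * A + 2) * (rTilde r ρ * R ρ.1 * g) := by linarith
    _ = _ := by ring

end Weights

/-! ### Slow variation of the metric and the weight -/

section SlowVariation

variable {n : ℕ} {r R m₀ : Config n → ℝ}

/-- A positive function in `S(f)` changes at most by the factor `2` on balls of radius `δ R(x)`. -/
lemma IsScalePair.exists_slow_base (h : IsScalePair r R) {f : Config n → ℝ} (hf0 : ∀ x, 0 < f x)
    (hf : SymbolClass r R (fun ρ : Phase n => f ρ.1) (fun ρ : Phase n => f ρ.1)) :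
    ∃ δ : ℝ, 0 < δ ∧ ∀ x y, ‖y - x‖ ≤ δ * R x → f y ≤ 2 * f x ∧ f x ≤ 2 * f y := by
  have hRx : ∃ δ : ℝ, 0 < δ ∧ ∀ x y, ‖y - x‖ ≤ δ * R x → R x ≤ 2 * R y := by
    obtain ⟨A, hA, H⟩ := h.exists_abs_fderiv_le_base h.R_pos h.symbol_R
    refine ⟨1 / (2 * A), by positivity, fun x y hxy => ?_⟩
    have hlip := (convex_univ (𝕜 := ℝ) (E := Config n)).norm_image_sub_le_of_norm_fderiv_le (𝕜 := ℝ)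
      (f := R) (C := A) (fun z _ => h.contDiff_R.differentiable (by simp) z) (fun z _ =>
        ContinuousLinearMap.opNorm_le_bound _ hA.le fun v => by
          have := H z v
          have hz := (h.R_pos z).ne'
          rw [Real.norm_eq_abs]
          refine this.trans (le_of_eq ?_)
          field_simp) (mem_univ x) (mem_univ y)
    rw [Real.norm_eq_abs] at hlip
    have h1 : A * ‖y - x‖ ≤ R x / 2 := by
      calc A * ‖y - x‖ ≤ A * (1 / (2 * A) * R x) := by gcongr
        _ = R x / 2 := by field_simp
    linarith [(abs_le.1 (hlip.trans h1)).1]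
  obtain ⟨δ₁, hδ₁, hR2⟩ := hRx
  obtain ⟨A, hA, H⟩ := h.exists_abs_fderiv_le_base hf0 hf
  have hl2 : 0 < Real.log 2 := Real.log_pos one_lt_two
  refine ⟨min δ₁ (Real.log 2 / (2 * A)), by positivity, fun x y hxy => ?_⟩
  have hRx := h.R_pos x
  set s := min δ₁ (Real.log 2 / (2 * A)) * R x with hs
  have hy : y ∈ Metric.closedBall x s := by rwa [mem_closedBall_iff_norm]
  have hx : x ∈ Metric.closedBall x s :=
    Metric.mem_closedBall_self ((norm_nonneg _).trans hxy)
  have hlip := (convex_closedBall x s).norm_image_sub_le_of_norm_hasFDerivWithin_le (𝕜 := ℝ)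
    (f := fun z => Real.log (f z)) (C := 2 * A / R x)
    (f' := fun z => (f z)⁻¹ • fderiv ℝ f z) (fun z _ =>
      ((hf.contDiff_base.differentiable (by simp) z).hasFDerivAt.log (hf0 z).ne').hasFDerivWithinAt)
    (fun z hz => ContinuousLinearMap.opNorm_le_bound _ (by positivity) fun v => by
      have hz' : ‖z - x‖ ≤ δ₁ * R x :=
        (mem_closedBall_iff_norm.1 hz).trans (mul_le_mul_of_nonneg_right (min_le_left _ _) hRx.le)
      have hRz := hR2 x z hz'
      have hfz := hf0 z
      have hRz0 := h.R_pos z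
      rw [smul_apply, norm_smul, norm_inv, Real.norm_of_nonneg hfz.le,
        Real.norm_eq_abs, inv_mul_le_iff₀ hfz]
      refine (H z v).trans ?_
      have : ‖v‖ / R z ≤ 2 / R x * ‖v‖ := by
        rw [div_mul_eq_mul_div, div_le_div_iff₀ hRz0 hRx]
        nlinarith [norm_nonneg v]
      calc A * f z * (‖v‖ / R z) ≤ A * f z * (2 / R x * ‖v‖) := by gcongr
        _ = _ := by ring) hx hy
  have h1 : 2 * A / R x * ‖y - x‖ ≤ Real.log 2 := by
    calc 2 * A / R x * ‖y - x‖ ≤ 2 * A / R x * (Real.log 2 / (2 * A) * R x) := by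
          gcongr
          exact hxy.trans (mul_le_mul_of_nonneg_right (min_le_right _ _) hRx.le)
      _ = Real.log 2 := by field_simp
  rw [Real.norm_eq_abs] at hlip
  have h2 := abs_le.1 (hlip.trans h1)
  have hfx := hf0 x
  have hfy := hf0 y
  constructor
  · rw [← Real.log_le_log_iff hfy (by positivity), Real.log_mul two_ne_zero hfx.ne']
    linarith
  · rw [← Real.log_le_log_iff hfx (by positivity), Real.log_mul two_ne_zero hfy.ne']
    linarith

/-- The metric `g` and the weight `m` vary slowly. -/
lemma IsScalePair.exists_slow (h : IsScalePair r R) (hm : IsBaseWeight r R m₀)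
    (P : SemiclassicalOperator n) :
    ∃ δ D : ℝ, 0 < δ ∧ 1 ≤ D ∧ ∀ ρ ν : Phase n, gNorm r R ρ (ν - ρ) ≤ δ →
      (∀ v, gNorm r R ν v ≤ D * gNorm r R ρ v) ∧ P.m r m₀ ν ≤ D * P.m r m₀ ρ := by
  obtain ⟨δ₁, hδ₁, H₁⟩ := h.exists_slow_base h.r_pos h.symbol_r
  obtain ⟨δ₂, hδ₂, H₂⟩ := h.exists_slow_base h.R_pos h.symbol_R
  obtain ⟨δ₃, hδ₃, H₃⟩ := h.exists_slow_base (fun x => zero_lt_one.trans_le (hm.one_le x)) hm.symbol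
  refine ⟨min (1 / 4) (min δ₁ (min δ₂ δ₃)), 8 * 8 ^ P.N, by positivity,
    one_le_mul_of_one_le_of_one_le (by norm_num) (one_le_pow₀ (by norm_num)), fun ρ ν hν => ?_⟩
  have hRρ := h.R_pos ρ.1
  have hx : ‖ν.1 - ρ.1‖ ≤ R ρ.1 * min (1 / 4) (min δ₁ (min δ₂ δ₃)) :=
    (h.norm_fst_le ρ (ν - ρ)).trans (mul_le_mul_of_nonneg_left hν hRρ.le)
  have hξ : ‖ν.2 - ρ.2‖ ≤ rTilde r ρ * (1 / 4) :=
    (h.norm_snd_le ρ (ν - ρ)).trans (mul_le_mul_of_nonneg_left (hν.trans (min_le_left _ _))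
      (h.rTilde_pos ρ).le)
  rw [mul_comm] at hx
  have hx' : ∀ δ', min δ₁ (min δ₂ δ₃) ≤ δ' → ‖ν.1 - ρ.1‖ ≤ δ' * R ρ.1 := fun δ' hδ' =>
    hx.trans (mul_le_mul_of_nonneg_right ((min_le_right _ _).trans hδ') hRρ.le)
  obtain ⟨r1, r2⟩ := H₁ _ _ (hx' δ₁ (min_le_left _ _))
  obtain ⟨-, R2⟩ := H₂ _ _ (hx' δ₂ ((min_le_right _ _).trans (min_le_left _ _)))
  obtain ⟨w1, -⟩ := H₃ _ _ (hx' δ₃ ((min_le_right _ _).trans (min_le_right _ _)))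
  have hrν := h.r_pos ν.1
  have hrρ := h.r_pos ρ.1
  have hRν := h.R_pos ν.1
  have tν := h.rTilde_pos ν
  have tρ := h.rTilde_pos ρ
  have n1 : ‖ν.2‖ ≤ ‖ρ.2‖ + ‖ν.2 - ρ.2‖ := by
    simpa using norm_add_le ρ.2 (ν.2 - ρ.2)
  have n2 : ‖ρ.2‖ ≤ ‖ν.2‖ + ‖ν.2 - ρ.2‖ := by
    have := norm_sub_le ν.2 (ν.2 - ρ.2)
    simpa using this
  have t1 : rTilde r ν ≤ 4 * rTilde r ρ := by
    linarith [h.rTilde_le ν, r_le_rTilde r ρ, norm_le_rTilde r ρ]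
  have t2 : rTilde r ρ ≤ 4 * rTilde r ν := by
    linarith [h.rTilde_le ρ, r_le_rTilde r ν, norm_le_rTilde r ν]
  have h8 : (1 : ℝ) ≤ 8 ^ P.N := one_le_pow₀ (by norm_num)
  refine ⟨fun v => ?_, ?_⟩
  · have hg := gNorm_nonneg r R ρ v
    refine (h.gNorm_le_of (s := 4 * gNorm r R ρ v) ?_ ?_).trans ?_
    · refine (h.norm_fst_le ρ v).trans ?_
      nlinarith
    · refine (h.norm_snd_le ρ v).trans ?_
      nlinarith
    · nlinarith
  · have hm₀ρ := hm.one_le ρ.1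
    have hm₀ν := hm.one_le ν.1
    have q : rTilde r ν / r ν.1 ≤ 8 * (rTilde r ρ / r ρ.1) := by
      rw [← mul_div_assoc, div_le_div_iff₀ hrν hrρ]
      nlinarith [mul_le_mul t1 r2 hrρ.le (by positivity)]
    calc P.m r m₀ ν ≤ (2 * m₀ ρ.1) * (8 * (rTilde r ρ / r ρ.1)) ^ P.N := by
          unfold SemiclassicalOperator.m
          gcongr
      _ = 2 * 8 ^ P.N * P.m r m₀ ρ := by
          rw [mul_pow, SemiclassicalOperator.m]; ring
      _ ≤ 8 * 8 ^ P.N * P.m r m₀ ρ := by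
          have : 0 ≤ P.m r m₀ ρ := zero_le_one.trans (P.one_le_m h hm ρ)
          gcongr
          norm_num

lemma gNorm_smul (r R : Config n → ℝ) (ρ v : Phase n) (t : ℝ) :
    gNorm r R ρ (t • v) = |t| * gNorm r R ρ v := by
  rw [gNorm, gNorm, ← Real.sqrt_sq_eq_abs, ← Real.sqrt_mul (sq_nonneg t)]
  congr 1
  rw [Prod.smul_fst, Prod.smul_snd, norm_smul, norm_smul, Real.norm_eq_abs]
  rw [mul_div_assoc, mul_div_assoc, mul_pow, mul_pow, sq_abs]
  ring

/-- A symbol of weight `m` varies by at most `C δ m` on `g`-balls of small radius `δ`. -/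
lemma SymbolClass.exists_abs_sub_le (h : IsScalePair r R) (hm : IsBaseWeight r R m₀)
    (P : SemiclassicalOperator n) {b : Phase n → ℝ} (hb : SymbolClass r R (P.m r m₀) b) :
    ∃ δ C : ℝ, 0 < δ ∧ 0 < C ∧ ∀ ρ ν : Phase n, gNorm r R ρ (ν - ρ) ≤ δ →
      P.m r m₀ ν ≤ C * P.m r m₀ ρ ∧
      |b ν - b ρ| ≤ C * P.m r m₀ ρ * gNorm r R ρ (ν - ρ) := by
  have hm0 : ∀ ρ, 0 ≤ P.m r m₀ ρ := fun ρ => zero_le_one.trans (P.one_le_m h hm ρ)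
  obtain ⟨δ, D, hδ, hD, H⟩ := h.exists_slow hm P
  obtain ⟨B, hB, hbB⟩ := hb.exists_abs_fderiv_le h hm0
  refine ⟨δ, D + B * D * D, hδ, by positivity, fun ρ ν hν => ⟨?_, ?_⟩⟩
  · refine (H ρ ν hν).2.trans (mul_le_mul_of_nonneg_right ?_ (hm0 ρ))
    have : 0 ≤ B * D * D := by positivity
    linarith
  · have hg := gNorm_nonneg r R ρ (ν - ρ)
    set L : ℝ → Phase n := fun t => ρ + t • (ν - ρ) with hL
    have hd : ∀ t ∈ Icc (0 : ℝ) 1,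
        HasDerivWithinAt (fun t => b (L t)) (fderiv ℝ b (L t) (ν - ρ)) (Icc 0 1) t := fun t _ => by
      have h1 : HasDerivAt L ((1 : ℝ) • (ν - ρ)) t :=
        ((hasDerivAt_id t).smul_const (ν - ρ)).const_add ρ
      rw [one_smul] at h1
      exact ((hb.1.differentiable (by simp) (L t)).hasFDerivAt.comp_hasDerivAt t h1).hasDerivWithinAt
    have hbound : ∀ t ∈ Ico (0 : ℝ) 1, ‖fderiv ℝ b (L t) (ν - ρ)‖ ≤
        B * D * D * P.m r m₀ ρ * gNorm r R ρ (ν - ρ) := fun t ht => by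
      have h1 : gNorm r R ρ (L t - ρ) ≤ δ := by
        rw [hL, add_sub_cancel_left, gNorm_smul, abs_of_nonneg ht.1]
        nlinarith [ht.2]
      obtain ⟨g1, g2⟩ := H ρ (L t) h1
      calc ‖fderiv ℝ b (L t) (ν - ρ)‖ ≤ B * P.m r m₀ (L t) * gNorm r R (L t) (ν - ρ) := hbB _ _
        _ ≤ B * (D * P.m r m₀ ρ) * (D * gNorm r R ρ (ν - ρ)) := by
          gcongr
          · exact gNorm_nonneg _ _ _ _
          · have := hm0 ρ; positivity
          · exact g1 _
        _ = _ := by ring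
    have := norm_image_sub_le_of_norm_deriv_le_segment' hd hbound 1 (right_mem_Icc.2 zero_le_one)
    simp only [hL, one_smul, zero_smul, add_zero, sub_zero, mul_one, add_sub_cancel] at this
    refine this.trans ?_
    gcongr
    · exact hm0 ρ
    · linarith

/-- An escape function for the energy surface is an escape function for nearby energies: by
assumption points of small energy are close to the energy surface, and `H_p G ∈ S(m)` varies
slowly. -/
lemma exists_escapesOnShell (h : IsScalePair r R) (hm : IsBaseWeight r R m₀)
    (P : SemiclassicalOperator n) {G : Phase n → ℝ}
    (hb : SymbolClass r R (P.m r m₀) (hamDeriv P.p G))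
    (hG : EscapesOnShell P.p (P.m r m₀) G 0)
    (hlarge : LargeAwayFromEnergySurface r R P.p (P.m r m₀)) :
    ∃ ε₁ : ℝ, 0 < ε₁ ∧ ∀ ε : ℝ, 0 < ε → ε ≤ ε₁ → EscapesOnShell P.p (P.m r m₀) G ε := by
  obtain ⟨δ, C, hδ, hC, H⟩ := hb.exists_abs_sub_le h hm P
  obtain ⟨C₀, hC₀, K₀, hK₀, hesc⟩ := hG
  set δ' := min δ (1 / (2 * C₀ * C)) with hδ'
  have hδ'0 : 0 < δ' := by positivity
  obtain ⟨ε', hε', hl⟩ := hlarge δ' hδ'0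
  refine ⟨ε' / 2, by positivity, fun ε hε hεε => ⟨2 * C₀ * C, by positivity, ?_⟩⟩
  have hcont : Continuous fun ρ : Phase n => ‖ρ‖ + (R ρ.1 + rTilde r ρ) * δ' :=
    continuous_norm.add (((h.contDiff_R.continuous.comp continuous_fst).add
      h.contDiff_rTilde.continuous).mul continuous_const)
  obtain ⟨B, hB⟩ := hK₀.exists_bound_of_continuousOn hcont.continuousOn
  refine ⟨Metric.closedBall 0 B, isCompact_closedBall _ _, fun ν hν => ?_⟩
  have hmem : ν ∈ ⋃ ρ ∈ shell P.p 0, gBall r R ρ δ' := by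
    by_contra hcon
    have h1 := hl ν hcon
    have h2 : |P.p ν| ≤ ε := hν.1
    nlinarith [P.one_le_m h hm ν]
  simp only [mem_iUnion] at hmem
  obtain ⟨ρ, hρ, hρν⟩ := hmem
  have hρν' : gNorm r R ρ (ν - ρ) < δ' := hρν
  have hmρ := P.one_le_m h hm ρ
  have hρK : ρ ∉ K₀ := fun hρK => hν.2 <| by
    have hRρ := h.R_pos ρ.1
    have tρ := h.rTilde_pos ρ
    have h1 := h.norm_fst_le ρ (ν - ρ)
    have h2 := h.norm_snd_le ρ (ν - ρ)
    have h3 : ‖ν - ρ‖ ≤ (R ρ.1 + rTilde r ρ) * δ' := by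
      rw [Prod.norm_def]
      refine max_le ?_ ?_ <;> nlinarith [gNorm_nonneg r R ρ (ν - ρ)]
    have h4 : ‖ν‖ ≤ ‖ρ‖ + ‖ν - ρ‖ := by simpa using norm_add_le ρ (ν - ρ)
    rw [mem_closedBall_zero_iff]
    linarith [(le_abs_self _).trans (hB ρ hρK)]
  obtain ⟨k1, k2⟩ := H ρ ν (hρν'.le.trans (min_le_left _ _))
  have k3 := hesc ρ ⟨hρ, hρK⟩
  have k4 : C * P.m r m₀ ρ * gNorm r R ρ (ν - ρ) ≤ P.m r m₀ ρ / (2 * C₀) := by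
    calc C * P.m r m₀ ρ * gNorm r R ρ (ν - ρ) ≤ C * P.m r m₀ ρ * (1 / (2 * C₀ * C)) := by
          gcongr
          exact hρν'.le.trans (min_le_right _ _)
      _ = _ := by field_simp
  have k5 : P.m r m₀ ν / (2 * C₀ * C) ≤ P.m r m₀ ρ / (2 * C₀) := by
    rw [div_le_div_iff₀ (by positivity) (by positivity)]
    nlinarith
  have k6 : P.m r m₀ ρ / C₀ = P.m r m₀ ρ / (2 * C₀) + P.m r m₀ ρ / (2 * C₀) := by
    field_simp; norm_num
  linarith [(abs_le.1 (k2.trans k4)).1]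

end SlowVariation

/-! ### Change of time and the convex hull -/

section TimeChange

variable {n : ℕ} {v w : Phase n → Phase n} {Φ : ℝ → Phase n → Phase n} {μ : Phase n → ℝ}

lemma FlowsTo.reverse {t : ℝ} {ρ ν : Phase n} (h : FlowsTo v t ρ ν) :
    FlowsTo (fun x => -v x) (-t) ρ ν := by
  obtain ⟨γ, h0, ht, hγ⟩ := h
  refine ⟨fun s => γ (-s), by simpa using h0, by simpa using ht, fun s hs => ?_⟩
  have hmaps : MapsTo (fun s : ℝ => -s) (uIcc 0 (-t)) (uIcc 0 t) := fun s hs => by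
    rw [mem_uIcc] at hs ⊢
    rcases hs with hs | hs
    · exact Or.inr ⟨by linarith, by linarith⟩
    · exact Or.inl ⟨by linarith, by linarith⟩
  have := (hγ (-s) (hmaps hs)).scomp s (hasDerivAt_neg s).hasDerivWithinAt hmaps
  simpa [Function.comp_def] using this

lemma flowsTo_neg_iff {t : ℝ} {ρ ν : Phase n} :
    FlowsTo v (-t) ρ ν ↔ FlowsTo (fun x => -v x) t ρ ν := by
  refine ⟨fun h => by simpa using h.reverse, fun h => ?_⟩
  have := h.reverse
  simpa using this

lemma tendsToInftyBackward_iff {ρ : Phase n} :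
    TendsToInftyBackward v ρ ↔ TendsToInftyForward (fun x => -v x) ρ := by
  refine forall₂_congr fun L _ => ⟨?_, ?_⟩
  · rintro ⟨t₀, h0, ⟨ν, hν⟩, H⟩
    exact ⟨-t₀, by linarith, ⟨ν, hν.reverse⟩, fun t ht ν' hν' =>
      H (-t) (by linarith) ν' (flowsTo_neg_iff.2 hν')⟩
  · rintro ⟨t₀, h0, ⟨ν, hν⟩, H⟩
    refine ⟨-t₀, by linarith, ⟨ν, flowsTo_neg_iff.2 hν⟩, fun t ht ν' hν' => ?_⟩
    exact H (-t) (by linarith) ν' hν'.reverse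

/-- The time that the integral curve of `v = μ w` through `ρ` needs to reach `Φ s ρ`, where `Φ` is
the flow of `w`. -/
def timeChange (Φ : ℝ → Phase n → Phase n) (μ : Phase n → ℝ) (ρ : Phase n) (s : ℝ) : ℝ :=
  ∫ σ in (0 : ℝ)..s, (μ (Φ σ ρ))⁻¹

lemma timeChange_zero (ρ : Phase n) : timeChange Φ μ ρ 0 = 0 := by simp [timeChange]

lemma hasStrictDerivAt_timeChange (h : IsFlow w Φ) (hμ : Continuous μ) (hμ0 : ∀ x, 0 < μ x)
    (ρ : Phase n) (s : ℝ) : HasStrictDerivAt (timeChange Φ μ ρ) (μ (Φ s ρ))⁻¹ s :=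
  ((hμ.comp (h.continuous_time ρ)).inv₀ fun _ => (hμ0 _).ne').integral_hasStrictDerivAt 0 s

lemma strictMono_timeChange (h : IsFlow w Φ) (hμ : Continuous μ) (hμ0 : ∀ x, 0 < μ x)
    (ρ : Phase n) : StrictMono (timeChange Φ μ ρ) :=
  strictMono_of_hasDerivAt_pos (fun s => (hasStrictDerivAt_timeChange h hμ hμ0 ρ s).hasDerivAt)
    fun _ => inv_pos.2 (hμ0 _)

/-- The orbits of the flow of `w`, parametrized by the inverse of `timeChange`, are integral curves
of `v = μ w`. -/
lemma flowsTo_timeChange (h : IsFlow w Φ) (hμ : Continuous μ) (hμ0 : ∀ x, 0 < μ x)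
    (hv : ∀ x, v x = μ x • w x) (ρ : Phase n) (s : ℝ) :
    FlowsTo v (timeChange Φ μ ρ s) ρ (Φ s ρ) := by
  have hτ := hasStrictDerivAt_timeChange h hμ hμ0 ρ
  have hτc : Continuous (timeChange Φ μ ρ) :=
    continuous_iff_continuousAt.2 fun s => (hτ s).hasDerivAt.continuousAt
  have hopen : IsOpenEmbedding (timeChange Φ μ ρ) :=
    IsOpenEmbedding.of_continuous_injective_isOpenMap hτc (strictMono_timeChange h hμ hμ0 ρ).injective
      (isOpenMap_of_hasStrictDerivAt hτ fun s => (inv_pos.2 (hμ0 _)).ne')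
  set e := hopen.toOpenPartialHomeomorph with he
  have hleft : ∀ s, e.symm (timeChange Φ μ ρ s) = s := fun s => e.left_inv (x := s) trivial
  refine ⟨fun t => Φ (e.symm t) ρ, ?_, by simp only [hleft], fun t ht => ?_⟩
  · have := hleft 0
    rw [timeChange_zero] at this
    simp only [this, h.zero]
  · have hord : (range (timeChange Φ μ ρ)).OrdConnected := (isPreconnected_range hτc).ordConnected
    obtain ⟨σ, rfl⟩ := hord.uIcc_subset ⟨0, timeChange_zero ρ⟩ ⟨s, rfl⟩ ht
    have h1 : HasDerivAt e.symm (μ (Φ σ ρ))⁻¹⁻¹ (timeChange Φ μ ρ σ) :=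
      e.hasDerivAt_symm ⟨σ, trivial, rfl⟩ (inv_pos.2 (hμ0 _)).ne' (by
        rw [hleft]; exact (hτ σ).hasDerivAt)
    rw [inv_inv] at h1
    have h2 := (h.hasDerivAt ρ (e.symm (timeChange Φ μ ρ σ))).scomp _ h1
    rw [hleft] at h2
    have h3 := h2.hasDerivWithinAt (s := uIcc 0 (timeChange Φ μ ρ s))
    simp only [hv, hleft]
    exact h3

/-- Every integral curve of `v = μ w` is a reparametrized orbit of the flow of `w`. -/
lemma FlowsTo.exists_eq_timeChange (h : IsFlow w Φ) (hw : ContDiff ℝ 1 w) (hμ : Continuous μ)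
    (hμ0 : ∀ x, 0 < μ x) (hv : ∀ x, v x = μ x • w x) {ρ ν : Phase n} {t : ℝ} (ht : 0 ≤ t)
    (hf : FlowsTo v t ρ ν) : ∃ s, 0 ≤ s ∧ Φ s ρ = ν ∧ timeChange Φ μ ρ s = t := by
  obtain ⟨γ, h0, hγt, hγ⟩ := hf
  rw [uIcc_of_le ht] at hγ
  have hγc : ContinuousOn γ (Icc 0 t) := fun s hs => (hγ s hs).continuousWithinAt
  set γ' : ℝ → Phase n := fun s => γ (projIcc 0 t ht s) with hγ'
  have hγ'c : Continuous γ' := hγc.domRestrict.Icc_extend' (h := ht)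
  have hγ'e : ∀ s ∈ Icc 0 t, γ' s = γ s := fun s hs => by
    simp only [hγ', projIcc_of_mem ht hs]
  -- the time of the flow of `w` that corresponds to the time `u` of the curve
  set s : ℝ → ℝ := fun u => ∫ σ in (0 : ℝ)..u, μ (γ' σ) with hs
  have hsd : ∀ u, HasDerivAt s (μ (γ' u)) u := fun u =>
    ((hμ.comp hγ'c).integral_hasStrictDerivAt 0 u).hasDerivAt
  have hsc : Continuous s := continuous_iff_continuousAt.2 fun u => (hsd u).continuousAt
  have hyd : ∀ u, HasDerivAt (fun u => Φ (s u) ρ) (μ (γ' u) • w (Φ (s u) ρ)) u := fun u =>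
    (h.hasDerivAt ρ (s u)).scomp u (hsd u)
  have hyc : Continuous fun u => Φ (s u) ρ := (h.continuous_time ρ).comp hsc
  have hs0 : s 0 = 0 := by simp [hs]
  have hX := (isCompact_Icc.image_of_continuousOn hγc).union
    ((isCompact_Icc (a := (0 : ℝ)) (b := t)).image hyc)
  obtain ⟨L, hL⟩ := exists_lipschitzOnWith_of_isCompact hw hX
  obtain ⟨B, hB⟩ := (isCompact_Icc (a := (0 : ℝ)) (b := t)).exists_bound_of_continuousOn
    (hμ.comp hγ'c).continuousOn
  have heq : EqOn γ (fun u => Φ (s u) ρ) (Icc 0 t) := by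
    refine ODE_solution_unique_of_mem_Icc_right (v := fun u x => μ (γ' u) • w x)
      (s := fun _ => γ '' Icc 0 t ∪ (fun u => Φ (s u) ρ) '' Icc 0 t) (K := B.toNNReal * L)
      (fun u hu => LipschitzOnWith.of_dist_le_mul fun x hx y hy => ?_) hγc (fun u hu => ?_)
      (fun u hu => Or.inl (mem_image_of_mem _ (Ico_subset_Icc_self hu))) hyc.continuousOn
      (fun u _ => (hyd u).hasDerivWithinAt)
      (fun u hu => Or.inr (mem_image_of_mem _ (Ico_subset_Icc_self hu))) ?_
    · rw [dist_smul₀, NNReal.coe_mul, mul_assoc]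
      have h1 := hB u (Ico_subset_Icc_self hu)
      exact mul_le_mul (h1.trans (Real.le_coe_toNNReal B)) (hL.dist_le_mul x hx y hy) dist_nonneg
        (NNReal.coe_nonneg _)
    · have h1 := (hγ u (Ico_subset_Icc_self hu)).mono_of_mem_nhdsWithin
        (Icc_mem_nhdsGE_of_mem hu)
      rw [hv] at h1
      rwa [hγ'e u (Ico_subset_Icc_self hu)]
    · simp only [hs0, h.zero, h0]
  refine ⟨s t, intervalIntegral.integral_nonneg ht fun u _ => (hμ0 _).le, ?_, ?_⟩
  · exact (heq (right_mem_Icc.2 ht)).symm.trans hγt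
  · have hd : ∀ u ∈ Icc 0 t, HasDerivAt (fun u => timeChange Φ μ ρ (s u) - u) 0 u := fun u hu => by
      have h1 := ((hasStrictDerivAt_timeChange h hμ hμ0 ρ (s u)).hasDerivAt.comp u
        (hsd u)).sub (hasDerivAt_id u)
      have h2 : Φ (s u) ρ = γ' u := by rw [hγ'e u hu]; exact (heq hu).symm
      rw [h2, inv_mul_cancel₀ (hμ0 _).ne', sub_self] at h1
      exact h1
    have := constant_of_has_deriv_right_zero (fun u hu => (hd u hu).continuousAt.continuousWithinAt)
      (fun u hu => (hd u (Ico_subset_Icc_self hu)).hasDerivWithinAt) t (right_mem_Icc.2 ht)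
    simp only [hs0, timeChange_zero, sub_zero] at this
    linarith

lemma exists_flowsTo_iff (h : IsFlow w Φ) (hw : ContDiff ℝ 1 w) (hμ : Continuous μ)
    (hμ0 : ∀ x, 0 < μ x) (hv : ∀ x, v x = μ x • w x) {ρ ν : Phase n} :
    (∃ t : ℝ, 0 ≤ t ∧ FlowsTo v t ρ ν) ↔ ∃ s : ℝ, 0 ≤ s ∧ Φ s ρ = ν := by
  constructor
  · rintro ⟨t, ht, hf⟩
    obtain ⟨s, hs, e, -⟩ := hf.exists_eq_timeChange h hw hμ hμ0 hv ht
    exact ⟨s, hs, e⟩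
  · rintro ⟨s, hs, rfl⟩
    refine ⟨timeChange Φ μ ρ s, ?_, flowsTo_timeChange h hμ hμ0 hv ρ s⟩
    rw [← timeChange_zero (Φ := Φ) (μ := μ) ρ]
    exact (strictMono_timeChange h hμ hμ0 ρ).monotone hs

lemma tendsToInftyForward_iff (h : IsFlow w Φ) (hw : ContDiff ℝ 1 w) (hμ : Continuous μ)
    (hμ0 : ∀ x, 0 < μ x) (hv : ∀ x, v x = μ x • w x) {ρ : Phase n} :
    TendsToInftyForward v ρ ↔
      ∀ L : Set (Phase n), IsCompact L → ∃ s₀ : ℝ, 0 ≤ s₀ ∧ ∀ s, s₀ ≤ s → Φ s ρ ∉ L := by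
  have hmono := strictMono_timeChange h hμ hμ0 ρ
  refine forall₂_congr fun L _ => ⟨?_, ?_⟩
  · rintro ⟨t₀, ht₀, ⟨ν, hν⟩, H⟩
    obtain ⟨s₀, hs₀, -, rfl⟩ := hν.exists_eq_timeChange h hw hμ hμ0 hv ht₀
    exact ⟨s₀, hs₀, fun s hs => H _ (hmono.monotone hs) _ (flowsTo_timeChange h hμ hμ0 hv ρ s)⟩
  · rintro ⟨s₀, hs₀, H⟩
    have ht₀ : 0 ≤ timeChange Φ μ ρ s₀ := by
      rw [← timeChange_zero (Φ := Φ) (μ := μ) ρ]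
      exact hmono.monotone hs₀
    refine ⟨_, ht₀, ⟨_, flowsTo_timeChange h hμ hμ0 hv ρ s₀⟩, fun t ht ν hν => ?_⟩
    obtain ⟨s, hs, rfl, rfl⟩ := hν.exists_eq_timeChange h hw hμ hμ0 hv (ht₀.trans ht)
    exact H s (hmono.le_iff_le.1 ht)

/-- The convex hull in terms of the flow of `w = H_p / μ`: it consists of the points of the
energy shell from which one escapes to infinity neither forward nor backward in time without
meeting `K`. -/
theorem hull_eq_diff_escapeSet {p ψ G : Phase n → ℝ} {ε c C M : ℝ} {K K₁ : Set (Phase n)}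
    (h : IsEscapeSystem w Φ (shell p ε) ψ G K₁ c C M) (hw : ContDiff ℝ 1 w) (hμ : Continuous μ)
    (hμ0 : ∀ x, 0 < μ x) (hv : ∀ x, hamField p x = μ x • w x) (hK : K ⊆ K₁)
    (hKs : K ⊆ shell p ε) :
    hull p ε K = shell p ε \ (escapeSet Φ G M K ∪
      escapeSet (fun t => Φ (-t)) (fun x => -G x) M K) := by
  have hv' : ∀ x, -hamField p x = μ x • -w x := fun x => by rw [hv, smul_neg]
  have hinv : ∀ s x, Φ (-s) (Φ s x) = x := fun s x => by rw [← h.flow.add, neg_add_cancel, h.flow.zero]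
  have hinv' : ∀ s x, Φ s (Φ (-s) x) = x := fun s x => by rw [← h.flow.add, add_neg_cancel, h.flow.zero]
  have hin : ∀ x ∈ shell p ε, x ∈ inTailOf p ε K ↔ x ∉ escapeSet Φ G M K := fun x hx => by
    rw [h.notMem_escapeSet_iff hK hx, inTailOf, inTail, mem_union, mem_ofPred_eq, mem_ofPred_eq,
      tendsToInftyForward_iff h.flow hw hμ hμ0 hv]
    refine or_congr (and_iff_right hx) ⟨?_, ?_⟩
    · rintro ⟨ρ, hρ, t, ht, hf⟩
      obtain ⟨s, hs, rfl⟩ := (exists_flowsTo_iff h.flow.reverse hw.neg hμ hμ0 hv').1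
        ⟨t, ht, flowsTo_neg_iff.1 hf⟩
      exact ⟨s, hs, by rwa [hinv']⟩
    · rintro ⟨s, hs, hK'⟩
      obtain ⟨t, ht, hf⟩ := (exists_flowsTo_iff h.flow.reverse hw.neg hμ hμ0 hv'
        (ρ := Φ s x) (ν := x)).2 ⟨s, hs, hinv s x⟩
      exact ⟨_, hK', t, ht, flowsTo_neg_iff.2 hf⟩
  have hout : ∀ x ∈ shell p ε, x ∈ outTailOf p ε K ↔
      x ∉ escapeSet (fun t => Φ (-t)) (fun x => -G x) M K := fun x hx => by
    rw [h.reverse.notMem_escapeSet_iff hK hx, outTailOf, outTail, mem_union, mem_ofPred_eq,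
      mem_ofPred_eq, tendsToInftyBackward_iff,
      tendsToInftyForward_iff h.flow.reverse hw.neg hμ hμ0 hv']
    refine or_congr (and_iff_right hx) ⟨?_, ?_⟩
    · rintro ⟨ρ, hρ, t, ht, hf⟩
      obtain ⟨s, hs, rfl⟩ := (exists_flowsTo_iff h.flow hw hμ hμ0 hv).1 ⟨t, ht, hf⟩
      exact ⟨s, hs, by rwa [hinv]⟩
    · rintro ⟨s, hs, hK'⟩
      obtain ⟨t, ht, hf⟩ := (exists_flowsTo_iff h.flow hw hμ hμ0 hv
        (ρ := Φ (-s) x) (ν := x)).2 ⟨s, hs, hinv' s x⟩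
      exact ⟨_, hK', t, ht, hf⟩
  have hsub : outTailOf p ε K ⊆ shell p ε := by
    rintro x (hx | ⟨ρ, hρ, t, ht, hf⟩)
    · exact hx.1
    · obtain ⟨s, -, rfl⟩ := (exists_flowsTo_iff h.flow hw hμ hμ0 hv).1 ⟨t, ht, hf⟩
      exact h.invariant ρ (hKs hρ) s
  ext x
  simp only [hull, mem_inter_iff, Set.mem_sdiff, mem_union, not_or]
  constructor
  · rintro ⟨h1, h2⟩
    have hx := hsub h1
    exact ⟨hx, (hin x hx).1 h2, (hout x hx).1 h1⟩
  · rintro ⟨hx, h1, h2⟩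
    exact ⟨(hout x hx).2 h2, (hin x hx).2 h1⟩

end TimeChange

/-! ### Estimates for escape functions -/

section EscapeFunctions

variable {n : ℕ} {r R m₀ : Config n → ℝ} {P : SemiclassicalOperator n}

/-- The square of the derivative of a nonnegative function is bounded by the function. -/
lemma deriv_sq_le_of_nonneg {f : ℝ → ℝ} (hf : ContDiff ℝ ∞ f) (h0 : ∀ x, 0 ≤ f x)
    (hc : HasCompactSupport f) : ∃ C : ℝ, 0 < C ∧ ∀ x, deriv f x ^ 2 ≤ C * f x := by
  have hf' : ContDiff ℝ ∞ (deriv f) := (contDiff_infty_iff_deriv.1 hf).2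
  obtain ⟨M, hM⟩ := (hf'.continuous_deriv (by simp)).bounded_above_of_compact_support
    hc.deriv.deriv
  set B := |M| + 1 with hB
  have hB0 : 0 < B := by positivity
  have hlip : ∀ x y, |deriv f y - deriv f x| ≤ B * |y - x| := fun x y => by
    have := (convex_univ (𝕜 := ℝ) (E := ℝ)).norm_image_sub_le_of_norm_deriv_le
      (f := deriv f) (C := B) (fun z _ => hf'.differentiable (by simp) z)
      (fun z _ => (hM z).trans (by linarith [le_abs_self M])) (mem_univ x) (mem_univ y)
    simpa using this
  refine ⟨4 * B, by positivity, fun x => ?_⟩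
  have key : ∀ s, f (x + s) ≤ f x + deriv f x * s + B * s ^ 2 := fun s => by
    have hd : ∀ z ∈ uIcc 0 s, HasDerivWithinAt (fun z => f (x + z) - deriv f x * z)
        (deriv f (x + z) - deriv f x) (uIcc 0 s) z := fun z _ => by
      have h1 : HasDerivAt (fun z => f (x + z)) (deriv f (x + z)) z :=
        HasDerivAt.comp_const_add x z (hf.differentiable (by simp) _).hasDerivAt
      have h2 := h1.sub ((hasDerivAt_id z).const_mul (deriv f x))
      rw [mul_one] at h2
      exact h2.hasDerivWithinAt
    have := (convex_uIcc (0 : ℝ) s).norm_image_sub_le_of_norm_hasDerivWithin_le (C := B * |s|) hd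
      (fun z hz => ?_) left_mem_uIcc right_mem_uIcc
    · simp only [Real.norm_eq_abs, add_zero, mul_zero, sub_zero] at this
      have h3 := (le_abs_self _).trans this
      have h4 : B * |s| * |s| = B * s ^ 2 := by rw [mul_assoc, abs_mul_abs_self]; ring
      linarith
    · refine (hlip x (x + z)).trans ?_
      rw [add_sub_cancel_left]
      have := abs_sub_left_of_mem_uIcc hz
      simp only [sub_zero] at this
      gcongr
  -- the quadratic upper bound is taken at its minimum
  have h1 := (h0 _).trans (key (-(deriv f x) / (2 * B)))
  have h2 : f x + deriv f x * (-(deriv f x) / (2 * B)) + B * (-(deriv f x) / (2 * B)) ^ 2 =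
      f x - deriv f x ^ 2 / (4 * B) := by
    field_simp
    ring
  rw [h2, sub_nonneg, div_le_iff₀ (by positivity)] at h1
  linarith

lemma SymbolClass.exists_gNorm_hamField_le (h : IsScalePair r R) {w a : Phase n → ℝ}
    (hw : ∀ ρ, 0 ≤ w ρ) (ha : SymbolClass r R w a) :
    ∃ C : ℝ, 0 < C ∧ ∀ ρ, gNorm r R ρ (hamField a ρ) ≤ C * (w ρ / (rTilde r ρ * R ρ.1)) := by
  obtain ⟨C, hC, H⟩ := ha.exists_abs_fderiv_le h hw
  refine ⟨2 * C, by positivity, fun ρ => ?_⟩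
  refine (h.gNorm_hamField_le (ha.1.differentiable (by simp) ρ)
    (mul_nonneg hC.le (hw ρ)) (H ρ)).trans (le_of_eq ?_)
  ring

lemma SymbolClass.exists_abs_le {w a : Phase n → ℝ} (ha : SymbolClass r R w a) :
    ∃ C : ℝ, ∀ ρ, |a ρ| ≤ C * w ρ := by
  obtain ⟨C, hC⟩ := ha.2 0 Fin.elim0
  exact ⟨C, fun ρ => by simpa using hC ρ⟩

/-- Differentiation along the rescaled Hamilton field `H_p / m`. -/
lemma fderiv_smul_hamField (p μ b : Phase n → ℝ) (ρ : Phase n) :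
    fderiv ℝ b ρ ((μ ρ)⁻¹ • hamField p ρ) = (μ ρ)⁻¹ * hamDeriv p b ρ := by
  rw [map_smul, smul_eq_mul, hamDeriv]

/-- Divided by the weight `m`, the Hamilton field becomes complete, and the escape function grows at
least at a constant rate along its flow, off a compact part of the energy shell. -/
lemma exists_isEscapeSystem (h : IsScalePair r R) (hm : IsBaseWeight r R m₀)
    (hc : P.HasSymbolCoeffs r R m₀) {G : Phase n → ℝ} (hG : ContDiff ℝ ∞ G) {ε C₀ : ℝ}
    (hC₀ : 0 < C₀) {K K' : Set (Phase n)} (hK : IsCompact K) (hK' : IsCompact K')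
    (hesc : ∀ ρ ∈ shell P.p ε \ K', P.m r m₀ ρ / C₀ ≤ hamDeriv P.p G ρ) :
    ∃ Φ K₁ C M, K ⊆ interior K₁ ∧
      IsEscapeSystem (fun ρ => (P.m r m₀ ρ)⁻¹ • hamField P.p ρ) Φ (shell P.p ε) (logWeight r) G K₁
        C₀⁻¹ C M := by
  have hp := P.symbolClass_p h hm hc
  have hm1 := P.one_le_m (m₀ := m₀) h hm
  have hm0 : ∀ ρ, 0 < P.m r m₀ ρ := fun ρ => zero_lt_one.trans_le (hm1 ρ)
  have hpd : Differentiable ℝ P.p := hp.1.differentiable (by simp)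
  have hw : ContDiff ℝ ∞ (fun ρ : Phase n => (P.m r m₀ ρ)⁻¹ • hamField P.p ρ) :=
    ((P.contDiff_m h hm).inv fun ρ => (hm0 ρ).ne').smul (contDiff_hamField hp.1)
  obtain ⟨A, hA, hpA⟩ := hp.exists_gNorm_hamField_le h fun ρ => (hm0 ρ).le
  obtain ⟨B, hB, hψB⟩ := h.exists_abs_fderiv_logWeight_le
  have hspeed : ∀ ρ : Phase n,
      |fderiv ℝ (logWeight r) ρ ((P.m r m₀ ρ)⁻¹ • hamField P.p ρ)| ≤ B * A := fun ρ => by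
    have hmρ := hm0 ρ
    have hrR : 0 < rTilde r ρ * R ρ.1 := zero_lt_one.trans_le (h.one_le_rTilde_mul ρ)
    rw [map_smul, smul_eq_mul, abs_mul, abs_of_pos (inv_pos.2 hmρ), inv_mul_le_iff₀ hmρ]
    calc _ ≤ B * (rTilde r ρ * R ρ.1) * gNorm r R ρ (hamField P.p ρ) := hψB _ _
      _ ≤ B * (rTilde r ρ * R ρ.1) * (A * (P.m r m₀ ρ / (rTilde r ρ * R ρ.1))) := by
        gcongr
        exact hpA ρ
      _ = _ := by
        have := (h.rTilde_pos ρ).ne'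
        have := (h.R_pos ρ.1).ne'
        field_simp
  obtain ⟨Φ, hΦ⟩ := exists_isFlow (hw.of_le (by simp)) (h.contDiff_logWeight.of_le (by simp))
    h.isCompact_logWeight_le hspeed
  obtain ⟨b, hb⟩ := (hK.union hK').isBounded.subset_ball (0 : Phase n)
  obtain ⟨M, hM⟩ := (isCompact_closedBall (0 : Phase n) b).exists_bound_of_continuousOn
    hG.continuous.continuousOn
  refine ⟨Φ, Metric.closedBall 0 b, B * A, M,
    (subset_union_left.trans hb).trans Metric.ball_subset_interior_closedBall, hΦ, hw.continuous,
    isClosed_le hp.1.continuous.abs continuous_const, fun x hx t => ?_, h.contDiff_logWeight,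
    h.isCompact_logWeight_le, hspeed, hG, isCompact_closedBall _ _, inv_pos.2 hC₀,
    fun x hx hxK => ?_, hM⟩
  · have := hΦ.apply_eq_of_fderiv_eq_zero hpd (fun x => by
      rw [fderiv_smul_hamField, hamDeriv_self (hpd x), mul_zero]) x t
    change |P.p (Φ t x)| ≤ ε
    rw [this]
    exact hx
  · rw [fderiv_smul_hamField, le_inv_mul_iff₀ (hm0 x), ← div_eq_mul_inv]
    exact hesc x ⟨hx, fun hxK' =>
      hxK (Metric.ball_subset_closedBall (hb (subset_union_right hxK')))⟩

/-- A function that is an escape function near infinity and controls its differential on compact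
sets does so everywhere. -/
lemma exists_mul_gNorm_hamField_le (h : IsScalePair r R) (hm : IsBaseWeight r R m₀)
    {G Gt : Phase n → ℝ} (hG : SymbolClass r R (fun ρ => rTilde r ρ * R ρ.1) G)
    (hGt : ContDiff ℝ ∞ Gt) {S X : Set (Phase n)} (hX : IsCompact X)
    (heq : ∀ ρ, ρ ∉ X → Gt =ᶠ[𝓝 ρ] G) {p : Phase n → ℝ} {C₀ A : ℝ} (hC₀ : 0 < C₀) (hA : 0 < A)
    (hesc : ∀ ρ ∈ S, ρ ∉ X → P.m r m₀ ρ / C₀ ≤ hamDeriv p G ρ)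
    (hX' : ∀ ρ ∈ S ∩ X, ‖fderiv ℝ Gt ρ‖ ≤
      A * fderiv ℝ Gt ρ ((P.m r m₀ ρ)⁻¹ • hamField p ρ)) :
    ∃ C : ℝ, 0 < C ∧ ∀ ρ ∈ S,
      P.m r m₀ ρ * gNorm r R ρ (hamField Gt ρ) ≤ C * hamDeriv p Gt ρ := by
  have hm0 : ∀ ρ, 0 < P.m r m₀ ρ := fun ρ => zero_lt_one.trans_le (P.one_le_m h hm ρ)
  have hrR : ∀ ρ : Phase n, 0 < rTilde r ρ * R ρ.1 := fun ρ =>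
    zero_lt_one.trans_le (h.one_le_rTilde_mul ρ)
  obtain ⟨B, hB, hGB⟩ := hG.exists_gNorm_hamField_le h fun ρ => (hrR ρ).le
  have hscont : Continuous fun ρ : Phase n =>
      2 * ((R ρ.1 + rTilde r ρ) / (rTilde r ρ * R ρ.1)) := by
    have c1 : Continuous fun ρ : Phase n => R ρ.1 := h.contDiff_R.continuous.comp continuous_fst
    have c2 := h.contDiff_rTilde.continuous
    exact continuous_const.mul ((c1.add c2).div (c2.mul c1) fun ρ => (hrR ρ).ne')
  obtain ⟨D, hD⟩ := hX.exists_bound_of_continuousOn hscont.continuousOn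
  refine ⟨B * C₀ + |D| * A, by positivity, fun ρ hρ => ?_⟩
  have hmρ := hm0 ρ
  have hg := gNorm_nonneg r R ρ (hamField Gt ρ)
  -- it suffices to have one of the two summands as constant, since the left-hand side is `≥ 0`
  have weaken : ∀ C₁ C₂ : ℝ, 0 < C₁ → C₁ ≤ C₂ →
      P.m r m₀ ρ * gNorm r R ρ (hamField Gt ρ) ≤ C₁ * hamDeriv p Gt ρ →
      P.m r m₀ ρ * gNorm r R ρ (hamField Gt ρ) ≤ C₂ * hamDeriv p Gt ρ := fun C₁ C₂ h1 h2 h3 => by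
    have h4 : 0 ≤ hamDeriv p Gt ρ := by
      have := (mul_nonneg hmρ.le hg).trans h3
      exact (mul_nonneg_iff_of_pos_left h1).1 this
    exact h3.trans (mul_le_mul_of_nonneg_right h2 h4)
  by_cases hρX : ρ ∈ X
  · have h1 := hX' ρ ⟨hρ, hρX⟩
    rw [fderiv_smul_hamField] at h1
    have h2 : gNorm r R ρ (hamField Gt ρ) ≤ |D| * ‖fderiv ℝ Gt ρ‖ := by
      have hR := h.R_pos ρ.1
      have hr := h.rTilde_pos ρ
      refine (h.gNorm_hamField_le (B := ‖fderiv ℝ Gt ρ‖ * (R ρ.1 + rTilde r ρ))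
        (hGt.differentiable (by simp) ρ) (by positivity) fun v => ?_).trans ?_
      · refine ((fderiv ℝ Gt ρ).le_opNorm v).trans ?_
        rw [mul_assoc]
        refine mul_le_mul_of_nonneg_left ?_ (norm_nonneg _)
        rw [Prod.norm_def]
        refine max_le ((h.norm_fst_le ρ v).trans ?_) ((h.norm_snd_le ρ v).trans ?_) <;>
          nlinarith [gNorm_nonneg r R ρ v]
      · calc _ = 2 * ((R ρ.1 + rTilde r ρ) / (rTilde r ρ * R ρ.1)) * ‖fderiv ℝ Gt ρ‖ := by ring
          _ ≤ _ := mul_le_mul_of_nonneg_right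
            (((le_abs_self _).trans (hD ρ hρX)).trans (le_abs_self D)) (norm_nonneg _)
    rcases (abs_nonneg D).eq_or_lt with hD0 | hD0
    · rw [← hD0, zero_mul] at h2
      have h3 : gNorm r R ρ (hamField Gt ρ) = 0 := le_antisymm h2 hg
      have h4 : 0 ≤ (P.m r m₀ ρ)⁻¹ * hamDeriv p Gt ρ :=
        (mul_nonneg_iff_of_pos_left hA).1 ((norm_nonneg _).trans h1)
      have h5 := (mul_nonneg_iff_of_pos_left (inv_pos.2 hmρ)).1 h4
      rw [h3, mul_zero]
      positivity
    · refine weaken (|D| * A) _ (by positivity) (by linarith [mul_pos hB hC₀]) ?_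
      calc P.m r m₀ ρ * gNorm r R ρ (hamField Gt ρ)
          ≤ P.m r m₀ ρ * (|D| * (A * ((P.m r m₀ ρ)⁻¹ * hamDeriv p Gt ρ))) := by
            gcongr
            exact h2.trans (mul_le_mul_of_nonneg_left h1 (abs_nonneg D))
        _ = _ := by field_simp
  · refine weaken (B * C₀) _ (by positivity) (by linarith [mul_nonneg (abs_nonneg D) hA.le]) ?_
    have hf : fderiv ℝ Gt ρ = fderiv ℝ G ρ := (heq ρ hρX).fderiv_eq
    have hH : hamField Gt ρ = hamField G ρ :=
      hamField_eq_of_fderiv (hGt.differentiable (by simp) ρ) fun u => by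
        rw [hf, fderiv_eq_inner_hamField (hG.1.differentiable (by simp) ρ)]
    have hb := hGB ρ
    rw [div_self (hrR ρ).ne', mul_one] at hb
    have h1 := hesc ρ hρ hρX
    rw [div_le_iff₀ hC₀] at h1
    rw [hH, hamDeriv, hf]
    calc P.m r m₀ ρ * gNorm r R ρ (hamField G ρ) ≤ hamDeriv p G ρ * C₀ * B :=
          mul_le_mul h1 hb (gNorm_nonneg _ _ _ _) (hmρ.le.trans h1)
      _ = _ := by rw [hamDeriv]; ring

/-- The energy cutoff of a modified escape function. The term in `H_{χ(p) G}` which contains the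
derivative of `χ` is controlled because `χ'² ≤ C χ` and because `G² ≤ C H_p G` on compact sets. -/
lemma exists_cutoff_estimate (h : IsScalePair r R) (hm : IsBaseWeight r R m₀)
    (hc : P.HasSymbolCoeffs r R m₀) {Gt : Phase n → ℝ}
    (hGt : SymbolClass r R (fun ρ => rTilde r ρ * R ρ.1) Gt) {ε C₀ A C₁ D : ℝ} {X : Set (Phase n)}
    (hC₀ : 0 < C₀) (hA : 0 < A) (hC₁ : 0 < C₁)
    (hD : ∀ ρ ∈ shell P.p ε, P.m r m₀ ρ ≤ D)
    (hesc : ∀ ρ ∈ shell P.p ε, ρ ∉ X → P.m r m₀ ρ / C₀ ≤ hamDeriv P.p Gt ρ)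
    (hX' : ∀ ρ ∈ shell P.p ε ∩ X, Gt ρ ^ 2 ≤
      A * fderiv ℝ Gt ρ ((P.m r m₀ ρ)⁻¹ • hamField P.p ρ))
    (hlow : ∀ ρ ∈ shell P.p ε,
      P.m r m₀ ρ * gNorm r R ρ (hamField Gt ρ) ≤ C₁ * hamDeriv P.p Gt ρ)
    {χ : ℝ → ℝ} (hχ : IsEnergyCutoff ε χ) :
    ∃ C : ℝ, 0 < C ∧ ∀ ρ : Phase n, P.m r m₀ ρ / C *
        gNorm r R ρ (hamField (fun ν => χ (P.p ν) * Gt ν) ρ) ^ 2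
      ≤ hamDeriv P.p (fun ν => χ (P.p ν) * Gt ν) ρ := by
  have hp := P.symbolClass_p h hm hc
  have hm1 := P.one_le_m (m₀ := m₀) h hm
  have hrR1 := fun ρ : Phase n => h.one_le_rTilde_mul ρ
  obtain ⟨E, hE, hpE⟩ := hp.exists_gNorm_hamField_le h fun ρ => zero_le_one.trans (hm1 ρ)
  obtain ⟨F, hF, hGF⟩ := hGt.exists_gNorm_hamField_le h fun ρ => zero_le_one.trans (hrR1 ρ)
  obtain ⟨J, hJ⟩ := hGt.exists_abs_le
  have hsupp : HasCompactSupport χ :=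
    isCompact_Icc.of_isClosed_subset (isClosed_tsupport χ) (hχ.support.trans Ioo_subset_Icc_self)
  obtain ⟨N, hN, hχN⟩ := deriv_sq_le_of_nonneg hχ.smooth (fun s => (hχ.mem_Icc s).1) hsupp
  set D' := max D 1 with hD'
  have hD'1 : 1 ≤ D' := le_max_right _ _
  -- the estimate of `m (Gt ‖H_p‖)²` by `H_p Gt`
  set T := E ^ 2 * J ^ 2 * D' ^ 2 * C₀ + E ^ 2 * D' ^ 3 * A with hT
  have hT0 : 0 < T := by positivity
  have key : ∀ ρ ∈ shell P.p ε,
      P.m r m₀ ρ * (|Gt ρ| * gNorm r R ρ (hamField P.p ρ)) ^ 2 ≤ T * hamDeriv P.p Gt ρ := by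
    intro ρ hρ
    have hmρ : 0 < P.m r m₀ ρ := zero_lt_one.trans_le (hm1 ρ)
    have hmD : P.m r m₀ ρ ≤ D' := (hD ρ hρ).trans (le_max_left _ _)
    have hrR := hrR1 ρ
    have hrR0 : 0 < rTilde r ρ * R ρ.1 := zero_lt_one.trans_le hrR
    have hH0 : 0 ≤ hamDeriv P.p Gt ρ := (mul_nonneg_iff_of_pos_left hC₁).1
      ((mul_nonneg hmρ.le (gNorm_nonneg _ _ _ _)).trans (hlow ρ hρ))
    have hg := gNorm_nonneg r R ρ (hamField P.p ρ)
    by_cases hρX : ρ ∈ X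
    · have h1 := hX' ρ ⟨hρ, hρX⟩
      rw [fderiv_smul_hamField] at h1
      have h2 : gNorm r R ρ (hamField P.p ρ) ≤ E * P.m r m₀ ρ := (hpE ρ).trans
        (mul_le_mul_of_nonneg_left (div_le_self hmρ.le hrR) hE.le)
      calc P.m r m₀ ρ * (|Gt ρ| * gNorm r R ρ (hamField P.p ρ)) ^ 2
          = P.m r m₀ ρ * Gt ρ ^ 2 * gNorm r R ρ (hamField P.p ρ) ^ 2 := by
            rw [mul_pow, sq_abs]; ring
        _ ≤ P.m r m₀ ρ * (A * ((P.m r m₀ ρ)⁻¹ * hamDeriv P.p Gt ρ)) *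
            (E * P.m r m₀ ρ) ^ 2 := by gcongr
        _ = E ^ 2 * P.m r m₀ ρ ^ 2 * A * hamDeriv P.p Gt ρ := by field_simp
        _ ≤ E ^ 2 * D' ^ 3 * A * hamDeriv P.p Gt ρ := by
            have : P.m r m₀ ρ ^ 2 ≤ D' ^ 3 :=
              (pow_le_pow_left₀ hmρ.le hmD 2).trans (pow_le_pow_right₀ hD'1 (by norm_num))
            gcongr
        _ ≤ T * hamDeriv P.p Gt ρ := by
            refine mul_le_mul_of_nonneg_right ?_ hH0
            have : 0 ≤ E ^ 2 * J ^ 2 * D' ^ 2 * C₀ := by positivity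
            linarith
    · have h1 := hesc ρ hρ hρX
      rw [div_le_iff₀ hC₀] at h1
      have h2 : |Gt ρ| * gNorm r R ρ (hamField P.p ρ) ≤ |J| * E * P.m r m₀ ρ := by
        calc _ ≤ (|J| * (rTilde r ρ * R ρ.1)) * (E * (P.m r m₀ ρ / (rTilde r ρ * R ρ.1))) :=
              mul_le_mul ((hJ ρ).trans (mul_le_mul_of_nonneg_right (le_abs_self J) hrR0.le))
                (hpE ρ) hg (by positivity)
          _ = _ := by
            have := (h.rTilde_pos ρ).ne'
            have := (h.R_pos ρ.1).ne'
            field_simp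
      calc P.m r m₀ ρ * (|Gt ρ| * gNorm r R ρ (hamField P.p ρ)) ^ 2
          ≤ P.m r m₀ ρ * (|J| * E * P.m r m₀ ρ) ^ 2 := by gcongr
        _ = E ^ 2 * J ^ 2 * P.m r m₀ ρ ^ 2 * P.m r m₀ ρ := by
            rw [mul_pow, mul_pow, sq_abs]; ring
        _ ≤ E ^ 2 * J ^ 2 * D' ^ 2 * (hamDeriv P.p Gt ρ * C₀) := by gcongr
        _ = E ^ 2 * J ^ 2 * D' ^ 2 * C₀ * hamDeriv P.p Gt ρ := by ring
        _ ≤ T * hamDeriv P.p Gt ρ := by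
            refine mul_le_mul_of_nonneg_right ?_ hH0
            have : 0 ≤ E ^ 2 * D' ^ 3 * A := by positivity
            linarith
  refine ⟨8 * (F * C₁ + N * T), by positivity, fun ρ => ?_⟩
  have hmρ : 0 < P.m r m₀ ρ := zero_lt_one.trans_le (hm1 ρ)
  obtain ⟨e1, e2⟩ := hamField_mul_comp (Gt := Gt) (χ := χ) (hp.1.differentiable (by simp) ρ)
    (hGt.1.differentiable (by simp) ρ) (hχ.smooth.differentiable (by simp) _)
  rw [e1, e2]
  by_cases hρ : ρ ∈ shell P.p ε
  · obtain ⟨c0, c1⟩ := hχ.mem_Icc (P.p ρ)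
    have g0 := gNorm_add_smul_le h ρ (hamField Gt ρ) (hamField P.p ρ) (χ (P.p ρ))
      (deriv χ (P.p ρ) * Gt ρ)
    set g₁ := gNorm r R ρ (hamField Gt ρ) with hg₁
    set g₂ := gNorm r R ρ (hamField P.p ρ) with hg₂
    have hg₁0 : 0 ≤ g₁ := gNorm_nonneg _ _ _ _
    have hg₂0 : 0 ≤ g₂ := gNorm_nonneg _ _ _ _
    have hg₁F : g₁ ≤ F := by
      have := hGF ρ
      rwa [div_self (zero_lt_one.trans_le (hrR1 ρ)).ne', mul_one] at this
    have hH0 : 0 ≤ hamDeriv P.p Gt ρ := (mul_nonneg_iff_of_pos_left hC₁).1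
      ((mul_nonneg hmρ.le (gNorm_nonneg _ _ _ _)).trans (hlow ρ hρ))
    have a1 : P.m r m₀ ρ * (χ (P.p ρ) * g₁) ^ 2 ≤
        χ (P.p ρ) * (F * C₁ * hamDeriv P.p Gt ρ) := by
      calc P.m r m₀ ρ * (χ (P.p ρ) * g₁) ^ 2
          = χ (P.p ρ) * (χ (P.p ρ) * (g₁ * (P.m r m₀ ρ * g₁))) := by ring
        _ ≤ χ (P.p ρ) * (1 * (F * (C₁ * hamDeriv P.p Gt ρ))) := by
          have := mul_le_mul hg₁F (hlow ρ hρ) (mul_nonneg hmρ.le hg₁0) hF.le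
          gcongr
        _ = _ := by ring
    have a2 : P.m r m₀ ρ * (|deriv χ (P.p ρ) * Gt ρ| * g₂) ^ 2 ≤
        χ (P.p ρ) * (N * T * hamDeriv P.p Gt ρ) := by
      calc P.m r m₀ ρ * (|deriv χ (P.p ρ) * Gt ρ| * g₂) ^ 2
          = deriv χ (P.p ρ) ^ 2 * (P.m r m₀ ρ * (|Gt ρ| * g₂) ^ 2) := by
            rw [abs_mul, mul_pow, mul_pow, mul_pow, sq_abs]; ring
        _ ≤ N * χ (P.p ρ) * (T * hamDeriv P.p Gt ρ) :=
          mul_le_mul (hχN _) (key ρ hρ) (by positivity) (by positivity)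
        _ = _ := by ring
    rw [abs_of_nonneg c0] at g0
    rw [div_mul_eq_mul_div, div_le_iff₀ (by positivity)]
    set u := χ (P.p ρ) * g₁
    set v := |deriv χ (P.p ρ) * Gt ρ| * g₂
    have h1 : gNorm r R ρ (χ (P.p ρ) • hamField Gt ρ +
        (deriv χ (P.p ρ) * Gt ρ) • hamField P.p ρ) ^ 2 ≤ 8 * (u ^ 2 + v ^ 2) := by
      calc _ ≤ (2 * (u + v)) ^ 2 := pow_le_pow_left₀ (gNorm_nonneg _ _ _ _) g0 2
        _ ≤ _ := by nlinarith [sq_nonneg (u - v)]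
    have h2 := mul_le_mul_of_nonneg_left h1 hmρ.le
    linarith
  · have hnot : P.p ρ ∉ tsupport χ := fun hmem => by
      have := hχ.support hmem
      exact hρ (abs_le.2 ⟨this.1.le, this.2.le⟩)
    have z1 : χ (P.p ρ) = 0 := image_eq_zero_of_notMem_tsupport hnot
    have z2 : deriv χ (P.p ρ) = 0 := by
      rw [(notMem_tsupport_iff_eventuallyEq.1 hnot).deriv_eq]
      exact deriv_const _ _
    rw [z1, z2]
    simp [gNorm]

end EscapeFunctions

end Escape

end

/-! ### Escape functions that vanish near the convex hull -/

theorem mainTheorem8 (n : ℕ) (r R m₀ : Escape.Config n → ℝ)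
    (hscale : Escape.IsScalePair r R) (hm₀ : Escape.IsBaseWeight r R m₀)
    (P : Escape.SemiclassicalOperator n) (hcoeff : P.HasSymbolCoeffs r R m₀)
    (hself : P.FormallySelfAdjoint) (hell : P.Elliptic r m₀)
    (G : Escape.Phase n → ℝ)
    (hGS : Escape.SymbolClass r R (fun ρ => Escape.rTilde r ρ * R ρ.1) G)
    (hGesc : Escape.IsEscapeFunction r R P.p (P.m r m₀) G)
    (hlarge : Escape.LargeAwayFromEnergySurface r R P.p (P.m r m₀)) :
    (∃ ε₁ : ℝ, 0 < ε₁ ∧ ∀ ε : ℝ, 0 < ε → ε ≤ ε₁ →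
      Escape.EscapesOnShell P.p (P.m r m₀) G ε) ∧
    ∀ ε₀ : ℝ, 0 < ε₀ → Escape.EscapesOnShell P.p (P.m r m₀) G ε₀ →
    ∀ K : Set (Escape.Phase n), IsCompact K → K ⊆ Escape.shell P.p ε₀ →
      Escape.trappedSet P.p ε₀ ⊆ K →
      IsCompact (Escape.hull P.p ε₀ K) ∧
      Escape.hull P.p ε₀ K ⊆ Escape.shell P.p ε₀ ∧
      ∀ U ∈ 𝓝ˢ (Escape.hull P.p ε₀ K),
        ∃ Gt : Escape.Phase n → ℝ,
          Escape.SymbolClass r R (fun ρ => Escape.rTilde r ρ * R ρ.1) Gt ∧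
          (∃ B : Set (Escape.Phase n), Bornology.IsBounded B ∧ ∀ ρ, ρ ∉ B → Gt ρ = G ρ) ∧
          (∃ C : ℝ, 0 < C ∧ ∀ ρ ∈ Escape.shell P.p ε₀,
            C⁻¹ * (P.m r m₀ ρ * Escape.gNorm r R ρ (Escape.hamField Gt ρ))
                ≤ Escape.hamDeriv P.p Gt ρ ∧
            Escape.hamDeriv P.p Gt ρ
                ≤ C * (P.m r m₀ ρ * Escape.gNorm r R ρ (Escape.hamField Gt ρ))) ∧
          (∀ ρ ∈ Escape.shell P.p ε₀ \ U, 0 < Escape.hamDeriv P.p Gt ρ) ∧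
          (∀ᶠ ρ in 𝓝ˢ (Escape.hull P.p ε₀ K), Gt ρ = 0) ∧
          ((∃ C : ℝ, 0 < C ∧ ∀ ρ ∈ Escape.shell P.p ε₀,
              C⁻¹ ≤ P.m r m₀ ρ ∧ P.m r m₀ ρ ≤ C) →
            ∀ χ : ℝ → ℝ, Escape.IsEnergyCutoff ε₀ χ →
              Escape.SymbolClass r R (fun ρ => Escape.rTilde r ρ * R ρ.1)
                (fun ρ => χ (P.p ρ) * Gt ρ) ∧
              ∃ C : ℝ, 0 < C ∧ ∀ ρ : Escape.Phase n,
                P.m r m₀ ρ / C *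
                    Escape.gNorm r R ρ
                      (Escape.hamField (fun ν => χ (P.p ν) * Gt ν) ρ) ^ 2
                  ≤ Escape.hamDeriv P.p (fun ν => χ (P.p ν) * Gt ν) ρ) := by
  have hp := P.symbolClass_p hscale hm₀ hcoeff
  have hm1 := P.one_le_m (m₀ := m₀) hscale hm₀
  have hm0 : ∀ ρ, 0 < P.m r m₀ ρ := fun ρ => zero_lt_one.trans_le (hm1 ρ)
  have hrR : ∀ ρ : Escape.Phase n, 0 < Escape.rTilde r ρ * R ρ.1 := fun ρ =>
    zero_lt_one.trans_le (hscale.one_le_rTilde_mul ρ)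
  refine ⟨?_, fun ε₀ _ hesc K hK hKs _ => ?_⟩
  · refine Escape.exists_escapesOnShell hscale hm₀ P ?_ hGesc.2 hlarge
    have h1 := hp.hamDeriv hscale (fun ρ => (hm0 ρ).le) (fun ρ => (hrR ρ).le) hGS
    simpa only [mul_div_cancel_right₀ _ (hrR _).ne'] using h1
  obtain ⟨C₀, hC₀, K', hK', hesc⟩ := hesc
  obtain ⟨Φ, K₁, c, M, hKK, sys⟩ :=
    Escape.exists_isEscapeSystem hscale hm₀ hcoeff hGS.1 hC₀ hK hK' hesc
  have hw : ContDiff ℝ 1 (fun ρ : Escape.Phase n => (P.m r m₀ ρ)⁻¹ • Escape.hamField P.p ρ) :=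
    (((P.contDiff_m hscale hm₀).inv fun ρ => (hm0 ρ).ne').smul
      (Escape.contDiff_hamField hp.1)).of_le (by simp)
  have hhull := Escape.hull_eq_diff_escapeSet sys hw (P.contDiff_m hscale hm₀).continuous hm0
    (fun ρ => by rw [smul_smul, mul_inv_cancel₀ (hm0 ρ).ne', one_smul])
    (hKK.trans interior_subset) hKs
  rw [hhull]
  refine ⟨sys.isCompact_diff_escapeSet hK.isClosed (hKK.trans interior_subset), sdiff_subset,
    fun U hU => ?_⟩
  obtain ⟨Gt, b, hGt, hGtG, hzero, hpos, hquant⟩ := sys.exists_modification hK.isClosed hKK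
    isOpen_interior (subset_interior_iff_mem_nhdsSet.2 hU)
  have hψ := hscale.contDiff_logWeight.continuous
  have hbdd : Bornology.IsBounded {ρ : Escape.Phase n | Escape.logWeight r ρ ≤ b} :=
    (hscale.isCompact_logWeight_le b).isBounded
  have hGtS : Escape.SymbolClass r R (fun ρ => Escape.rTilde r ρ * R ρ.1) Gt :=
    hGS.congr_off_bounded hscale (hscale.contDiff_rTilde.continuous.mul
      (hscale.contDiff_R.continuous.comp continuous_fst)) hrR hGt hbdd
      (fun ρ hρ => hGtG ρ (not_le.1 hρ)) hscale.contDiff_R.continuous hscale.contDiff_r.continuous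
  -- off the compact set `X` both `Gt = G` and the escape estimate hold
  set X := {ρ : Escape.Phase n | Escape.logWeight r ρ ≤ b} ∪ K' with hX
  have hXc : IsCompact X := (hscale.isCompact_logWeight_le b).union hK'
  have heq : ∀ ρ, ρ ∉ X → Gt =ᶠ[𝓝 ρ] G := fun ρ hρ => by
    have : b < Escape.logWeight r ρ := not_le.1 fun h => hρ (Or.inl h)
    filter_upwards [hψ.continuousAt.eventually (lt_mem_nhds this)] with ν hν using hGtG ν hν
  have hescX : ∀ ρ ∈ Escape.shell P.p ε₀, ρ ∉ X →
      P.m r m₀ ρ / C₀ ≤ Escape.hamDeriv P.p G ρ := fun ρ hρ hρX =>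
    hesc ρ ⟨hρ, fun h => hρX (Or.inr h)⟩
  obtain ⟨A, hA, hAX⟩ := hquant X hXc
  obtain ⟨C₁, hC₁, hlow⟩ := Escape.exists_mul_gNorm_hamField_le hscale hm₀ hGS hGt hXc heq hC₀ hA
    hescX fun ρ hρ => (hAX ρ hρ).1
  obtain ⟨C₂, hC₂, hup⟩ := hp.exists_abs_fderiv_le hscale fun ρ => (hm0 ρ).le
  refine ⟨Gt, hGtS, ⟨_, hbdd, fun ρ hρ => hGtG ρ (not_le.1 hρ)⟩,
    ⟨C₁ + C₂, by positivity, fun ρ hρ => ?_⟩, fun ρ hρ => ?_, hzero, ?_⟩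
  · have hg := mul_nonneg (hm0 ρ).le (Escape.gNorm_nonneg r R ρ (Escape.hamField Gt ρ))
    have h1 := hlow ρ hρ
    have h2 : 0 ≤ Escape.hamDeriv P.p Gt ρ :=
      (mul_nonneg_iff_of_pos_left hC₁).1 (hg.trans h1)
    constructor
    · rw [inv_mul_le_iff₀ (by positivity)]
      nlinarith
    · rw [Escape.hamDeriv_antisymm (hp.1.differentiable (by simp) ρ)
        (hGt.differentiable (by simp) ρ)]
      have h3 := (neg_le_abs _).trans (hup ρ (Escape.hamField Gt ρ))
      rw [mul_assoc] at h3
      nlinarith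
  · have h1 := hpos ρ ⟨hρ.1, fun h => hρ.2 (interior_subset h)⟩
    rw [Escape.fderiv_smul_hamField] at h1
    exact (mul_pos_iff_of_pos_left (inv_pos.2 (hm0 ρ))).1 h1
  · rintro ⟨D, hD, hmD⟩ χ hχ
    refine ⟨?_, Escape.exists_cutoff_estimate hscale hm₀ hcoeff hGtS hC₀ hA hC₁
      (fun ρ hρ => (hmD ρ hρ).2) (fun ρ hρ hρX => ?_) (fun ρ hρ => (hAX ρ hρ).2) hlow hχ⟩
    · have h1 := (hp.comp_cutoff hscale hχ.smooth hχ.support (fun ρ hρ => (hmD ρ hρ).2)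
        fun ρ => (hm0 ρ).le).mul hscale hGtS
      simpa only [one_mul] using h1
    · rw [Escape.hamDeriv, (heq ρ hρX).fderiv_eq]
      exact hescX ρ hρ hρX
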